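/- An SW-category (subtractive Waldhausen category) is a small category $\mathcal C$ with an initial object $\emptyset$, subcategories of cofibrations ($\hookrightarrow$), of fibrations and of weak equivalences, each containing all isomorphisms, and a class of subtraction sequences $X\hookrightarrow Y\xleftarrow{\circ}Y\smallsetminus X$ (a cofibration and a fibration), such that: cofibrations and fibrations have pullbacks along all maps and are stable under them; pushouts of pairs of cofibrations exist, consist of cofibrations and are Cartesian; every cofibration is part of a subtraction sequence, and either map of a subtraction sequence determines the other up to unique isomorphism; $X=X\leftarrow\emptyset$ and $\emptyset\to X=X$ are subtraction sequences; subtraction sequences are stable under base change; a Cartesian square of cofibrations induces a unique compatible map on complements, which is a cofibration; weak equivalences can be glued along pushouts of cofibrations; and in a map of subtraction sequences that is a weak equivalence on $X$ and on $Y$ the map on $Y\smallsetminus X$ is a weak equivalence. Its $K$-theory is $K^{SW}(\mathcal C)=\Omega_\emptyset|N_\bullet w\tilde S_\bullet\mathcal C|$, where $w\tilde S_n\mathcal C$ is the category of functors $X\colon\{(i,j)\in[n]^{op}\times[n]: i\le j\}\to\mathcal C$ with $X_{i,i}\cong\emptyset$ such that $X_{i,j}\hookrightarrow X_{i,k}\xleftarrow{\circ}X_{j,k}$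 is a subtraction sequence for all $i\le j\le k$, and of natural transformations that are componentwise weak equivalences. Let $\mathcal C$ be an SW-category in which all cofibrations are monomorphisms and which satisfies $(*)$ if $X\hookrightarrow Y\xleftarrow{\circ}Y\smallsetminus X$ is a subtraction sequence and $Z\to Y$ a map such that $X\times_YZ\to X$ and $(Y\smallsetminus X)\times_YZ\to Y\smallsetminus X$ are weak equivalences, then $Z\to Y$ is a weak equivalence. Let $\mathcal C'$ be the associated squares category (double category): its horizontal maps are the cofibrations, its vertical maps are all maps of $\mathcal C$, its basepoint $O$ is $\emptyset$, and its distinguished squares are the commutative squares with horizontal maps $A\hookrightarrow B$, $C\hookrightarrow D$ and vertical maps $A\to C$, $B\to D$ such that $A\to B\times_DC$ is a weak equivalence, and such that $B\to D$ induces a map $B\smallsetminus A\to D\smallsetminus C$ that is a weak equivalence. Its $K$-theory is $K^\square(\mathcal C')=\Omega_O|N_\bullet T_\bullet\mathcal C'|$, where $T_n\mathcal C'$ is the category of functors from $[n]$ to the horizontal category, and of vertical transformations all of whose squares are distinguished. Then there is a homotopy equivalence $K^{SW}(\mathcal C)\simeq K^\square(\mathcal C')$. If moreover coproducts of subtraction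 sequences are subtraction sequences, so that coproducts define $\Gamma$-spaces (infinite loop space structures) on both sides, then these $\Gamma$-spaces are equivalent. Here the $\Gamma$-spaces send a finite set $S$ to the $K$-theory of the category of sum diagrams (functors $A$ from the subsets of $S$ to $\mathcal C$ with $A(\emptyset)$ initial and $A(U\sqcup V)=A(U)\sqcup A(V)$) with the pointwise structures, and equivalent means: connected by a zigzag of natural transformations that are homotopy equivalences on every finite set $S$. -/

import Mathlib

open CategoryTheory CategoryTheory.Limits Opposite
open scoped Simplicial ContinuousMap

universe v u

noncomputable section

namespace SquaresK

/-! ## Squares categories -/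

/-- A squares category: a small double category whose 2-cells are determined by their boundary
(the distinguished squares), with an object `O` that is initial both for the horizontal
category `M` and for the vertical category `E`. The square
`dist f f' g g'` has top edge `f`, bottom edge `f'`, left edge `g` and right edge `g'`. -/
structure SquaresCategory where
  Ob : Type u
  E : Category.{v} Ob
  M : Category.{v} Ob
  dist : ∀ {A B C D : Ob}, M.Hom A B → M.Hom C D → E.Hom A C → E.Hom B D → Prop
  dist_vcomp : ∀ {A B C D X Y : Ob} {f : M.Hom A B} {f' : M.Hom C D} {f'' : M.Hom X Y}
    {g : E.Hom A C} {g' : E.Hom B D} {h : E.Hom C X} {h' : E.Hom D Y},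
    dist f f' g g' → dist f' f'' h h' → dist f f'' (E.comp g h) (E.comp g' h')
  dist_hcomp : ∀ {A B C X Y Z : Ob} {f : M.Hom A B} {k : M.Hom B C} {f' : M.Hom X Y}
    {k' : M.Hom Y Z} {g : E.Hom A X} {g' : E.Hom B Y} {g'' : E.Hom C Z},
    dist f f' g g' → dist k k' g' g'' → dist (M.comp f k) (M.comp f' k') g g''
  dist_vid : ∀ {A B : Ob} (f : M.Hom A B), dist f f (E.id A) (E.id B)
  dist_hid : ∀ {A B : Ob} (g : E.Hom A B), dist (M.id A) (M.id B) g g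
  O : Ob
  initial_M : ∀ X : Ob, Nonempty (Unique (M.Hom O X))
  initial_E : ∀ X : Ob, Nonempty (Unique (E.Hom O X))

namespace SquaresCategory

/-- The horizontal category `M` of a squares category. -/
def Hor (S : SquaresCategory.{v, u}) : Type u := S.Ob

instance (S : SquaresCategory.{v, u}) : Category.{v} S.Hor := S.M

/-- The basepoint as an object of the horizontal category. -/
def horO (S : SquaresCategory.{v, u}) : S.Hor := S.O

/-- A functor of squares categories. -/
structure Hom (S T : SquaresCategory.{v, u}) where
  obj : S.Ob → T.Ob
  mapE : ∀ {A B : S.Ob}, S.E.Hom A B → T.E.Hom (obj A) (obj B)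
  mapM : ∀ {A B : S.Ob}, S.M.Hom A B → T.M.Hom (obj A) (obj B)
  mapE_id : ∀ A : S.Ob, mapE (S.E.id A) = T.E.id (obj A)
  mapM_id : ∀ A : S.Ob, mapM (S.M.id A) = T.M.id (obj A)
  mapE_comp : ∀ {A B C : S.Ob} (f : S.E.Hom A B) (g : S.E.Hom B C),
    mapE (S.E.comp f g) = T.E.comp (mapE f) (mapE g)
  mapM_comp : ∀ {A B C : S.Ob} (f : S.M.Hom A B) (g : S.M.Hom B C),
    mapM (S.M.comp f g) = T.M.comp (mapM f) (mapM g)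
  map_dist : ∀ {A B C D : S.Ob} {f : S.M.Hom A B} {f' : S.M.Hom C D} {g : S.E.Hom A C}
    {g' : S.E.Hom B D}, S.dist f f' g g' → T.dist (mapM f) (mapM f') (mapE g) (mapE g')
  obj_O : obj S.O = T.O

instance : Category SquaresCategory.{v, u} where
  Hom := Hom
  id S :=
    { obj := fun A => A
      mapE := fun f => f
      mapM := fun f => f
      mapE_id := fun _ => rfl
      mapM_id := fun _ => rfl
      mapE_comp := fun _ _ => rfl
      mapM_comp := fun _ _ => rfl
      map_dist := fun h => h
      obj_O := rfl }
  comp F G :=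
    { obj := fun A => G.obj (F.obj A)
      mapE := fun f => G.mapE (F.mapE f)
      mapM := fun f => G.mapM (F.mapM f)
      mapE_id := fun A => by rw [F.mapE_id, G.mapE_id]
      mapM_id := fun A => by rw [F.mapM_id, G.mapM_id]
      mapE_comp := fun f g => by rw [F.mapE_comp, G.mapE_comp]
      mapM_comp := fun f g => by rw [F.mapM_comp, G.mapM_comp]
      map_dist := fun h => G.map_dist (F.map_dist h)
      obj_O := by rw [F.obj_O, G.obj_O] }

/-- The underlying functor on horizontal categories. -/
def Hom.hor {S T : SquaresCategory.{v, u}} (F : S ⟶ T) : S.Hor ⥤ T.Hor where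
  obj A := Hom.obj F A
  map f := Hom.mapM F f
  map_id A := Hom.mapM_id F A
  map_comp f g := Hom.mapM_comp F f g

/-- A horizontal functor `D ⥤ S`. -/
structure HFun (D : Type) [Category.{0} D] (S : SquaresCategory.{v, u}) where
  fn : D ⥤ S.Hor

/-- A vertical distinguished transformation between horizontal functors. -/
@[ext]
structure VertTrans {D : Type} [Category.{0} D] {S : SquaresCategory.{v, u}}
    (F G : HFun D S) where
  app : ∀ d : D, S.E.Hom (F.fn.obj d) (G.fn.obj d)
  dist : ∀ {d d' : D} (f : d ⟶ d'), S.dist (F.fn.map f) (G.fn.map f) (app d) (app d')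

/-- The category of horizontal functors and vertical distinguished transformations. -/
instance (D : Type) [Category.{0} D] (S : SquaresCategory.{v, u}) : Category.{v} (HFun D S) where
  Hom F G := VertTrans F G
  id F := ⟨fun d => S.E.id (F.fn.obj d), fun f => S.dist_vid (F.fn.map f)⟩
  comp α β := ⟨fun d => S.E.comp (α.app d) (β.app d),
    fun f => S.dist_vcomp (α.dist f) (β.dist f)⟩
  id_comp α := VertTrans.ext (funext fun d => S.E.id_comp (α.app d))
  comp_id α := VertTrans.ext (funext fun d => S.E.comp_id (α.app d))
  assoc α β γ := VertTrans.ext (funext fun d => S.E.assoc (α.app d) (β.app d) (γ.app d))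

/-- Restriction of horizontal functors along a functor of index categories. -/
def HFun.precomp {D D' : Type} [Category.{0} D] [Category.{0} D'] (p : D ⥤ D')
    (S : SquaresCategory.{v, u}) : HFun D' S ⥤ HFun D S where
  obj F := ⟨p ⋙ F.fn⟩
  map α := ⟨fun d => VertTrans.app α (p.obj d), fun f => VertTrans.dist α (p.map f)⟩

/-- A functor of squares categories acts on horizontal functors. -/
def HFun.postcomp (D : Type) [Category.{0} D] {S T : SquaresCategory.{v, u}} (F : S ⟶ T) :
    HFun D S ⥤ HFun D T where
  obj X := ⟨X.fn ⋙ Hom.hor F⟩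
  map α := ⟨fun d => Hom.mapE F (VertTrans.app α d), fun f => Hom.map_dist F (VertTrans.dist α f)⟩
  map_id X := VertTrans.ext (funext fun d => Hom.mapE_id F (X.fn.obj d))
  map_comp α β := VertTrans.ext (funext fun d =>
    Hom.mapE_comp F (VertTrans.app α d) (VertTrans.app β d))

end SquaresCategory

/-- The functor `[m] ⥤ [n]` given by a morphism of the simplex category. -/
abbrev ordFunctor {m n : SimplexCategory} (f : m ⟶ n) : Fin (m.len + 1) ⥤ Fin (n.len + 1) :=
  f.toOrderHom.monotone.functor

open SquaresCategory in
/-- The simplicial category `T_• S`, where `T_n S` is the category of horizontal functors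
`[n] ⥤ S`. -/
def simplicialT (S : SquaresCategory.{v, u}) : SimplexCategoryᵒᵖ ⥤ Cat.{v, max u v} where
  obj n := Cat.of (HFun (Fin (n.unop.len + 1)) S)
  map f := (HFun.precomp (ordFunctor f.unop) S).toCatHom
  map_id _ := rfl
  map_comp _ _ := rfl

/-! ## Realizations and loop spaces -/

/-- A simplicial set with a chosen vertex. -/
structure PointedSSet where
  X : SSet.{u}
  pt : X.obj (op ⦋0⦌)

/-- A map of simplicial sets that preserves the chosen vertices. -/
@[ext]
structure PointedSSet.Hom (X Y : PointedSSet.{u}) where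
  map : X.X ⟶ Y.X
  map_pt : map.app (op ⦋0⦌) X.pt = Y.pt

instance : Category PointedSSet.{u} where
  Hom := PointedSSet.Hom
  id X := ⟨𝟙 X.X, rfl⟩
  comp f g := ⟨f.map ≫ g.map, by
    rw [← g.map_pt, ← f.map_pt]; rfl⟩

/-- The nerve of a simplicial category `X` is the bisimplicial set `N_m X_n`; this is its
diagonal simplicial set, whose geometric realization is the realization of the
bisimplicial set. -/
def diagNerve : (SimplexCategoryᵒᵖ ⥤ Cat.{v, u}) ⥤ SSet.{max u v} where
  obj X :=
    { obj := fun n => (nerve (X.obj n)).obj n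
      map := fun {m n} f => (nerve (X.obj m)).map f ≫ (nerveMap (X.map f).toFunctor).app n
      map_id := fun n => by
        rw [X.map_id]
        rfl
      map_comp := fun f g => by
        rw [X.map_comp]
        rfl }
  map {X Y} α :=
    { app := fun n => (nerveMap (α.app n).toFunctor).app n
      naturality := fun m n f => by
        ext x
        exact congrArg (fun F => (nerveMap (Cat.Hom.toFunctor F)).app n
          ((nerve (X.obj m)).map f x)) (α.naturality f) }
  map_id X := rfl
  map_comp α β := rfl

/-- The point of the geometric realization given by a vertex. -/
def realizationPoint (X : SSet.{u}) (x : X.obj (op ⦋0⦌)) : SSet.toTop.obj X :=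
  TopCat.toSSetObj₀Equiv ((sSetTopAdj.unit.app X).app (op ⦋0⦌) x)

lemma realizationPoint_map {X Y : SSet.{u}} (f : X ⟶ Y) (x : X.obj (op ⦋0⦌)) :
    SSet.toTop.map f (realizationPoint X x) = realizationPoint Y (f.app (op ⦋0⦌) x) := by
  have h := congrArg (fun t => t.app (op ⦋0⦌) x) (sSetTopAdj.unit.naturality f)
  exact congrArg TopCat.toSSetObj₀Equiv h.symm

/-- The loop space, at the chosen vertex, of the geometric realization of a pointed
simplicial set, with the compact-open topology. -/
def loopRealization : PointedSSet.{u} ⥤ TopCat.{u} where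
  obj X := TopCat.of (Path (realizationPoint X.X X.pt) (realizationPoint X.X X.pt))
  map {X Y} f := TopCat.ofHom
    { toFun := fun γ => (γ.map (SSet.toTop.map f.map).hom.continuous).cast
        (by rw [← f.map_pt]; exact (realizationPoint_map f.map X.pt).symm)
        (by rw [← f.map_pt]; exact (realizationPoint_map f.map X.pt).symm)
      continuous_toFun := by
        have h : Continuous fun γ : Path (realizationPoint X.X X.pt) (realizationPoint X.X X.pt) =>
            (SSet.toTop.map f.map).hom.comp γ.toContinuousMap :=
          (ContinuousMap.continuous_postcomp (SSet.toTop.map f.map).hom).comp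
            continuous_induced_dom
        exact continuous_induced_rng.2 h }
  map_id X := by
    ext γ t
    exact congrArg (fun g => g (γ t)) (SSet.toTop.map_id X.X)
  map_comp f g := by
    ext γ t
    exact congrArg (fun h => h (γ t)) (SSet.toTop.map_comp f.map g.map)

/-! ## `K`-theory of squares categories -/

open SquaresCategory in
/-- `|N_• T_• S|` as a simplicial set, pointed at `O ∈ N_0 T_0 S`. -/
def pointedT : SquaresCategory.{v, u} ⥤ PointedSSet.{max u v} where
  obj S :=
    { X := diagNerve.obj (simplicialT S)
      pt := ComposableArrows.mk₀
        (⟨(Functor.const _).obj S.horO⟩ : HFun (Fin (0 + 1)) S) }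
  map {S T} F :=
    { map := diagNerve.map
        { app := fun n => (HFun.postcomp (Fin (n.unop.len + 1)) F).toCatHom
          naturality := fun _ _ _ => rfl }
      map_pt := by
        refine ComposableArrows.ext₀ ?_
        have h : (Functor.const (Fin (0 + 1))).obj S.horO ⋙ SquaresCategory.Hom.hor F
            = (Functor.const (Fin (0 + 1))).obj T.horO := by
          have hO : T.horO = (SquaresCategory.Hom.hor F).obj S.horO :=
            (SquaresCategory.Hom.obj_O F).symm
          rw [hO]
          exact CategoryTheory.Functor.ext (fun _ => rfl)
            (fun _ _ _ => by
              have h : (SquaresCategory.Hom.hor F).map (𝟙 S.horO) =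
                  𝟙 _ ≫ 𝟙 _ ≫ 𝟙 _ := by
                rw [CategoryTheory.Functor.map_id, Category.id_comp, Category.id_comp]
              exact h)
        exact congrArg HFun.mk h }
  map_id S := rfl
  map_comp F G := rfl

/-- The `K`-theory space `Ω_O |N_• T_• S|` of a squares category. -/
def squaresK : SquaresCategory.{v, u} ⥤ TopCat.{max u v} :=
  pointedT ⋙ loopRealization

/-! ## Subtractive Waldhausen categories -/

/-- The data of a subtractive Waldhausen category: subcategories of cofibrations, of fibrations
(complement maps) and of weak equivalences, a class of subtraction sequences
`X ⟶ Y ⟵ U` (with `U = Y ∖ X`), and an object `O` (the initial object `∅`). -/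
structure SWData (C : Type u) [Category.{v} C] where
  cof : MorphismProperty C
  fib : MorphismProperty C
  weq : MorphismProperty C
  cof_mul : cof.IsMultiplicative
  fib_mul : fib.IsMultiplicative
  weq_mul : weq.IsMultiplicative
  sub : ∀ {X Y U : C}, (X ⟶ Y) → (U ⟶ Y) → Prop
  O : C
  -- the sequence `∅ = ∅ ⟵ ∅`, needed for the basepoint
  sub_O : sub (𝟙 O) (𝟙 O)

namespace SWData

variable {C : Type u} [Category.{v} C]

/-- The axioms of a subtractive category. -/
structure IsSubtractive (W : SWData C) : Prop where
  initial : Nonempty (IsInitial W.O)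
  cof_of_iso : MorphismProperty.isomorphisms C ≤ W.cof
  fib_of_iso : MorphismProperty.isomorphisms C ≤ W.fib
  -- pullbacks along cofibrations and fibrations
  cof_hasPullback : ∀ {X Y Z : C} (i : X ⟶ Y) (f : Z ⟶ Y), W.cof i → HasPullback f i
  fib_hasPullback : ∀ {U Y Z : C} (j : U ⟶ Y) (f : Z ⟶ Y), W.fib j → HasPullback f j
  cof_baseChange : W.cof.IsStableUnderBaseChange
  fib_baseChange : W.fib.IsStableUnderBaseChange
  -- pushouts of pairs of cofibrations
  cof_hasPushout : ∀ {X Y Z : C} (i : X ⟶ Y) (i' : X ⟶ Z), W.cof i → W.cof i' → HasPushout i i'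
  cof_pushout : ∀ {X Y Z P : C} {i : X ⟶ Y} {i' : X ⟶ Z} {k : Y ⟶ P} {k' : Z ⟶ P},
    IsPushout i i' k k' → W.cof i → W.cof i' → W.cof k ∧ W.cof k' ∧ IsPullback i i' k k'
  -- subtraction sequences consist of a cofibration and a fibration, and either of the two maps
  -- determines the other up to unique isomorphism
  sub_cof : ∀ {X Y U : C} {i : X ⟶ Y} {j : U ⟶ Y}, W.sub i j → W.cof i
  sub_fib : ∀ {X Y U : C} {i : X ⟶ Y} {j : U ⟶ Y}, W.sub i j → W.fib j
  exists_sub : ∀ {X Y : C} (i : X ⟶ Y), W.cof i → ∃ (U : C) (j : U ⟶ Y), W.sub i j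
  sub_unique : ∀ {X Y U U' : C} {i : X ⟶ Y} {j : U ⟶ Y} {j' : U' ⟶ Y},
    W.sub i j → W.sub i j' → ∃! e : U ≅ U', e.hom ≫ j' = j
  sub_unique' : ∀ {X X' Y U : C} {i : X ⟶ Y} {i' : X' ⟶ Y} {j : U ⟶ Y},
    W.sub i j → W.sub i' j → ∃! e : X ≅ X', e.hom ≫ i' = i
  sub_id : ∀ {X : C} (f : W.O ⟶ X), W.sub (𝟙 X) f
  sub_initial : ∀ {X : C} (f : W.O ⟶ X), W.sub f (𝟙 X)
  -- subtraction sequences are stable under base change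
  sub_baseChange : ∀ {X Y U Z X' U' : C} {i : X ⟶ Y} {j : U ⟶ Y} {f : Z ⟶ Y}
    {i' : X' ⟶ Z} {p : X' ⟶ X} {j' : U' ⟶ Z} {q : U' ⟶ U},
    W.sub i j → IsPullback p i' i f → IsPullback q j' j f → W.sub i' j'
  -- subtraction is functorial for Cartesian squares of cofibrations
  sub_cartesian : ∀ {X Y X' Y' U U' : C} {i : X ⟶ Y} {i' : X' ⟶ Y'} {a : X ⟶ X'} {b : Y ⟶ Y'}
    {j : U ⟶ Y} {j' : U' ⟶ Y'}, IsPullback i a b i' → W.cof a → W.cof b →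
    W.sub i j → W.sub i' j' →
    ∃ c : U ⟶ U', c ≫ j' = j ≫ b ∧ W.cof c ∧ ∀ c' : U ⟶ U', c' ≫ j' = j ≫ b → c' = c

/-- The axioms of an SW-category (subtractive Waldhausen category). -/
structure IsSW (W : SWData C) : Prop extends W.IsSubtractive where
  weq_of_iso : MorphismProperty.isomorphisms C ≤ W.weq
  -- gluing of weak equivalences along pushouts of cofibrations
  weq_gluing : ∀ {X Y Z P X' Y' Z' P' : C} {i : X ⟶ Y} {k : X ⟶ Z} {l : Y ⟶ P} {m : Z ⟶ P}
    {i' : X' ⟶ Y'} {k' : X' ⟶ Z'} {l' : Y' ⟶ P'} {m' : Z' ⟶ P'}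
    {a : X ⟶ X'} {b : Y ⟶ Y'} {c : Z ⟶ Z'} {d : P ⟶ P'},
    IsPushout i k l m → IsPushout i' k' l' m' → W.cof i → W.cof k → W.cof i' → W.cof k' →
    i ≫ b = a ≫ i' → k ≫ c = a ≫ k' → l ≫ d = b ≫ l' → m ≫ d = c ≫ m' →
    W.weq a → W.weq b → W.weq c → W.weq d
  -- subtraction of weak equivalences
  weq_subtraction : ∀ {X Y U X' Y' U' : C} {i : X ⟶ Y} {j : U ⟶ Y} {i' : X' ⟶ Y'} {j' : U' ⟶ Y'}
    {a : X ⟶ X'} {b : Y ⟶ Y'} {c : U ⟶ U'}, W.sub i j → W.sub i' j' →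
    i ≫ b = a ≫ i' → j ≫ b = c ≫ j' → W.weq a → W.weq b → W.weq c

/-- Condition `(*)`: weak equivalences over both parts of a subtraction sequence
`X ⟶ Y ⟵ Y ∖ X` can be glued, i.e. if `X ×_Y Z ⟶ X` and `(Y ∖ X) ×_Y Z ⟶ Y ∖ X` are weak
equivalences, then so is `Z ⟶ Y`. -/
def Star (W : SWData C) : Prop :=
  ∀ {X Y U Z X' U' : C} {i : X ⟶ Y} {j : U ⟶ Y} {f : Z ⟶ Y}
    {i' : X' ⟶ Z} {p : X' ⟶ X} {j' : U' ⟶ Z} {q : U' ⟶ U},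
    W.sub i j → IsPullback p i' i f → IsPullback q j' j f → W.weq p → W.weq q → W.weq f

/-- All cofibrations are monomorphisms. -/
def MonoCof (W : SWData C) : Prop :=
  ∀ {X Y : C} (i : X ⟶ Y), W.cof i → Mono i

/-- The distinguished squares of the associated squares category: commutative squares, with top
and bottom edges `f : A ⟶ B`, `f' : A' ⟶ B'` and vertical edges `g : A ⟶ A'`, `g' : B ⟶ B'`,
such that `A ⟶ B ×_{B'} A'` is a weak equivalence, and such that there is an induced map
`B ∖ A ⟶ B' ∖ A'` and it is a weak equivalence. -/
def Dist (W : SWData C) {A B A' B' : C} (f : A ⟶ B) (f' : A' ⟶ B') (g : A ⟶ A')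
    (g' : B ⟶ B') : Prop :=
  ∃ w : f ≫ g' = g ≫ f',
    (∃ (P : C) (p : P ⟶ B) (q : P ⟶ A') (h : IsPullback p q g' f'), W.weq (h.lift f g w)) ∧
    (∃ (U U' : C) (j : U ⟶ B) (j' : U' ⟶ B') (c : U ⟶ U'),
      W.sub f j ∧ W.sub f' j' ∧ c ≫ j' = j ≫ g' ∧ W.weq c)

section

variable {W : SWData C}

lemma weq_of_isIso (hW : W.IsSW) {X Y : C} (f : X ⟶ Y) [IsIso f] : W.weq f :=
  hW.weq_of_iso _ ((MorphismProperty.isomorphisms.iff _).2 inferInstance)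

lemma weq_comp (W : SWData C) {X Y Z : C} {f : X ⟶ Y} {g : Y ⟶ Z} (hf : W.weq f)
    (hg : W.weq g) : W.weq (f ≫ g) :=
  W.weq_mul.comp_mem f g hf hg

lemma cof_comp (W : SWData C) {X Y Z : C} {f : X ⟶ Y} {g : Y ⟶ Z} (hf : W.cof f)
    (hg : W.cof g) : W.cof (f ≫ g) :=
  W.cof_mul.comp_mem f g hf hg

/-- Subtraction sequences are invariant under isomorphism. -/
lemma sub_iso (hW : W.IsSubtractive) {X Y U X' U' : C} {i : X ⟶ Y} {j : U ⟶ Y}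
    (h : W.sub i j) (a : X' ≅ X) (b : U' ≅ U) : W.sub (a.hom ≫ i) (b.hom ≫ j) :=
  hW.sub_baseChange (f := 𝟙 Y) (p := a.hom) (q := b.hom) h
    (IsPullback.of_horiz_isIso ⟨by simp⟩) (IsPullback.of_horiz_isIso ⟨by simp⟩)

/-- The complement of an isomorphism is initial. -/
lemma iso_O_of_sub_isIso (hW : W.IsSubtractive) {X Y U : C} {i : X ⟶ Y} {j : U ⟶ Y} [IsIso i]
    (h : W.sub i j) : Nonempty (U ≅ W.O) := by
  obtain ⟨I⟩ := hW.initial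
  have h' := sub_iso hW h (asIso i).symm (Iso.refl U)
  simp only [Iso.symm_hom, asIso_inv, IsIso.inv_hom_id, Iso.refl_hom, Category.id_comp] at h'
  obtain ⟨e, -⟩ := hW.sub_unique h' (hW.sub_id (I.to Y))
  exact ⟨e⟩

/-- If the closed part is initial, then the open part is everything. -/
lemma isIso_of_sub_initial (hW : W.IsSubtractive) {X Y U : C} {i : X ⟶ Y} {j : U ⟶ Y}
    (h : W.sub i j) (e : X ≅ W.O) : IsIso j := by
  have h' := sub_iso hW h e.symm (Iso.refl U)
  simp only [Iso.refl_hom, Category.id_comp] at h'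
  obtain ⟨e, he, -⟩ := hW.sub_unique h' (hW.sub_initial _)
  have : j = e.hom := by simpa using he.symm
  rw [this]; infer_instance

/-- If the open part is initial, then the closed part is everything. -/
lemma isIso_of_sub_initial' (hW : W.IsSubtractive) {X Y U : C} {i : X ⟶ Y} {j : U ⟶ Y}
    (h : W.sub i j) (e : U ≅ W.O) : IsIso i := by
  have h' := sub_iso hW h (Iso.refl X) e.symm
  simp only [Iso.refl_hom, Category.id_comp] at h'
  obtain ⟨e, he, -⟩ := hW.sub_unique' h' (hW.sub_id _)
  have : i = e.hom := by simpa using he.symm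
  rw [this]; infer_instance

/-- The initial object is strict. -/
lemma iso_O_of_hom (hW : W.IsSubtractive) {R : C} (f : R ⟶ W.O) : Nonempty (R ≅ W.O) := by
  obtain ⟨I⟩ := hW.initial
  have h0 : W.sub (𝟙 W.O) (𝟙 W.O) := hW.sub_id _
  have h : W.sub (𝟙 R) (𝟙 R) := hW.sub_baseChange h0
    (IsPullback.of_vert_isIso (f := 𝟙 _) (fst := f) (snd := 𝟙 R) (g := f) ⟨by simp⟩)
    (IsPullback.of_vert_isIso (f := 𝟙 _) (fst := f) (snd := 𝟙 R) (g := f) ⟨by simp⟩)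
  exact iso_O_of_sub_isIso hW h

/-- The two parts of a subtraction sequence are disjoint. -/
lemma disjoint_of_sub (hW : W.IsSubtractive) (hm : W.MonoCof) {X Y U P : C} {i : X ⟶ Y}
    {j : U ⟶ Y} (h : W.sub i j) {p : P ⟶ X} {q : P ⟶ U} (hc : p ≫ i = q ≫ j) :
    Nonempty (P ≅ W.O) := by
  have := hm i (hW.sub_cof h)
  have := hW.fib_hasPullback j i (hW.sub_fib h)
  have h1 : W.sub (𝟙 X) (pullback.fst i j) := hW.sub_baseChange h
    (IsKernelPair.id_of_mono i) (IsPullback.of_hasPullback i j).flip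
  obtain ⟨e⟩ := iso_O_of_sub_isIso hW h1
  exact iso_O_of_hom hW (pullback.lift p q hc ≫ e.hom)

lemma mono_of_sub (hW : W.IsSubtractive) (hm : W.MonoCof) {X Y U : C} {i : X ⟶ Y}
    {j : U ⟶ Y} (h : W.sub i j) : Mono j := by
  have := hW.fib_hasPullback j j (hW.sub_fib h)
  have := hW.cof_hasPullback i j (hW.sub_cof h)
  have h1 : W.sub (pullback.fst j i) (pullback.fst j j) := hW.sub_baseChange h
    (IsPullback.of_hasPullback j i).flip (IsPullback.of_hasPullback j j).flip
  obtain ⟨e⟩ := disjoint_of_sub hW hm h (pullback.condition (f := j) (g := i)).symm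
  have h2 : IsIso (pullback.fst j j) := isIso_of_sub_initial hW h1 e
  have h3 : pullback.fst j j = pullback.snd j j := by
    have : pullback.diagonal j ≫ pullback.fst j j = 𝟙 U := pullback.diagonal_fst j
    have h4 : pullback.diagonal j = inv (pullback.fst j j) := by
      rw [← cancel_mono (pullback.fst j j), this, IsIso.inv_hom_id]
    have h5 : pullback.diagonal j ≫ pullback.snd j j = 𝟙 U := pullback.diagonal_snd j
    rw [h4, IsIso.inv_comp_eq, Category.comp_id] at h5
    exact h5.symm
  refine ⟨fun a b hab => ?_⟩
  rw [← pullback.lift_fst a b hab, h3, pullback.lift_snd]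

/-- In a distinguished square the map `A ⟶ B ×_{B'} A'` is even an isomorphism. -/
lemma Dist.isPullback (hW : W.IsSubtractive) (hm : W.MonoCof) {A B A' B' : C} {f : A ⟶ B}
    {f' : A' ⟶ B'} {g : A ⟶ A'} {g' : B ⟶ B'} (h : W.Dist f f' g g') :
    IsPullback f g g' f' := by
  obtain ⟨w, ⟨P, p, q, hP, -⟩, U, U', j, j', c, hj, hj', hc, -⟩ := h
  have := hm f (hW.sub_cof hj)
  have hp : W.cof p := hW.cof_baseChange.of_isPullback hP.flip (hW.sub_cof hj')
  have := hm p hp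
  set a := hP.lift f g w with ha
  have hap : a ≫ p = f := hP.lift_fst _ _ _
  have := hW.fib_hasPullback j p (hW.sub_fib hj)
  -- the complement of `a`
  have hsub : W.sub a (pullback.fst p j) := by
    refine hW.sub_baseChange (p := 𝟙 A) (f := p) hj ?_ (IsPullback.of_hasPullback p j).flip
    refine IsPullback.of_isLimit' ⟨by simp [hap]⟩ (PullbackCone.IsLimit.mk _
      (fun s => s.fst) (fun s => by simp) (fun s => ?_) (fun s m h1 _ => by simpa using h1))
    rw [← cancel_mono p, Category.assoc, hap]
    exact s.condition
  have hd : pullback.fst p j ≫ p ≫ g' = pullback.snd p j ≫ c ≫ j' := by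
    rw [hc, ← Category.assoc, pullback.condition, Category.assoc]
  obtain ⟨e⟩ := disjoint_of_sub hW hm hj' (p := pullback.fst p j ≫ q)
    (q := pullback.snd p j ≫ c) (by rw [Category.assoc, ← hP.w, hd, Category.assoc])
  have : IsIso a := isIso_of_sub_initial' hW hsub e
  exact hP.of_iso (asIso a).symm (Iso.refl _) (Iso.refl _) (Iso.refl _)
    (by simp [hap]) (by simp [ha]) (by simp) (by simp)

/-- In a distinguished square the induced map on complements is a weak equivalence, for any
choice of the complements. -/
lemma Dist.weq_snd (hW : W.IsSW) (hm : W.MonoCof) {A B A' B' : C} {f : A ⟶ B}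
    {f' : A' ⟶ B'} {g : A ⟶ A'} {g' : B ⟶ B'} (h : W.Dist f f' g g') {V K : C} {k : V ⟶ B'}
    {r : K ⟶ B} {s : K ⟶ V} (hk : W.sub f' k) (hK : IsPullback r s g' k) : W.weq s := by
  have hP := h.isPullback hW.toIsSubtractive hm
  obtain ⟨w, -, U, U', j, j', c, hj, hj', hc, hcw⟩ := h
  have hr : W.sub f r := hW.sub_baseChange hk hP.flip hK.flip
  obtain ⟨e, he, -⟩ := hW.sub_unique hr hj
  obtain ⟨e', he', -⟩ := hW.sub_unique hj' hk
  have := mono_of_sub hW.toIsSubtractive hm hk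
  have hs : s = e.hom ≫ c ≫ e'.hom := by
    rw [← cancel_mono k, ← hK.w, ← he]
    simp [he', hc]
  rw [hs]
  exact weq_comp W (weq_of_isIso hW _) (weq_comp W hcw (weq_of_isIso hW _))

lemma Dist.mk' (hW : W.IsSW) {A B A' B' V K : C} {f : A ⟶ B}
    {f' : A' ⟶ B'} {g : A ⟶ A'} {g' : B ⟶ B'} (hP : IsPullback f g g' f') {k : V ⟶ B'}
    {r : K ⟶ B} {s : K ⟶ V} (hk : W.sub f' k) (hK : IsPullback r s g' k) (hs : W.weq s) :
    W.Dist f f' g g' :=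
  ⟨hP.w, ⟨A, f, g, hP, by
    have : hP.lift f g hP.w = 𝟙 A := hP.hom_ext (by simp) (by simp)
    rw [this]; exact weq_of_isIso hW _⟩,
    K, V, r, k, s, hW.sub_baseChange hk hP.flip hK.flip, hk, hK.w.symm, hs⟩

lemma Dist.vcomp (hW : W.IsSW) (hm : W.MonoCof) {A B A' B' A'' B'' : C} {f : A ⟶ B}
    {f' : A' ⟶ B'} {f'' : A'' ⟶ B''} {g : A ⟶ A'} {g' : B ⟶ B'} {h : A' ⟶ A''} {h' : B' ⟶ B''}
    (h₁ : W.Dist f f' g g') (h₂ : W.Dist f' f'' h h') : W.Dist f f'' (g ≫ h) (g' ≫ h') := by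
  have hP₁ := h₁.isPullback hW.toIsSubtractive hm
  have hP₂ := h₂.isPullback hW.toIsSubtractive hm
  obtain ⟨V, k, hk⟩ : ∃ (V : C) (k : V ⟶ B''), W.sub f'' k := by
    obtain ⟨-, -, -, V, -, k, -, -, hk, -⟩ := h₂
    exact ⟨V, k, hk⟩
  have := hW.fib_hasPullback k h' (hW.sub_fib hk)
  have hK₂ := IsPullback.of_hasPullback h' k
  have hk₂ : W.sub f' (pullback.fst h' k) := hW.sub_baseChange hk hP₂.flip hK₂.flip
  have := hW.fib_hasPullback _ g' (hW.sub_fib hk₂)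
  have hK₁ := IsPullback.of_hasPullback g' (pullback.fst h' k)
  exact Dist.mk' hW (hP₁.paste_vert hP₂) hk (hK₁.paste_vert hK₂)
    (weq_comp W (h₁.weq_snd hW hm hk₂ hK₁) (h₂.weq_snd hW hm hk hK₂))

lemma Dist.hcomp (hW : W.IsSW) (hm : W.MonoCof) (hs : W.Star) {A B D A' B' D' : C} {f : A ⟶ B}
    {k : B ⟶ D} {f' : A' ⟶ B'} {k' : B' ⟶ D'} {g : A ⟶ A'} {g' : B ⟶ B'} {g'' : D ⟶ D'}
    (h₁ : W.Dist f f' g g') (h₂ : W.Dist k k' g' g'') :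
    W.Dist (f ≫ k) (f' ≫ k') g g'' := by
  have hS := hW.toIsSubtractive
  have hP₁ := h₁.isPullback hS hm
  have hP₂ := h₂.isPullback hS hm
  obtain ⟨V, v, hv⟩ : ∃ (V : C) (v : V ⟶ B'), W.sub f' v := by
    obtain ⟨-, -, -, V, -, v, -, -, hv, -⟩ := h₁
    exact ⟨V, v, hv⟩
  obtain ⟨T, t, ht⟩ : ∃ (T : C) (t : T ⟶ D'), W.sub k' t := by
    obtain ⟨-, -, -, T, -, t, -, -, ht, -⟩ := h₂
    exact ⟨T, t, ht⟩
  have hk' := hm k' (hW.sub_cof ht)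
  obtain ⟨L, l, hl⟩ := hW.exists_sub (f' ≫ k') (cof_comp W (hW.sub_cof hv) (hW.sub_cof ht))
  have hlm := mono_of_sub hS hm hl
  have htm := mono_of_sub hS hm ht
  have := hW.fib_hasPullback l g'' (hW.sub_fib hl)
  have := hW.fib_hasPullback l k' (hW.sub_fib hl)
  have := hW.fib_hasPullback l t (hW.sub_fib hl)
  have hP : IsPullback (f ≫ k) g g'' (f' ≫ k') := hP₁.paste_horiz hP₂
  have hK := IsPullback.of_hasPullback g'' l
  -- `V' = B' ×_{D'} L` is a complement of `A' ⟶ B'`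
  have hV := IsPullback.of_hasPullback k' l
  have hV' : W.sub f' (pullback.fst k' l) := by
    refine hW.sub_baseChange (p := 𝟙 A') hl ?_ hV.flip
    refine IsPullback.of_isLimit' ⟨by simp⟩ (PullbackCone.IsLimit.mk _
      (fun s => s.fst) (fun s => by simp) (fun s => ?_) (fun s m h1 _ => by simpa using h1))
    rw [← cancel_mono k', Category.assoc]
    exact s.condition
  -- `T' = T ×_{D'} L` is `T`
  have hT := IsPullback.of_hasPullback t l
  have hT' : IsIso (pullback.fst t l) := by
    have := hW.cof_hasPullback (f' ≫ k') t (hW.sub_cof hl)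
    have h0 : W.sub (pullback.fst t (f' ≫ k')) (pullback.fst t l) :=
      hW.sub_baseChange hl (IsPullback.of_hasPullback t (f' ≫ k')).flip hT.flip
    obtain ⟨e⟩ := disjoint_of_sub hS hm ht (p := pullback.snd t (f' ≫ k') ≫ f')
      (q := pullback.fst t (f' ≫ k')) (by rw [pullback.condition, Category.assoc])
    exact isIso_of_sub_initial hS h0 e
  have hsub : W.sub (pullback.snd k' l) (pullback.snd t l) := hW.sub_baseChange ht hV hT
  have ht' : W.sub k' (pullback.snd t l ≫ l) := by
    have := sub_iso hS ht (Iso.refl _) (asIso (pullback.fst t l))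
    simpa [pullback.condition] using this
  refine Dist.mk' hW hP hl hK ?_
  have := hW.cof_hasPullback _ (pullback.snd g'' l) (hW.sub_cof hsub)
  have := hW.fib_hasPullback _ (pullback.snd g'' l) (hW.sub_fib hsub)
  have hX := IsPullback.of_hasPullback (pullback.snd g'' l) (pullback.snd k' l)
  have hY := IsPullback.of_hasPullback (pullback.snd g'' l) (pullback.snd t l)
  refine hs hsub hX.flip hY.flip ?_ ?_
  · -- `X = B ×_{B'} V'`
    have hX' := hX.paste_horiz hK
    rw [← pullback.condition (f := k') (g := l)] at hX'
    exact h₁.weq_snd hW hm hV' (hX'.of_right' hP₂)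
  · exact h₂.weq_snd hW hm ht' (hY.paste_horiz hK)

lemma Dist.vid (hW : W.IsSW) {A B : C} {f : A ⟶ B} (hf : W.cof f) :
    W.Dist f f (𝟙 A) (𝟙 B) := by
  obtain ⟨V, k, hk⟩ := hW.exists_sub f hf
  exact Dist.mk' hW (IsPullback.of_vert_isIso ⟨by simp⟩) hk
    (IsPullback.of_vert_isIso (fst := k) (snd := 𝟙 V) (f := 𝟙 B) (g := k) ⟨by simp⟩)
    (weq_of_isIso hW _)

lemma Dist.hid (hW : W.IsSW) {A B : C} (g : A ⟶ B) : W.Dist (𝟙 A) (𝟙 B) g g := by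
  obtain ⟨I⟩ := hW.initial
  have hP : IsPullback (𝟙 A) g g (𝟙 B) := IsPullback.of_horiz_isIso ⟨by simp⟩
  refine ⟨by simp, ⟨A, 𝟙 A, g, hP, ?_⟩, W.O, W.O, I.to A, I.to B, 𝟙 _, hW.sub_id _,
    hW.sub_id _, I.hom_ext _ _, weq_of_isIso hW _⟩
  have : hP.lift (𝟙 A) g (by simp) = 𝟙 A :=
    (Category.comp_id _).symm.trans (hP.lift_fst (𝟙 A) g (by simp))
  rw [this]
  exact weq_of_isIso hW _

end

/-- The category of cofibrations. -/
abbrev cofCategory (W : SWData C) : Category.{v} C where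
  Hom A B := { f : A ⟶ B // W.cof f }
  id A := ⟨𝟙 A, W.cof_mul.id_mem A⟩
  comp f g := ⟨f.1 ≫ g.1, W.cof_mul.comp_mem _ _ f.2 g.2⟩
  id_comp f := Subtype.ext (Category.id_comp f.1)
  comp_id f := Subtype.ext (Category.comp_id f.1)
  assoc f g h := Subtype.ext (Category.assoc f.1 g.1 h.1)

/-- The squares category associated to an SW-category whose cofibrations are monomorphisms and
which satisfies `(*)`: horizontal maps are the cofibrations, vertical maps are all maps. -/
def squares (W : SWData C) (hW : W.IsSW) (hm : W.MonoCof) (hs : W.Star) :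
    SquaresCategory.{v, u} where
  Ob := C
  E := inferInstance
  M := W.cofCategory
  dist f f' g g' := W.Dist f.1 f'.1 g g'
  dist_vcomp h₁ h₂ := Dist.vcomp hW hm h₁ h₂
  dist_hcomp h₁ h₂ := Dist.hcomp hW hm hs h₁ h₂
  dist_vid f := Dist.vid hW f.2
  dist_hid g := Dist.hid hW g
  O := W.O
  initial_M X := by
    obtain ⟨I⟩ := hW.initial
    exact ⟨{ default := ⟨I.to X, hW.sub_cof (hW.sub_initial _)⟩
             uniq := fun f => Subtype.ext (I.hom_ext _ _) }⟩
  initial_E X := by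
    obtain ⟨I⟩ := hW.initial
    exact ⟨{ default := I.to X
             uniq := fun f => I.hom_ext _ _ }⟩

end SWData

/-! ## The `K`-theory of SW-categories -/

/-- The category `Ar~[n]`: the full subcategory of `[n]ᵒᵖ × [n]` on the pairs `(i, j)` with
`i ≤ j`, regarded as a partial order. -/
structure ArTilde (n : ℕ) where
  i : Fin (n + 1)
  j : Fin (n + 1)
  le : i ≤ j

namespace ArTilde

instance (n : ℕ) : Preorder (ArTilde n) where
  le a b := b.i ≤ a.i ∧ a.j ≤ b.j
  le_refl _ := ⟨le_rfl, le_rfl⟩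
  le_trans _ _ _ h h' := ⟨h'.1.trans h.1, h.2.trans h'.2⟩

/-- A morphism `[m] ⟶ [n]` induces a functor `Ar~[m] ⥤ Ar~[n]`. -/
def map {m n : SimplexCategory} (f : m ⟶ n) : ArTilde m.len ⥤ ArTilde n.len :=
  Monotone.functor (f := fun a : ArTilde m.len =>
    (⟨f.toOrderHom a.i, f.toOrderHom a.j, f.toOrderHom.monotone a.le⟩ : ArTilde n.len))
    (fun _ _ h => ⟨f.toOrderHom.monotone h.1, f.toOrderHom.monotone h.2⟩)

/-- The map `(i, j) ⟶ (i, k)` for `i ≤ j ≤ k`. -/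
def right {n : ℕ} {i j k : Fin (n + 1)} (h : i ≤ j) (h' : j ≤ k) :
    (⟨i, j, h⟩ : ArTilde n) ⟶ ⟨i, k, h.trans h'⟩ :=
  homOfLE ⟨le_rfl, h'⟩

/-- The map `(j, k) ⟶ (i, k)` for `i ≤ j ≤ k`. -/
def left {n : ℕ} {i j k : Fin (n + 1)} (h : i ≤ j) (h' : j ≤ k) :
    (⟨j, k, h'⟩ : ArTilde n) ⟶ ⟨i, k, h.trans h'⟩ :=
  homOfLE ⟨h, le_rfl⟩

end ArTilde

/-- A category with the data of an SW-category. -/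
structure BundledSW where
  C : Type u
  cat : Category.{v} C
  W : SWData C

instance (B : BundledSW.{v, u}) : Category.{v} B.C := B.cat

/-- A functor that preserves subtraction sequences, weak equivalences and the object `O`. -/
structure BundledSW.Hom (B D : BundledSW.{v, u}) where
  fn : B.C ⥤ D.C
  map_sub : ∀ {X Y U : B.C} {i : X ⟶ Y} {j : U ⟶ Y}, B.W.sub i j → D.W.sub (fn.map i) (fn.map j)
  map_weq : ∀ {X Y : B.C} {f : X ⟶ Y}, B.W.weq f → D.W.weq (fn.map f)
  obj_O : fn.obj B.W.O = D.W.O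

instance : Category BundledSW.{v, u} where
  Hom := BundledSW.Hom
  id B := ⟨𝟭 B.C, fun h => h, fun h => h, rfl⟩
  comp F G := ⟨F.fn ⋙ G.fn, fun h => G.map_sub (F.map_sub h), fun h => G.map_weq (F.map_weq h), by
    rw [← G.obj_O, ← F.obj_O]; rfl⟩

/-- The objects of `S~_n`: functors `X : Ar~[n] ⥤ C` with `X_{i,i} = ∅` such that
`X_{i,j} ⟶ X_{i,k} ⟵ X_{j,k}` is a subtraction sequence for all `i ≤ j ≤ k`. -/
structure STilde (B : BundledSW.{v, u}) (n : ℕ) where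
  fn : ArTilde n ⥤ B.C
  diag : ∀ i : Fin (n + 1), Nonempty (fn.obj ⟨i, i, le_rfl⟩ ≅ B.W.O)
  sub : ∀ {i j k : Fin (n + 1)} (h : i ≤ j) (h' : j ≤ k),
    B.W.sub (fn.map (ArTilde.right h h')) (fn.map (ArTilde.left h h'))

/-- The morphisms of `wS~_n`: natural transformations all of whose components are weak
equivalences. -/
@[ext]
structure STilde.Hom {B : BundledSW.{v, u}} {n : ℕ} (X Y : STilde B n) where
  nat : X.fn ⟶ Y.fn
  weq : ∀ a : ArTilde n, B.W.weq (nat.app a)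

/-- The category `wS~_n`. -/
instance (B : BundledSW.{v, u}) (n : ℕ) : Category.{v} (STilde B n) where
  Hom X Y := STilde.Hom X Y
  id X := ⟨𝟙 X.fn, fun _ => B.W.weq_mul.id_mem _⟩
  comp f g := ⟨f.nat ≫ g.nat, fun a => B.W.weq_mul.comp_mem _ _ (f.weq a) (g.weq a)⟩

/-- The simplicial category `wS~_•`. -/
def simplicialS (B : BundledSW.{v, u}) : SimplexCategoryᵒᵖ ⥤ Cat.{v, max u v} where
  obj n := Cat.of (STilde B n.unop.len)
  map {m n} f := Functor.toCatHom
    { obj := fun X => (⟨ArTilde.map f.unop ⋙ X.fn, fun i => X.diag _, fun h h' =>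
        X.sub (f.unop.toOrderHom.monotone h) (f.unop.toOrderHom.monotone h')⟩ :
          STilde B n.unop.len)
      map := fun α => ⟨Functor.whiskerLeft (ArTilde.map f.unop) (STilde.Hom.nat α),
        fun a => STilde.Hom.weq α _⟩ }
  map_id _ := rfl
  map_comp _ _ := rfl

/-- The action of a functor on `wS~_n`. -/
def STilde.postcomp {B D : BundledSW.{v, u}} (F : B ⟶ D) (n : ℕ) : STilde B n ⥤ STilde D n where
  obj X := ⟨X.fn ⋙ BundledSW.Hom.fn F, fun i => by
    obtain ⟨e⟩ := X.diag i
    exact ⟨(BundledSW.Hom.fn F).mapIso e ≪≫ eqToIso (BundledSW.Hom.obj_O F)⟩,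
    fun h h' => BundledSW.Hom.map_sub F (X.sub h h')⟩
  map α := ⟨Functor.whiskerRight (STilde.Hom.nat α) (BundledSW.Hom.fn F),
    fun a => BundledSW.Hom.map_weq F (STilde.Hom.weq α a)⟩
  map_id X := by
    have h : Functor.whiskerRight (𝟙 X.fn) (BundledSW.Hom.fn F) =
      𝟙 (X.fn ⋙ BundledSW.Hom.fn F) := by simp
    exact STilde.Hom.ext h
  map_comp α β := STilde.Hom.ext
    (Functor.whiskerRight_comp (STilde.Hom.nat α) (STilde.Hom.nat β) (BundledSW.Hom.fn F))

/-- The basepoint of `wS~_0`. -/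
def STilde.base (B : BundledSW.{v, u}) : STilde B 0 :=
  ⟨(Functor.const _).obj B.W.O, fun _ => ⟨Iso.refl _⟩, fun _ _ => B.W.sub_O⟩

/-- `|N_• wS~_•|` as a simplicial set, pointed at `∅`. -/
def pointedS : BundledSW.{v, u} ⥤ PointedSSet.{max u v} where
  obj B :=
    { X := diagNerve.obj (simplicialS B)
      pt := ComposableArrows.mk₀ (STilde.base B) }
  map {B D} F :=
    { map := diagNerve.map
        { app := fun n => (STilde.postcomp F n.unop.len).toCatHom
          naturality := fun _ _ _ => rfl }
      map_pt := by
        refine ComposableArrows.ext₀ ?_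
        have h : (Functor.const (ArTilde 0)).obj B.W.O ⋙ BundledSW.Hom.fn F
            = (Functor.const (ArTilde 0)).obj D.W.O := by
          rw [← BundledSW.Hom.obj_O F]
          exact CategoryTheory.Functor.ext (fun _ => rfl)
            (fun _ _ _ => by simp)
        have h' : ∀ X Y : STilde D 0, X.fn = Y.fn → X = Y := by
          rintro ⟨_, _, _⟩ ⟨_, _, _⟩ rfl
          rfl
        exact h' ((STilde.postcomp F 0).obj (STilde.base B)) (STilde.base D) h }
  map_id B := rfl
  map_comp F G := rfl

/-- The `K`-theory space `Ω |N_• wS~_• C|` of an SW-category. -/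
def swK : BundledSW.{v, u} ⥤ TopCat.{max u v} :=
  pointedS ⋙ loopRealization

/-- The `K`-theory space of the SW-category given by `W`. -/
def SWData.K {C : Type u} [Category.{v} C] (W : SWData C) : TopCat.{max u v} :=
  swK.obj ⟨C, inferInstance, W⟩

/-! ## Infinite loop space structures

Following Segal, the infinite loop space structures given by coproducts are encoded by
`Γ`-spaces, i.e. functors on the category of finite pointed sets. The latter is described as
the category of finite sets and partial functions. -/

/-- The category of finite sets and partial functions (equivalently: finite pointed sets). -/
abbrev FinPart := ObjectProperty.FullSubcategory (fun X : PartialFun.{0} => Finite X)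

/-- An operation on subsets that preserves the empty set and disjoint unions. -/
@[ext]
structure SetMap (S T : Type) where
  fn : Set T → Set S
  mono : Monotone fn
  empty : fn ∅ = ∅
  union : ∀ U V : Set T, fn (U ∪ V) = fn U ∪ fn V
  disjoint : ∀ {U V : Set T}, Disjoint U V → Disjoint (fn U) (fn V)

/-- Preimages under a partial function. -/
def SetMap.ofPFun {S T : Type} (φ : S →. T) : SetMap S T where
  fn := φ.preimage
  mono _ _ h := φ.preimage_mono h
  empty := by ext x; simp [PFun.mem_preimage]
  union U V := φ.preimage_union U V
  disjoint {U V} h := by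
    rw [Set.disjoint_left] at h ⊢
    rintro x ⟨y, hy, hxy⟩ ⟨z, hz, hxz⟩
    exact h hy (Part.mem_unique hxz hxy ▸ hz)

/-- The identity operation. -/
def SetMap.id (S : Type) : SetMap S S :=
  ⟨fun U => U, fun _ _ h => h, rfl, fun _ _ => rfl, fun h => h⟩

lemma SetMap.preimage_id (S : Type) (U : Set S) : (PFun.id S).preimage U = U := by
  ext x
  simp [PFun.mem_preimage]

/-- Composition of operations. -/
def SetMap.comp {S T R : Type} (m : SetMap S T) (m' : SetMap T R) : SetMap S R :=
  ⟨fun U => m.fn (m'.fn U), fun _ _ h => m.mono (m'.mono h), by rw [m'.empty, m.empty],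
    fun U V => by rw [m'.union, m.union], fun h => m.disjoint (m'.disjoint h)⟩

/-- A sum diagram: objects `A(U)` for all `U ⊆ S`, functorial for inclusions, such that
`A(∅)` is initial and `A(U ∪ V)` is the coproduct of `A(U)` and `A(V)` for disjoint `U`, `V`. -/
structure SumDiag (C : Type u) [Category.{v} C] (S : Type) where
  fn : Set S ⥤ C
  empty : ∀ {U : Set S}, U = ∅ → Nonempty (IsInitial (fn.obj U))
  sum : ∀ {U V X : Set S} (hU : U ≤ X) (hV : V ≤ X), Disjoint U V → U ∪ V = X →
    Nonempty (IsColimit (BinaryCofan.mk (fn.map (homOfLE hU)) (fn.map (homOfLE hV))))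

namespace SumDiag

variable {C : Type u} [Category.{v} C]

instance (S : Type) : Category.{v} (SumDiag C S) where
  Hom A B := A.fn ⟶ B.fn
  id A := 𝟙 A.fn
  comp f g := NatTrans.vcomp f g

/-- The component of a morphism of sum diagrams. -/
def app {S : Type} {A B : SumDiag C S} (f : A ⟶ B) (U : Set S) : A.fn.obj U ⟶ B.fn.obj U :=
  NatTrans.app f U

/-- Reindexing of sum diagrams. -/
def pull {S T : Type} (m : SetMap S T) : SumDiag C S ⥤ SumDiag C T where
  obj A := ⟨m.mono.functor ⋙ A.fn, fun h => A.empty (h ▸ m.empty),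
    fun hU hV h h' => A.sum (m.mono hU) (m.mono hV) (m.disjoint h) (h' ▸ (m.union _ _).symm)⟩
  map f := Functor.whiskerLeft m.mono.functor f

/-- The constant sum diagram on an initial object. -/
def const (S : Type) (X : C) (hX : Nonempty (IsInitial X)) : SumDiag C S where
  fn := (Functor.const _).obj X
  empty _ := hX
  sum _ _ _ _ := by
    obtain ⟨I⟩ := hX
    exact ⟨BinaryCofan.isColimitMk (fun s => I.to s.pt) (fun _ => I.hom_ext _ _)
      (fun _ => I.hom_ext _ _) (fun _ _ _ _ => I.hom_ext _ _)⟩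

end SumDiag

namespace SWData

variable {C : Type u} [Category.{v} C]

/-- The category of sum diagrams, with the pointwise structure of an SW-category. -/
def sums (W : SWData C) (hO : Nonempty (IsInitial W.O)) (S : Type) :
    BundledSW.{v, max u v} where
  C := SumDiag C S
  cat := inferInstance
  W :=
    { cof := fun _ _ f => ∀ U, W.cof (SumDiag.app f U)
      fib := fun _ _ f => ∀ U, W.fib (SumDiag.app f U)
      weq := fun _ _ f => ∀ U, W.weq (SumDiag.app f U)
      cof_mul :=
        { id_mem := fun _ _ => W.cof_mul.id_mem _
          comp_mem := fun _ _ h h' U => W.cof_mul.comp_mem _ _ (h U) (h' U) }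
      fib_mul :=
        { id_mem := fun _ _ => W.fib_mul.id_mem _
          comp_mem := fun _ _ h h' U => W.fib_mul.comp_mem _ _ (h U) (h' U) }
      weq_mul :=
        { id_mem := fun _ _ => W.weq_mul.id_mem _
          comp_mem := fun _ _ h h' U => W.weq_mul.comp_mem _ _ (h U) (h' U) }
      sub := fun i j => ∀ U, W.sub (SumDiag.app i U) (SumDiag.app j U)
      O := SumDiag.const S W.O hO
      sub_O := fun _ => W.sub_O }

/-- Reindexing, as a functor that preserves the pointwise structures. -/
def sumsMap (W : SWData C) (hO : Nonempty (IsInitial W.O)) {S T : Type} (m : SetMap S T) :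
    W.sums hO S ⟶ W.sums hO T where
  fn := SumDiag.pull m
  map_sub h U := h (m.fn U)
  map_weq h U := h (m.fn U)
  obj_O := rfl

/-- The `Γ`-space of the `K`-theory of an SW-category, given by coproducts. -/
def swKGamma (W : SWData C) (hO : Nonempty (IsInitial W.O)) : FinPart ⥤ TopCat.{max u v} :=
  Functor.comp
    { obj := fun S => W.sums hO S.obj
      map := fun φ => W.sumsMap hO (SetMap.ofPFun φ.hom)
      map_id := fun S => by
        have h : SetMap.ofPFun (𝟙 S : S ⟶ S).hom = SetMap.id S.obj :=
          SetMap.ext (funext fun U => SetMap.preimage_id S.obj U)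
        rw [h]
        rfl
      map_comp := fun {S T R} φ ψ => by
        have h : SetMap.ofPFun (φ ≫ ψ).hom =
            (SetMap.ofPFun φ.hom).comp (SetMap.ofPFun ψ.hom) :=
          SetMap.ext (funext fun U => PFun.preimage_comp _ _ U)
        rw [h]
        rfl }
    swK

/-- The squares category of sum diagrams, with horizontal maps and distinguished squares defined
pointwise in the associated squares category. -/
def sumSquares (W : SWData C) (hW : W.IsSW) (hm : W.MonoCof) (hs : W.Star) (S : Type) :
    SquaresCategory.{v, max u v} where
  Ob := SumDiag C S
  E := inferInstance
  M := (W.sums hW.initial S).W.cofCategory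
  dist f f' g g' := ∀ U, W.Dist (SumDiag.app f.1 U) (SumDiag.app f'.1 U) (SumDiag.app g U)
    (SumDiag.app g' U)
  dist_vcomp h₁ h₂ U := Dist.vcomp hW hm (h₁ U) (h₂ U)
  dist_hcomp h₁ h₂ U := Dist.hcomp hW hm hs (h₁ U) (h₂ U)
  dist_vid f U := Dist.vid hW (f.2 U)
  dist_hid g U := Dist.hid hW (SumDiag.app g U)
  O := SumDiag.const S W.O hW.initial
  initial_M A := by
    obtain ⟨I⟩ := hW.initial
    exact ⟨{ default := ⟨{ app := fun U => I.to (A.fn.obj U)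
                           naturality := fun _ _ _ => I.hom_ext _ _ },
               fun U => hW.sub_cof (hW.sub_initial _)⟩
             uniq := fun f => Subtype.ext (NatTrans.ext (funext fun U => I.hom_ext _ _)) }⟩
  initial_E A := by
    obtain ⟨I⟩ := hW.initial
    exact ⟨{ default :=
               { app := fun U => I.to (A.fn.obj U)
                 naturality := fun _ _ _ => I.hom_ext _ _ }
             uniq := fun f => NatTrans.ext (funext fun U => I.hom_ext _ _) }⟩

/-- Reindexing, as a functor of squares categories. -/
def sumSquaresMap (W : SWData C) (hW : W.IsSW) (hm : W.MonoCof) (hs : W.Star) {S T : Type}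
    (m : SetMap S T) : W.sumSquares hW hm hs S ⟶ W.sumSquares hW hm hs T where
  obj A := (SumDiag.pull m).obj A
  mapE f := (SumDiag.pull m).map f
  mapM f := ⟨(SumDiag.pull m).map f.1, fun U => f.2 (m.fn U)⟩
  mapE_id _ := rfl
  mapM_id _ := rfl
  mapE_comp _ _ := rfl
  mapM_comp _ _ := rfl
  map_dist h U := h (m.fn U)
  obj_O := rfl

/-- The `Γ`-space of the `K`-theory of the associated squares category, given by coproducts. -/
def squaresKGamma (W : SWData C) (hW : W.IsSW) (hm : W.MonoCof) (hs : W.Star) :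
    FinPart ⥤ TopCat.{max u v} :=
  Functor.comp
    { obj := fun S => W.sumSquares hW hm hs S.obj
      map := fun φ => W.sumSquaresMap hW hm hs (SetMap.ofPFun φ.hom)
      map_id := fun S => by
        have h : SetMap.ofPFun (𝟙 S : S ⟶ S).hom = SetMap.id S.obj :=
          SetMap.ext (funext fun U => SetMap.preimage_id S.obj U)
        rw [h]
        rfl
      map_comp := fun {S T R} φ ψ => by
        have h : SetMap.ofPFun (φ ≫ ψ).hom =
            (SetMap.ofPFun φ.hom).comp (SetMap.ofPFun ψ.hom) :=
          SetMap.ext (funext fun U => PFun.preimage_comp _ _ U)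
        rw [h]
        rfl }
    squaresK

/-- Coproducts of subtraction sequences are subtraction sequences. -/
def SumsSubtractive (W : SWData C) : Prop :=
  ∀ {X₁ X₂ X Y₁ Y₂ Y U₁ U₂ U : C} {x₁ : X₁ ⟶ X} {x₂ : X₂ ⟶ X} {y₁ : Y₁ ⟶ Y} {y₂ : Y₂ ⟶ Y}
    {u₁ : U₁ ⟶ U} {u₂ : U₂ ⟶ U} {i₁ : X₁ ⟶ Y₁} {i₂ : X₂ ⟶ Y₂} {i : X ⟶ Y} {j₁ : U₁ ⟶ Y₁}
    {j₂ : U₂ ⟶ Y₂} {j : U ⟶ Y},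
    Nonempty (IsColimit (BinaryCofan.mk x₁ x₂)) → Nonempty (IsColimit (BinaryCofan.mk y₁ y₂)) →
    Nonempty (IsColimit (BinaryCofan.mk u₁ u₂)) → i₁ ≫ y₁ = x₁ ≫ i → i₂ ≫ y₂ = x₂ ≫ i →
    j₁ ≫ y₁ = u₁ ≫ j → j₂ ≫ y₂ = u₂ ≫ j → W.sub i₁ j₁ → W.sub i₂ j₂ → W.sub i j

end SWData

/-- Equivalence of `Γ`-spaces: a zigzag of natural transformations all of whose components are
homotopy equivalences. -/
def GammaEquiv (F G : FinPart ⥤ TopCat.{u}) : Prop :=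
  Relation.EqvGen (fun F G : FinPart ⥤ TopCat.{u} => ∃ α : F ⟶ G, ∀ S : FinPart,
    ∃ e : F.obj S ≃ₕ G.obj S, e.toFun = (α.app S).hom) F G

end SquaresK

end

/-!
The comparison map sends a chain of cofibrations `A₀ ↪ ⋯ ↪ Aₙ` to the diagram of complements
`Aⱼ ∖ Aᵢ` in `S~ₙ`. A vertical transformation of chains is distinguished exactly when it induces
weak equivalences on these complements, whatever it does on `A₀`.

Recovering a chain from its complements takes edgewise subdivision. For nested intervals
`[l₀, r₀] ⊆ ⋯ ⊆ [lₖ, rₖ]` in `[m]` and `X` in `S~ₘ`, the row `X_{lₐ,r₀} ↪ ⋯ ↪ X_{lₐ,rₖ}` is a chain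
of cofibrations whose complements `X_{rᵢ,rⱼ}` do not depend on `a`, so the transformations between
these rows are distinguished. This gives a map `sd S~ → T`. Its composites with `T → S~` and
`sd T → sd S~` are joined by natural transformations to the last vertex maps of `S~` and of `T`.

The last vertex map `sd Y → Y` is a homotopy equivalence on realizations. It is homotopic, along
straight segments, to the map that sends a distribution on a chain of intervals to the mean of the
distributions of the two endpoints, and that map is a homeomorphism on every simplex: a distribution
is such a mean in exactly one way, namely by coupling its lower half to its upper half in opposite
order. By the two-out-of-six property `T → S~` is a homotopy equivalence.

Sum diagrams have pointwise complements, so the argument applies to every value of the `Γ`-spaces.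
-/

noncomputable section

namespace SquaresK

/-! ## Homotopy equivalences and loop spaces -/

section HomotopyEquivalences

open ContinuousMap

variable {X Y Z T : Type*} [TopologicalSpace X] [TopologicalSpace Y] [TopologicalSpace Z]
  [TopologicalSpace T]

/-- A continuous map that is a homotopy equivalence. -/
def IsHomotopyEquiv (f : C(X, Y)) : Prop := ∃ e : X ≃ₕ Y, e.toFun = f

lemma IsHomotopyEquiv.of_inverses {f : C(X, Y)} {g g' : C(Y, X)} (h : (g.comp f).Homotopic (.id X))
    (h' : (f.comp g').Homotopic (.id Y)) : IsHomotopyEquiv f := by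
  refine ⟨⟨f, g', ?_, h'⟩, rfl⟩
  have h₁ : ((g.comp f).comp g').Homotopic ((ContinuousMap.id X).comp g') :=
    h.comp (Homotopic.refl g')
  have h₂ : (g.comp (f.comp g')).Homotopic (g.comp (.id Y)) := (Homotopic.refl g).comp h'
  have h₃ : g'.Homotopic g := by simpa using h₁.symm.trans h₂
  exact (h₃.comp (Homotopic.refl f)).trans h

lemma IsHomotopyEquiv.exists_inverse {f : C(X, Y)} (h : IsHomotopyEquiv f) :
    ∃ g : C(Y, X), (g.comp f).Homotopic (.id X) ∧ (f.comp g).Homotopic (.id Y) := by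
  obtain ⟨e, rfl⟩ := h
  exact ⟨e.invFun, e.left_inv, e.right_inv⟩

lemma IsHomotopyEquiv.of_homotopic {f f' : C(X, Y)} (h : IsHomotopyEquiv f) (hf : f.Homotopic f') :
    IsHomotopyEquiv f' := by
  obtain ⟨g, h₁, h₂⟩ := h.exists_inverse
  exact .of_inverses (((Homotopic.refl g).comp hf.symm).trans h₁)
    ((hf.symm.comp (Homotopic.refl g)).trans h₂)

lemma IsHomotopyEquiv.of_homeomorph (e : X ≃ₜ Y) : IsHomotopyEquiv (e : C(X, Y)) :=
  ⟨e.toHomotopyEquiv, rfl⟩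

lemma IsHomotopyEquiv.of_comp_left {f : C(X, Y)} {g : C(Y, Z)} (hg : IsHomotopyEquiv g)
    (hgf : IsHomotopyEquiv (g.comp f)) : IsHomotopyEquiv f := by
  obtain ⟨a, ha, ha'⟩ := hgf.exists_inverse
  obtain ⟨b, hb, -⟩ := hg.exists_inverse
  refine .of_inverses (g := a.comp g) (g' := a.comp g) ha ?_
  have h₁ : ((b.comp g).comp (f.comp (a.comp g))).Homotopic (f.comp (a.comp g)) :=
    hb.comp (Homotopic.refl _)
  have h₂ : (b.comp (((g.comp f).comp a).comp g)).Homotopic (b.comp g) :=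
    (Homotopic.refl b).comp (ha'.comp (Homotopic.refl g))
  exact (h₁.symm.trans h₂).trans hb

lemma IsHomotopyEquiv.of_comp_right {f : C(X, Y)} {g : C(Y, Z)} (hf : IsHomotopyEquiv f)
    (hgf : IsHomotopyEquiv (g.comp f)) : IsHomotopyEquiv g := by
  obtain ⟨a, ha, ha'⟩ := hgf.exists_inverse
  obtain ⟨b, -, hb'⟩ := hf.exists_inverse
  refine .of_inverses (g := f.comp a) (g' := f.comp a) ?_ ha'
  have h₁ : ((f.comp (a.comp g)).comp (f.comp b)).Homotopic (f.comp (a.comp g)) :=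
    (Homotopic.refl _).comp hb'
  have h₂ : ((f.comp (a.comp (g.comp f))).comp b).Homotopic (f.comp b) :=
    Homotopic.comp ((Homotopic.refl f).comp ha) (Homotopic.refl b)
  exact (h₁.symm.trans h₂).trans hb'

lemma IsHomotopyEquiv.two_of_six {f : C(X, Y)} {g : C(Y, Z)} {h : C(Z, T)}
    (hgf : IsHomotopyEquiv (g.comp f)) (hhg : IsHomotopyEquiv (h.comp g)) :
    IsHomotopyEquiv g := by
  obtain ⟨a, -, ha'⟩ := hgf.exists_inverse
  obtain ⟨b, hb, -⟩ := hhg.exists_inverse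
  exact .of_inverses (g := b.comp h) (g' := f.comp a) hb ha'

end HomotopyEquivalences

section Loops

open unitInterval ContinuousMap

variable {X Y Z : Type*} [TopologicalSpace X] [TopologicalSpace Y] [TopologicalSpace Z]

/-- The map on loop spaces induced by a continuous map. -/
def loopMap (f : C(X, Y)) (x : X) : C(Path x x, Path (f x) (f x)) where
  toFun p := p.map f.continuous
  continuous_toFun := by
    rw [Path.continuous_uncurry_iff.symm]
    exact f.continuous.comp continuous_eval

/-- Conjugation of loops by a path. -/
def conjLoop {x y : X} (γ : Path x y) : C(Path y y, Path x x) where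
  toFun p := (γ.trans p).trans γ.symm
  continuous_toFun :=
    (continuous_const.path_trans continuous_id).path_trans continuous_const

lemma conjLoop_refl_homotopic_id (x : X) : (conjLoop (Path.refl x)).Homotopic (.id _) := by
  have h₁ : (conjLoop (Path.refl x)).Homotopic
      ⟨fun p : Path x x => (Path.refl x).trans p, continuous_const.path_trans continuous_id⟩ :=
    ⟨{ toFun := fun z => Path.delayReflRight z.1 ((Path.refl x).trans z.2)
       continuous_toFun := Path.continuous_delayReflRight.comp
        (continuous_fst.prodMk (continuous_const.path_trans continuous_snd))
       map_zero_left := fun p => Path.delayReflRight_zero _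
       map_one_left := fun p => Path.delayReflRight_one _ }⟩
  exact h₁.trans
    ⟨{ toFun := fun z => Path.delayReflLeft z.1 z.2
       continuous_toFun := Path.continuous_delayReflLeft
       map_zero_left := fun p => Path.delayReflLeft_zero _
       map_one_left := fun p => Path.delayReflLeft_one _ }⟩

lemma homotopic_conjLoop_comp {x y : X} (γ : Path x y) (q : ∀ s : I, Z → Path (γ s) (γ s))
    (hq : Continuous fun z : (I × Z) × I => q z.1.1 z.1.2 z.2)
    (a : C(Z, Path x x)) (b : C(Z, Path y y)) (ha : ∀ z t, a z t = q 0 z t)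
    (hb : ∀ z t, b z t = q 1 z t) : a.Homotopic ((conjLoop γ).comp b) := by
  let δ : ∀ s : I, Path x (γ s) := fun s =>
    { toFun := fun t => γ (s * t)
      continuous_toFun := by fun_prop
      source' := by simp
      target' := by simp }
  have hδ : Continuous fun z : (I × Z) × I => δ z.1.1 z.2 := by
    change Continuous fun z : (I × Z) × I => γ (z.1.1 * z.2)
    fun_prop
  refine (Homotopic.comp (conjLoop_refl_homotopic_id x).symm (Homotopic.refl a)).trans ?_
  refine ⟨{ toFun := fun z => ((δ z.1).trans (q z.1 z.2)).trans (δ z.1).symm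
            continuous_toFun := ?_
            map_zero_left := fun z => ?_
            map_one_left := fun z => ?_ }⟩
  · rw [Path.continuous_uncurry_iff.symm]
    exact Path.trans_continuous_family _ (Path.trans_continuous_family (fun z : I × Z => δ z.1) hδ
      (fun z => q z.1 z.2) hq) _ (Path.symm_continuous_family (fun z : I × Z => δ z.1) hδ)
  · ext t
    have h0 : ∀ t, δ 0 t = x := fun t => by simp [δ]
    simp [conjLoop, Path.trans_apply, h0, ha]
  · ext t
    have h1 : ∀ t, δ 1 t = γ t := fun t => by simp [δ]
    simp [conjLoop, Path.trans_apply, h1, hb]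

lemma conjLoop_comp_conjLoop_symm_homotopic_id {x y : X} (γ : Path x y) :
    ((conjLoop γ).comp (conjLoop γ.symm)).Homotopic (.id _) := by
  let δ : ∀ s : I, Path (γ s) x := fun s =>
    { toFun := fun t => γ (s * σ t)
      continuous_toFun := by fun_prop
      source' := by simp
      target' := by simp }
  have hδ : Continuous fun z : (I × Path x x) × I => δ z.1.1 z.2 := by
    change Continuous fun z : (I × Path x x) × I => γ (z.1.1 * σ z.2)
    fun_prop
  have h := homotopic_conjLoop_comp γ (Z := Path x x)
    (fun s p => ((δ s).trans p).trans (δ s).symm) ?_ (conjLoop (Path.refl x)) (conjLoop γ.symm)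
    (fun p t => ?_) (fun p t => ?_)
  · exact h.symm.trans (conjLoop_refl_homotopic_id x)
  · exact Path.trans_continuous_family _ (Path.trans_continuous_family
      (fun z : I × Path x x => δ z.1) hδ (fun z => z.2) (by fun_prop)) _
      (Path.symm_continuous_family (fun z : I × Path x x => δ z.1) hδ)
  · have h0 : ∀ t, δ 0 t = x := fun t => by simp [δ]
    simp [conjLoop, Path.trans_apply, h0]
  · have h1 : ∀ t, δ 1 t = γ (σ t) := fun t => by simp [δ]
    simp [conjLoop, Path.trans_apply, h1]

lemma isHomotopyEquiv_conjLoop {x y : X} (γ : Path x y) : IsHomotopyEquiv (conjLoop γ) := by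
  refine .of_inverses (g := conjLoop γ.symm) ?_ (conjLoop_comp_conjLoop_symm_homotopic_id γ)
  simpa using conjLoop_comp_conjLoop_symm_homotopic_id γ.symm

lemma loopMap_homotopic_conjLoop_comp {f g : C(X, Y)} (H : f.Homotopy g) (x : X) :
    (loopMap f x).Homotopic ((conjLoop (H.evalAt x)).comp (loopMap g x)) := by
  refine homotopic_conjLoop_comp (H.evalAt x)
    (fun s p => p.map (f := fun x' => H (s, x')) (by fun_prop)) ?_ _ _ (fun p t => ?_)
    (fun p t => ?_)
  · change Continuous fun z : (I × Path x x) × I => H (z.1.1, z.1.2 z.2)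
    fun_prop
  · exact (H.apply_zero (p t)).symm
  · exact (H.apply_one (p t)).symm

lemma isHomotopyEquiv_loopMap_of_homotopic_id {f : C(X, X)} (h : f.Homotopic (.id X)) (x : X) :
    IsHomotopyEquiv (loopMap f x) := by
  obtain ⟨H⟩ := h
  exact (isHomotopyEquiv_conjLoop (H.evalAt x)).of_homotopic
    (loopMap_homotopic_conjLoop_comp H x).symm

lemma IsHomotopyEquiv.loopMap {f : C(X, Y)} (h : IsHomotopyEquiv f) (x : X) :
    IsHomotopyEquiv (SquaresK.loopMap f x) := by
  obtain ⟨g, h₁, h₂⟩ := h.exists_inverse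
  have hgf : IsHomotopyEquiv ((SquaresK.loopMap g (f x)).comp (SquaresK.loopMap f x)) :=
    isHomotopyEquiv_loopMap_of_homotopic_id h₁ x
  have hfg : IsHomotopyEquiv ((SquaresK.loopMap f (g (f x))).comp (SquaresK.loopMap g (f x))) :=
    isHomotopyEquiv_loopMap_of_homotopic_id h₂ (f x)
  exact (hgf.two_of_six hfg).of_comp_left hgf

end Loops

/-! ## Points of geometric realizations -/

section Points

variable {X Y : SSet.{u}}

/-- The topological standard simplex `|Δⁿ|`, as a space of probability distributions. -/
abbrev TSimplex (n : SimplexCategory) : Type := stdSimplex ℝ (Fin (n.len + 1))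

/-- The characteristic map `|Δⁿ| → |X|` of an `n`-simplex of `X`. -/
def charMap {n : SimplexCategory} (x : X.obj (op n)) : C(TSimplex n, SSet.toTop.obj X) :=
  TopCat.toSSetObjEquiv _ (op n) ((sSetTopAdj.unit.app X).app (op n) x)

lemma toTop_map_charMap (f : X ⟶ Y) {n : SimplexCategory} (x : X.obj (op n)) (t : TSimplex n) :
    SSet.toTop.map f (charMap x t) = charMap (f.app (op n) x) t := by
  have h := congrArg (fun a => a.app (op n) x) (sSetTopAdj.unit.naturality f)
  exact congrArg (fun a => TopCat.toSSetObjEquiv _ (op n) a t) h.symm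

lemma charMap_map {m n : SimplexCategory} (θ : m ⟶ n) (x : X.obj (op n)) (t : TSimplex m) :
    charMap (X.map θ.op x) t = charMap x (stdSimplex.map θ t) := by
  have h := congrArg (fun a => a x) ((sSetTopAdj.unit.app X).naturality θ.op)
  exact congrArg (fun a => TopCat.toSSetObjEquiv _ (op m) a t) h

/-- The continuous map out of a realization that is given by a compatible family of maps on
topological simplices. -/
def realizationDesc {Z : Type u} [TopologicalSpace Z]
    (g : ∀ (n : SimplexCategory), X.obj (op n) → C(TSimplex n, Z))
    (hg : ∀ {m n : SimplexCategory} (θ : m ⟶ n) (x : X.obj (op n)) (t : TSimplex m),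
      g m (X.map θ.op x) t = g n x (stdSimplex.map θ t)) :
    C(SSet.toTop.obj X, Z) :=
  ((sSetTopAdj.homEquiv X (TopCat.of Z)).symm
    { app := fun n => TypeCat.ofHom (fun x => ((TopCat.of Z).toSSetObjEquiv n).symm (g n.unop x))
      naturality := fun n m θ => by
        ext x
        apply ((TopCat.of Z).toSSetObjEquiv m).injective
        ext t
        exact (Equiv.apply_symm_apply ((TopCat.of Z).toSSetObjEquiv m) _ ▸
          hg θ.unop x t) }).hom

lemma homEquiv_symm_charMap {Z : TopCat.{u}} (f : X ⟶ TopCat.toSSet.obj Z) {n : SimplexCategory}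
    (x : X.obj (op n)) (t : TSimplex n) :
    (sSetTopAdj.homEquiv X Z).symm f (charMap x t) =
      TopCat.toSSetObjEquiv _ (op n) (f.app (op n) x) t := by
  obtain ⟨g, rfl⟩ := (sSetTopAdj.homEquiv X Z).surjective f
  rw [Equiv.symm_apply_apply, Adjunction.homEquiv_unit]
  rfl

lemma realizationDesc_charMap {Z : Type u} [TopologicalSpace Z]
    (g : ∀ (n : SimplexCategory), X.obj (op n) → C(TSimplex n, Z))
    (hg : ∀ {m n : SimplexCategory} (θ : m ⟶ n) (x : X.obj (op n)) (t : TSimplex m),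
      g m (X.map θ.op x) t = g n x (stdSimplex.map θ t)) {n : SimplexCategory}
    (x : X.obj (op n)) (t : TSimplex n) :
    realizationDesc g hg (charMap x t) = g n x t := by
  refine (homEquiv_symm_charMap _ x t).trans ?_
  exact congrArg (fun a : C(TSimplex n, Z) => a t)
    (Equiv.apply_symm_apply ((TopCat.of Z).toSSetObjEquiv (op n)) _)

lemma toTop_hom_ext {Z : TopCat.{u}} {f g : SSet.toTop.obj X ⟶ Z}
    (h : ∀ (n : SimplexCategory) (x : X.obj (op n)) (t : TSimplex n),
      f (charMap x t) = g (charMap x t)) : f = g := by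
  apply (sSetTopAdj.homEquiv X Z).injective
  ext n x
  apply (TopCat.toSSetObjEquiv Z n).injective
  ext t
  rw [Adjunction.homEquiv_unit, Adjunction.homEquiv_unit]
  exact h n.unop x t

-- The image of all simplices and the whole realization have the same classifying map to the
-- indiscrete two-point space.
lemma charMap_jointly_surjective (z : SSet.toTop.obj X) :
    ∃ (n : SimplexCategory) (x : X.obj (op n)) (t : TSimplex n), charMap x t = z := by
  let : TopologicalSpace (ULift.{u} Prop) := ⊤
  let f : SSet.toTop.obj X ⟶ TopCat.of (ULift.{u} Prop) := TopCat.ofHom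
    ⟨fun z => ⟨∃ (n : SimplexCategory) (x : X.obj (op n)) (t : TSimplex n), charMap x t = z⟩,
      continuous_top⟩
  let g : SSet.toTop.obj X ⟶ TopCat.of (ULift.{u} Prop) := TopCat.ofHom
    ⟨fun _ => ⟨True⟩, continuous_top⟩
  have h : f = g := toTop_hom_ext (fun n x t =>
    congrArg ULift.up (eq_true ⟨n, x, t, rfl⟩))
  have h' : f z = g z := by rw [h]
  exact of_eq_true (congrArg ULift.down h')

end Points

/-! ## Distributions on finite sets -/

section Distributions

open Finset

variable {α β : Type*} [Fintype α] [Fintype β]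

lemma stdSimplex_map_apply [DecidableEq β] (g : α → β) (f : stdSimplex ℝ α) (b : β) :
    stdSimplex.map g f b = ∑ a with g a = b, f a := by
  rw [stdSimplex.map_coe, FunOnFinite.linearMap_apply_apply]

lemma sum_filter_stdSimplex_map (g : α → β) (f : stdSimplex ℝ α) (p : β → Prop)
    [DecidablePred p] : ∑ b with p b, stdSimplex.map g f b = ∑ a with p (g a), f a := by
  classical
  simp_rw [stdSimplex_map_apply]
  rw [sum_filter, sum_filter, ← sum_fiberwise (g := g) univ]
  refine sum_congr rfl fun b _ => ?_
  split_ifs with hb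
  · exact sum_congr rfl fun a ha => by rw [if_pos ((mem_filter.1 ha).2 ▸ hb)]
  · exact (sum_eq_zero fun a ha => by rw [if_neg ((mem_filter.1 ha).2 ▸ hb)]).symm

lemma stdSimplex_support_nonempty (f : stdSimplex ℝ α) : (Function.support f).Nonempty := by
  by_contra h
  have h0 : ∀ a, f a = 0 := by simpa [Set.not_nonempty_iff_eq_empty, funext_iff] using h
  simpa [h0] using stdSimplex.sum_eq_one f

lemma support_stdSimplex_map (g : α → β) (f : stdSimplex ℝ α) :
    Function.support (stdSimplex.map g f) = g '' Function.support f := by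
  classical
  ext b
  rw [Function.mem_support, stdSimplex_map_apply, ne_eq,
    sum_eq_zero_iff_of_nonneg fun a _ => stdSimplex.zero_le f a]
  simp only [mem_filter, mem_univ, true_and, not_forall, Set.mem_image, Function.mem_support]
  exact exists_congr fun a => ⟨fun ⟨h, h'⟩ => ⟨h', h⟩, fun ⟨h, h'⟩ => ⟨h', h⟩⟩

lemma stdSimplex_map_apply_of_injective {g : α → β} (hg : Function.Injective g)
    (f : stdSimplex ℝ α) (a : α) : stdSimplex.map g f (g a) = f a := by
  classical
  have hfiber : univ.filter (fun a' => g a' = g a) = {a} := by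
    ext a'
    simp [hg.eq_iff]
  rw [stdSimplex_map_apply, hfiber, sum_singleton]

lemma stdSimplex_map_injective {g : α → β} (hg : Function.Injective g) :
    Function.Injective (stdSimplex.map g : stdSimplex ℝ α → stdSimplex ℝ β) := by
  intro f f' h
  ext a
  rw [← stdSimplex_map_apply_of_injective hg f, h, stdSimplex_map_apply_of_injective hg]

lemma exists_stdSimplex_map_eq {g : α → β} (hg : Function.Injective g) {f : stdSimplex ℝ β}
    (hf : Function.support f ⊆ Set.range g) : ∃ f' : stdSimplex ℝ α, stdSimplex.map g f' = f := by
  have hsum : ∑ a, f (g a) = 1 := by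
    rw [← stdSimplex.sum_eq_one f]
    exact Fintype.sum_of_injective g hg _ _
      (fun b hb => Function.notMem_support.1 fun h => hb (hf h)) fun _ => rfl
  let f' : stdSimplex ℝ α := ⟨f ∘ g, fun a => stdSimplex.zero_le f (g a), hsum⟩
  refine ⟨f', stdSimplex.ext (funext fun b => ?_)⟩
  by_cases hb : b ∈ Set.range g
  · obtain ⟨a, rfl⟩ := hb
    exact stdSimplex_map_apply_of_injective hg f' a
  · have hb' : b ∉ Function.support (stdSimplex.map g f') := by
      rw [support_stdSimplex_map]
      exact fun h => hb (Set.image_subset_range _ _ h)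
    rw [Function.notMem_support.1 hb', Function.notMem_support.1 fun h => hb (hf h)]

lemma stdSimplex_map_const [DecidableEq β] (b : β) (f : stdSimplex ℝ α) :
    stdSimplex.map (fun _ => b) f = stdSimplex.vertex b := by
  ext b'
  rw [stdSimplex_map_apply, stdSimplex.vertex_coe]
  obtain rfl | h := eq_or_ne b b'
  · simp
  · simp [h, h.symm]

lemma stdSimplex_map_fst_apply (f : stdSimplex ℝ (α × β)) (a : α) :
    stdSimplex.map Prod.fst f a = ∑ b, f (a, b) := by
  classical
  simp [stdSimplex_map_apply, sum_filter, Fintype.sum_prod_type_right, sum_ite_eq']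

lemma stdSimplex_map_snd_apply (f : stdSimplex ℝ (α × β)) (b : β) :
    stdSimplex.map Prod.snd f b = ∑ a, f (a, b) := by
  classical
  simp [stdSimplex_map_apply, sum_filter, Fintype.sum_prod_type, sum_ite_eq']

end Distributions

section ChainSupported

variable {P Q : Type*} [PartialOrder P] [Fintype P] [PartialOrder Q] [Fintype Q]

/-- A distribution on a finite partially ordered set whose support is a chain. -/
def ChainSupported (f : stdSimplex ℝ P) : Prop :=
  IsChain (· ≤ ·) (Function.support f)

lemma ChainSupported.map {f : stdSimplex ℝ P} (hf : ChainSupported f) {g : P → Q}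
    (hg : Monotone g) : ChainSupported (stdSimplex.map g f) := by
  rw [ChainSupported, support_stdSimplex_map]
  exact hg.isChain_image hf

lemma chainSupported_map {n : ℕ} (c : Fin n →o P) (t : stdSimplex ℝ (Fin n)) :
    ChainSupported (stdSimplex.map c t) :=
  ChainSupported.map (isChain_of_trichotomous _) c.monotone

lemma ChainSupported.of_map {f : stdSimplex ℝ P} (e : P ↪o Q)
    (hf : ChainSupported (stdSimplex.map e f)) : ChainSupported f := by
  rwa [ChainSupported, support_stdSimplex_map, IsChain.image_embedding_iff] at hf

lemma ChainSupported.exists_map_eq {f : stdSimplex ℝ P} (hf : ChainSupported f) :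
    ∃ (n : ℕ) (c : Fin (n + 1) →o P) (t : stdSimplex ℝ (Fin (n + 1))), stdSimplex.map c t = f := by
  classical
  let S := Function.support f
  let _ : LinearOrder S :=
    { (inferInstance : PartialOrder S) with
      le_total := fun p q => hf.total p.2 q.2
      toDecidableLE := Classical.decRel _ }
  have : Nonempty S := (stdSimplex_support_nonempty f).to_subtype
  obtain ⟨n, hn⟩ := Nat.exists_eq_succ_of_ne_zero (Fintype.card_ne_zero (α := S))
  let e : Fin (n + 1) ≃o S := Fintype.orderIsoFinOfCardEq S hn
  let c : Fin (n + 1) →o P := ⟨fun i => e i, fun i j h => e.monotone h⟩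
  obtain ⟨t, ht⟩ := exists_stdSimplex_map_eq (g := c) (Subtype.val_injective.comp e.injective)
    fun p hp => ⟨e.symm ⟨p, hp⟩, congrArg Subtype.val (e.apply_symm_apply _)⟩
  exact ⟨n, c, t, ht⟩

end ChainSupported

/-! ## Monotone couplings -/

section CumulativeSums

open Finset

lemma sum_cumulative_sub {α : Type*} [LinearOrder α] (r : α → ℝ) (g : ℝ → ℝ) (s : Finset α) :
    ∑ j ∈ s, (g (∑ i ∈ s with i ≤ j, r i) - g (∑ i ∈ s with i < j, r i)) =
      g (∑ i ∈ s, r i) - g 0 := by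
  induction s using Finset.induction_on_max with
  | empty => simp
  | insert a s ha ih =>
    have has : a ∉ s := fun h => lt_irrefl _ (ha a h)
    have hle : (insert a s).filter (fun i => i ≤ a) = insert a s :=
      filter_true_of_mem fun i hi => (mem_insert.1 hi).elim (fun h => h.le) fun h => (ha i h).le
    have hlt : (insert a s).filter (fun i => i < a) = s := by
      rw [filter_insert, if_neg (lt_irrefl a)]
      exact filter_true_of_mem ha
    have hrest : ∑ j ∈ s, (g (∑ i ∈ insert a s with i ≤ j, r i) -
        g (∑ i ∈ insert a s with i < j, r i)) = g (∑ i ∈ s, r i) - g 0 := by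
      refine (sum_congr rfl fun j hj => ?_).trans ih
      rw [filter_insert, if_neg (not_le.2 (ha j hj)), filter_insert, if_neg (not_lt.2 (ha j hj).le)]
    rw [sum_insert has, hle, hlt, hrest]
    ring

lemma eq_of_sum_le_eq {P : Type*} [PartialOrder P] [Fintype P] [DecidableLE P] {f g : P → ℝ}
    (h : ∀ p, ∑ q with q ≤ p, f q = ∑ q with q ≤ p, g q) : f = g := by
  classical
  ext p
  induction p using WellFoundedLT.induction with
  | ind p ih =>
    have hp := h p
    have hfilter : univ.filter (fun q => q ≤ p) = insert p (univ.filter fun q => q < p) := by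
      ext q
      simp [le_iff_eq_or_lt]
    rw [hfilter, sum_insert (by simp), sum_insert (by simp),
      sum_congr rfl fun q hq => ih q (mem_filter.1 hq).2] at hp
    exact add_right_cancel hp

variable {α : Type*} [LinearOrder α] [Fintype α]

/-- The cumulative distribution function. -/
def cumLE (t : stdSimplex ℝ α) (i : α) : ℝ := ∑ j with j ≤ i, t j

/-- The left-continuous cumulative distribution function. -/
def cumLT (t : stdSimplex ℝ α) (i : α) : ℝ := ∑ j with j < i, t j

lemma cumLE_eq (t : stdSimplex ℝ α) (i : α) : cumLE t i = cumLT t i + t i := by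
  have hfilter : univ.filter (fun j => j ≤ i) = insert i (univ.filter fun j => j < i) := by
    ext j
    simp [le_iff_eq_or_lt]
  rw [cumLE, hfilter, sum_insert (by simp), add_comm]
  rfl

lemma cumLT_le_cumLE (t : stdSimplex ℝ α) (i : α) : cumLT t i ≤ cumLE t i := by
  rw [cumLE_eq]
  exact le_add_of_nonneg_right (stdSimplex.zero_le t i)

lemma cumLE_le_cumLT (t : stdSimplex ℝ α) {i j : α} (h : i < j) : cumLE t i ≤ cumLT t j :=
  sum_le_sum_of_subset_of_nonneg (monotone_filter_right _ fun _ _ hk => lt_of_le_of_lt hk h)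
    fun k _ _ => stdSimplex.zero_le t k

lemma cumLT_nonneg (t : stdSimplex ℝ α) (i : α) : 0 ≤ cumLT t i :=
  sum_nonneg fun _ _ => stdSimplex.zero_le t _

lemma cumLE_nonneg (t : stdSimplex ℝ α) (i : α) : 0 ≤ cumLE t i :=
  (cumLT_nonneg t i).trans (cumLT_le_cumLE t i)

lemma cumLE_le_one (t : stdSimplex ℝ α) (i : α) : cumLE t i ≤ 1 := by
  rw [← stdSimplex.sum_eq_one t]
  exact sum_le_sum_of_subset_of_nonneg (filter_subset _ _) fun k _ _ => stdSimplex.zero_le t k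

lemma sum_cumLE_sub_cumLT (t : stdSimplex ℝ α) (g : ℝ → ℝ) :
    ∑ i, (g (cumLE t i) - g (cumLT t i)) = g 1 - g 0 := by
  rw [← stdSimplex.sum_eq_one t]
  exact sum_cumulative_sub t g univ

end CumulativeSums

section Couplings

open Finset

lemma forall_snd_le_or_forall_fst_le_of_isChain {α β : Type*} [LinearOrder α] [LinearOrder β]
    {s : Set (α × β)} (hs : IsChain (· ≤ ·) s) (p : α × β) :
    (∀ x ∈ s, x.1 ≤ p.1 → x.2 ≤ p.2) ∨ ∀ x ∈ s, x.2 ≤ p.2 → x.1 ≤ p.1 := by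
  by_contra! h
  obtain ⟨⟨x, hx, hx₁, hx₂⟩, y, hy, hy₂, hy₁⟩ := h
  rcases hs.total hx hy with hxy | hxy
  · exact (hx₂.trans_le (hxy.2.trans hy₂)).false
  · exact (hy₁.trans_le (hxy.1.trans hx₁)).false

variable {α β : Type*} [LinearOrder α] [Fintype α] [LinearOrder β] [Fintype β]

lemma ChainSupported.sum_le_eq_min {f : stdSimplex ℝ (α × β)} (hf : ChainSupported f)
    (p : α × β) : ∑ q with q ≤ p, f q =
      min (cumLE (stdSimplex.map Prod.fst f) p.1) (cumLE (stdSimplex.map Prod.snd f) p.2) := by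
  have hsub : ∀ r : α × β → Prop, ∀ [DecidablePred r], (∀ x, x ≤ p → r x) →
      ∑ q with q ≤ p, f q ≤ ∑ x with r x, f x := fun r _ hr =>
    sum_le_sum_of_subset_of_nonneg (monotone_filter_right _ fun x _ => hr x)
      fun x _ _ => stdSimplex.zero_le f x
  have hsup : ∀ r : α × β → Prop, ∀ [DecidablePred r], (∀ x, f x ≠ 0 → r x → x ≤ p) →
      ∑ x with r x, f x ≤ ∑ q with q ≤ p, f q := fun r _ hr => by
    rw [sum_filter, sum_filter]
    refine sum_le_sum fun x _ => ?_
    by_cases hx : f x = 0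
    · simp [hx]
    · split_ifs with h h'
      exacts [le_rfl, absurd (hr x hx h) h', stdSimplex.zero_le f x, le_rfl]
  rw [cumLE, cumLE, sum_filter_stdSimplex_map, sum_filter_stdSimplex_map]
  refine le_antisymm (le_min (hsub _ fun x h => h.1) (hsub _ fun x h => h.2)) (min_le_iff.2 ?_)
  refine (forall_snd_le_or_forall_fst_le_of_isChain hf p).imp (fun h => ?_) fun h => ?_
  · exact hsup _ fun x hx hx₁ => ⟨hx₁, h x hx hx₁⟩
  · exact hsup _ fun x hx hx₂ => ⟨h x hx hx₂, hx₂⟩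

lemma ChainSupported.eq_of_marginals {f g : stdSimplex ℝ (α × β)} (hf : ChainSupported f)
    (hg : ChainSupported g) (hfst : stdSimplex.map Prod.fst f = stdSimplex.map Prod.fst g)
    (hsnd : stdSimplex.map Prod.snd f = stdSimplex.map Prod.snd g) : f = g :=
  stdSimplex.ext (eq_of_sum_le_eq fun p => by
    rw [hf.sum_le_eq_min, hg.sum_le_eq_min, hfst, hsnd])

lemma overlap_eq_sub {a b c d : ℝ} (hab : a ≤ b) (hcd : c ≤ d) :
    max 0 (min b d - max a c) = max a (min b d) - max a (min b c) := by
  grind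

/-- The length of the overlap of the interval `(cumLT a i, cumLE a i]`, on which the quantile
function of `a` takes the value `i`, with the corresponding interval of `b` and `j`. -/
def quantileOverlap (a : stdSimplex ℝ α) (b : stdSimplex ℝ β) (i : α) (j : β) : ℝ :=
  max 0 (min (cumLE a i) (cumLE b j) - max (cumLT a i) (cumLT b j))

lemma quantileOverlap_comm (a : stdSimplex ℝ α) (b : stdSimplex ℝ β) (i : α) (j : β) :
    quantileOverlap a b i j = quantileOverlap b a j i := by
  rw [quantileOverlap, quantileOverlap, min_comm, max_comm (cumLT a i)]

lemma sum_quantileOverlap (a : stdSimplex ℝ α) (b : stdSimplex ℝ β) (i : α) :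
    ∑ j, quantileOverlap a b i j = a i := by
  have htelescope := sum_cumLE_sub_cumLT b fun x => max (cumLT a i) (min (cumLE a i) x)
  simp only [quantileOverlap, overlap_eq_sub (cumLT_le_cumLE a i) (cumLT_le_cumLE b _)]
  rw [htelescope, min_eq_left (cumLE_le_one a i), max_eq_right (cumLT_le_cumLE a i),
    min_eq_right (cumLE_nonneg a i), max_eq_left (cumLT_nonneg a i), cumLE_eq]
  ring

lemma cumLT_lt_cumLE_of_quantileOverlap_ne_zero {a : stdSimplex ℝ α} {b : stdSimplex ℝ β} {i : α}
    {j : β} (h : quantileOverlap a b i j ≠ 0) : cumLT a i < cumLE b j := by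
  by_contra! hle
  refine h (max_eq_left (sub_nonpos.2 ?_))
  exact (min_le_right _ _).trans (hle.trans (le_max_left _ _))

lemma le_of_quantileOverlap_ne_zero {a : stdSimplex ℝ α} {b : stdSimplex ℝ β} {i i' : α}
    {j j' : β} (h : quantileOverlap a b i j ≠ 0) (h' : quantileOverlap a b i' j' ≠ 0)
    (hi : i < i') : j ≤ j' := by
  by_contra! hj
  rw [quantileOverlap_comm] at h
  linarith [cumLE_le_cumLT a hi, cumLE_le_cumLT b hj, cumLT_lt_cumLE_of_quantileOverlap_ne_zero h,
    cumLT_lt_cumLE_of_quantileOverlap_ne_zero h']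

/-- The monotone coupling of two distributions: the joint distribution of their quantile
functions, evaluated at a common uniformly distributed random variable. -/
def monotoneCoupling (a : stdSimplex ℝ α) (b : stdSimplex ℝ β) : stdSimplex ℝ (α × β) :=
  ⟨fun p => quantileOverlap a b p.1 p.2, fun _ => le_max_left _ _, by
    simp only [Fintype.sum_prod_type, sum_quantileOverlap, stdSimplex.sum_eq_one]⟩

lemma monotoneCoupling_apply (a : stdSimplex ℝ α) (b : stdSimplex ℝ β) (p : α × β) :
    monotoneCoupling a b p = quantileOverlap a b p.1 p.2 := rfl

lemma map_fst_monotoneCoupling (a : stdSimplex ℝ α) (b : stdSimplex ℝ β) :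
    stdSimplex.map Prod.fst (monotoneCoupling a b) = a := by
  ext i
  simp only [stdSimplex_map_fst_apply, monotoneCoupling_apply, sum_quantileOverlap]

lemma map_snd_monotoneCoupling (a : stdSimplex ℝ α) (b : stdSimplex ℝ β) :
    stdSimplex.map Prod.snd (monotoneCoupling a b) = b := by
  ext j
  simp only [stdSimplex_map_snd_apply, monotoneCoupling_apply, quantileOverlap_comm a b,
    sum_quantileOverlap]

lemma chainSupported_monotoneCoupling (a : stdSimplex ℝ α) (b : stdSimplex ℝ β) :
    ChainSupported (monotoneCoupling a b) := by
  intro p hp q hq _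
  rcases lt_trichotomy p.1 q.1 with h | h | h
  · exact Or.inl ⟨h.le, le_of_quantileOverlap_ne_zero hp hq h⟩
  · exact (le_total p.2 q.2).imp (fun h' => ⟨h.le, h'⟩) fun h' => ⟨h.ge, h'⟩
  · exact Or.inr ⟨h.le, le_of_quantileOverlap_ne_zero hq hp h⟩

end Couplings

/-! ## Realizations of nerves of partially ordered sets -/

section Chains

lemma exists_nonDegenerate_charMap_eq {X : SSet.{u}} (z : SSet.toTop.obj X) :
    ∃ (n : ℕ) (x : X.obj (op ⦋n⦌)) (t : TSimplex ⦋n⦌), charMap x t = z ∧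
      x ∈ X.nonDegenerate n ∧ Function.support t = Set.univ := by
  classical
  have hz : ∃ (n : ℕ) (x : X.obj (op ⦋n⦌)) (t : TSimplex ⦋n⦌), charMap x t = z := by
    obtain ⟨n, x, t, h⟩ := charMap_jointly_surjective z
    exact ⟨n.len, x, t, h⟩
  generalize hn : Nat.find hz = n
  have hmin : ∀ {m : ℕ} (y : X.obj (op ⦋m⦌)) (s : TSimplex ⦋m⦌), charMap y s = z → n ≤ m :=
    fun y s h => hn ▸ Nat.find_le ⟨y, s, h⟩
  obtain ⟨x, t, rfl⟩ := hn ▸ Nat.find_spec hz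
  refine ⟨n, x, t, rfl, fun hx => ?_, Set.eq_univ_of_forall fun i hi => ?_⟩
  · obtain ⟨m, hm, σ, -, y, rfl⟩ := (X.mem_degenerate_iff x).1 hx
    exact (hmin y (stdSimplex.map σ t) (charMap_map σ y t).symm).not_gt hm
  · obtain _ | n := n
    · exact one_ne_zero ((stdSimplex.eq_one_of_unique (X := Fin 1) t i).symm.trans hi)
    have hsupport : Function.support t ⊆ Set.range (SimplexCategory.δ i) := fun j hj =>
      (Fin.range_succAbove i).ge fun h : j = i => hj (h ▸ hi)
    obtain ⟨s, rfl⟩ := exists_stdSimplex_map_eq Fin.succAbove_right_injective hsupport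
    exact (hmin (X.map (SimplexCategory.δ i).op x) s (charMap_map _ x s)).not_gt n.lt_succ_self

/-- The nerve of a partially ordered set. -/
def chains (P : Type) [PartialOrder P] : SSet.{u} where
  obj n := ULift.{u} (Fin (n.unop.len + 1) →o P)
  map θ := TypeCat.ofHom fun c => ⟨c.down.comp θ.unop.toOrderHom⟩
  map_id _ := rfl
  map_comp _ _ := rfl

/-- The simplex of the nerve given by a chain. -/
def chain {P : Type} [PartialOrder P] {n : SimplexCategory} (c : Fin (n.len + 1) →o P) :
    (chains.{u} P).obj (op n) := ULift.up c

lemma strictMono_of_mem_nonDegenerate {P : Type} [PartialOrder P] {n : ℕ} {c : Fin (n + 1) →o P}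
    (hc : chain (n := ⦋n⦌) c ∈ (chains.{u} P).nonDegenerate n) : StrictMono c := by
  obtain _ | n := n
  · exact Subsingleton.strictMono (α := Fin 1) c
  refine Fin.strictMono_iff_lt_succ.2 fun i =>
    (c.monotone Fin.castSucc_lt_succ.le).lt_of_ne fun hi => hc ?_
  have hσ : (chains.{u} P).σ i ((chains.{u} P).δ i.succ (chain (n := ⦋n + 1⦌) c)) =
      chain (n := ⦋n + 1⦌) c := by
    refine ULift.ext _ _ (OrderHom.ext _ _ (funext fun j => ?_))
    change c (i.succ.succAbove (i.predAbove j)) = c j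
    by_cases hj : j = i.succ
    · rw [hj, Fin.predAbove_succ_self, Fin.succAbove_of_castSucc_lt _ _ Fin.castSucc_lt_succ, hi]
    · rw [Fin.succ_succAbove_predAbove hj]
  rw [← hσ]
  exact SSet.σ_mem_degenerate _ i _

lemma exists_strictMono_charMap_chain_eq {P : Type} [PartialOrder P]
    (z : SSet.toTop.obj (chains.{u} P)) :
    ∃ (n : ℕ) (c : Fin (n + 1) →o P) (t : TSimplex ⦋n⦌), charMap (n := ⦋n⦌) (chain c) t = z ∧
      StrictMono c ∧ Function.support t = Set.univ := by
  obtain ⟨n, ⟨c⟩, t, hz, hc, ht⟩ := exists_nonDegenerate_charMap_eq z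
  exact ⟨n, c, t, hz, strictMono_of_mem_nonDegenerate hc, ht⟩

variable (P : Type) [PartialOrder P] [Fintype P]

/-- Barycentric coordinates on the realization of a nerve. -/
def chainsCoord : C(SSet.toTop.obj (chains.{u} P), ULift.{u} (stdSimplex ℝ P)) :=
  realizationDesc
    (fun _ c => ⟨fun t => ⟨stdSimplex.map c.down t⟩,
      continuous_uliftUp.comp (stdSimplex.continuous_map _)⟩)
    (fun θ c t => congrArg ULift.up (stdSimplex.map_comp_apply θ c.down t).symm)

variable {P}

lemma chainsCoord_charMap {n : SimplexCategory} (c : Fin (n.len + 1) →o P) (t : TSimplex n) :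
    chainsCoord P (charMap (chain c) t) = ⟨stdSimplex.map c t⟩ :=
  realizationDesc_charMap (X := chains P) _
    (fun θ c t => congrArg ULift.up (stdSimplex.map_comp_apply θ c.down t).symm) _ _

lemma chainsCoord_injective : Function.Injective (chainsCoord.{u} P) := by
  intro z z' h
  obtain ⟨m, c, t, rfl, hc, ht⟩ := exists_strictMono_charMap_chain_eq z
  obtain ⟨n, d, s, rfl, hd, hs⟩ := exists_strictMono_charMap_chain_eq z'
  replace h : stdSimplex.map c t = stdSimplex.map d s := congrArg ULift.down
    ((chainsCoord_charMap (n := ⦋m⦌) c t).symm.trans (h.trans (chainsCoord_charMap (n := ⦋n⦌) d s)))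
  have hrange : Set.range c = Set.range d := by
    have hsupport := congrArg (fun f : stdSimplex ℝ P => Function.support f) h
    simpa only [support_stdSimplex_map, ht, hs, Set.image_univ] using hsupport
  have hmn : m = n := by
    have hcard := congrArg Set.ncard hrange
    rw [Set.ncard_range_of_injective hc.injective, Set.ncard_range_of_injective hd.injective]
      at hcard
    simpa using hcard
  subst hmn
  obtain rfl : c = d := DFunLike.coe_injective ((hc.range_inj hd).1 hrange)
  rw [stdSimplex_map_injective hc.injective h]

lemma compactSpace_toTop_chains (P : Type) [PartialOrder P] [Finite P] :
    CompactSpace (SSet.toTop.obj (chains.{u} P)) := by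
  have := Fintype.ofFinite P
  have hcover : (Set.univ : Set (SSet.toTop.obj (chains.{u} P))) =
      ⋃ n ∈ Finset.range (Fintype.card P), ⋃ c : Fin (n + 1) →o P,
        Set.range (charMap (n := ⦋n⦌) (chain.{u} c)) := by
    refine (Set.eq_univ_of_forall fun z => ?_).symm
    obtain ⟨n, c, t, rfl, hc, -⟩ := exists_strictMono_charMap_chain_eq z
    have hn : n < Fintype.card P := by simpa using Fintype.card_le_of_injective _ hc.injective
    simp only [Set.mem_iUnion]
    exact ⟨n, Finset.mem_range.2 hn, c, t, rfl⟩
  refine ⟨?_⟩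
  rw [hcover]
  refine Finset.isCompact_biUnion _ fun n _ => ?_
  have : Finite (Fin (n + 1) →o P) := Finite.of_injective _ DFunLike.coe_injective
  exact isCompact_iUnion fun c => isCompact_range (charMap (chain c)).continuous

variable {Z : Type} {g : stdSimplex ℝ P → Z}

lemma bijective_comp_chainsCoord (hg : Set.BijOn g {f | ChainSupported f} Set.univ) :
    Function.Bijective fun z : SSet.toTop.obj (chains.{u} P) => g (chainsCoord P z).down := by
  have hcoord : ∀ z : SSet.toTop.obj (chains.{u} P), ChainSupported (chainsCoord P z).down := by
    intro z
    obtain ⟨n, ⟨c⟩, t, rfl⟩ := charMap_jointly_surjective z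
    exact (congrArg (fun f => ChainSupported (ULift.down f)) (chainsCoord_charMap c t)).mpr
      (chainSupported_map c t)
  refine ⟨fun z z' h => chainsCoord_injective (ULift.down_injective
    (hg.injOn (hcoord z) (hcoord z') h)), fun w => ?_⟩
  obtain ⟨f, hf, rfl⟩ := hg.surjOn (Set.mem_univ w)
  obtain ⟨n, c, t, rfl⟩ := hf.exists_map_eq
  exact ⟨charMap (n := ⦋n⦌) (chain c) t,
    congrArg (fun f => g (ULift.down f)) (chainsCoord_charMap (n := ⦋n⦌) c t)⟩

variable [TopologicalSpace Z] [T2Space Z]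

/-- A Hausdorff space that is parametrized by the chain-supported distributions on `P` is
homeomorphic to the realization of the nerve of `P`. -/
def chainsHomeo (hg : Set.BijOn g {f | ChainSupported f} Set.univ) (hc : Continuous g) :
    SSet.toTop.obj (chains.{u} P) ≃ₜ Z :=
  have := compactSpace_toTop_chains.{u} P
  Continuous.homeoOfEquivCompactToT2 (f := Equiv.ofBijective _ (bijective_comp_chainsCoord hg))
    (hc.comp (continuous_uliftDown.comp (chainsCoord P).continuous))

lemma chainsHomeo_symm_apply (hg : Set.BijOn g {f | ChainSupported f} Set.univ)
    (hc : Continuous g) {n : SimplexCategory} (c : Fin (n.len + 1) →o P) (t : TSimplex n) :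
    (chainsHomeo.{u} hg hc).symm (g (stdSimplex.map c t)) = charMap (chain c) t := by
  rw [Homeomorph.symm_apply_eq]
  exact (congrArg (fun f => g (ULift.down f)) (chainsCoord_charMap c t)).symm

end Chains

/-! ## Realizations of simplicial homotopies -/

section Homotopies

open MonoidalCategory

/-- The two marginals of a distribution on a product. -/
def marginals {α β : Type} [Fintype α] [Fintype β] (f : stdSimplex ℝ (α × β)) :
    stdSimplex ℝ α × stdSimplex ℝ β :=
  (stdSimplex.map Prod.fst f, stdSimplex.map Prod.snd f)

lemma marginals_map {α β γ : Type} [Fintype α] [Fintype β] [Fintype γ] (c : γ → α) (d : γ → β)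
    (t : stdSimplex ℝ γ) : marginals (stdSimplex.map (fun i => (c i, d i)) t) =
      (stdSimplex.map c t, stdSimplex.map d t) :=
  Prod.ext (stdSimplex.map_comp_apply _ _ _) (stdSimplex.map_comp_apply _ _ _)

lemma continuous_marginals {α β : Type} [Fintype α] [Fintype β] :
    Continuous (marginals : stdSimplex ℝ (α × β) → _) :=
  (stdSimplex.continuous_map _).prodMk (stdSimplex.continuous_map _)

lemma bijOn_marginals {α β : Type} [Fintype α] [Fintype β] [LinearOrder α] [LinearOrder β] :
    Set.BijOn (marginals : stdSimplex ℝ (α × β) → _) {f | ChainSupported f} Set.univ :=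
  ⟨Set.mapsTo_univ _ _,
    fun _ hf _ hf' h => ChainSupported.eq_of_marginals hf hf' (congrArg Prod.fst h)
      (congrArg Prod.snd h),
    fun z _ => ⟨monotoneCoupling z.1 z.2, chainSupported_monotoneCoupling _ _,
      Prod.ext (map_fst_monotoneCoupling _ _) (map_snd_monotoneCoupling _ _)⟩⟩

/-- The triangulation of the prism `|Δⁿ| × |Δ¹|`. -/
def prismHomeo (n : SimplexCategory) :
    SSet.toTop.obj (chains.{u} (Fin (n.len + 1) × Fin 2)) ≃ₜ TSimplex n × stdSimplex ℝ (Fin 2) :=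
  chainsHomeo bijOn_marginals continuous_marginals

lemma prismHomeo_symm_map {k n : SimplexCategory} (c : k ⟶ n) (χ : k ⟶ ⦋1⦌) (t : TSimplex k) :
    (prismHomeo.{u} n).symm (stdSimplex.map c t, stdSimplex.map χ t) =
      charMap (chain (c.toOrderHom.prod χ.toOrderHom)) t := by
  rw [prismHomeo, ← chainsHomeo_symm_apply bijOn_marginals continuous_marginals]
  exact congrArg _ (marginals_map _ _ t).symm

/-- A monotone map as a morphism of the simplex category. -/
def ordHom {m n : SimplexCategory} (c : Fin (m.len + 1) →o Fin (n.len + 1)) : m ⟶ n :=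
  SimplexCategory.Hom.mk c

lemma ordHom_eq {m n : SimplexCategory} {c : Fin (m.len + 1) →o Fin (n.len + 1)} {θ : m ⟶ n}
    (h : ⇑c = θ.toOrderHom) : ordHom c = θ :=
  SimplexCategory.Hom.ext _ _ ((SimplexCategory.Hom.toOrderHom_mk _).trans (OrderHom.ext _ _ h))

lemma exists_map_eq_and_map_eq {m n : ℕ} (t : TSimplex ⦋m⦌) (s : TSimplex ⦋n⦌) :
    ∃ (k : SimplexCategory) (c : k ⟶ ⦋m⦌) (d : k ⟶ ⦋n⦌) (r : TSimplex k),
      stdSimplex.map c r = t ∧ stdSimplex.map d r = s := by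
  obtain ⟨k, c, r, h⟩ := (chainSupported_monotoneCoupling t s).exists_map_eq
  refine ⟨⦋k⦌, ordHom (OrderHom.fst.comp c),
    ordHom (OrderHom.snd.comp c), r, ?_, ?_⟩
  · rw [← map_fst_monotoneCoupling t s, ← h, stdSimplex.map_comp_apply]
    rfl
  · rw [← map_snd_monotoneCoupling t s, ← h, stdSimplex.map_comp_apply]
    rfl

variable {X Y : SSet.{u}}

/-- The prism over a simplex `x` of `X`, as a map to the cylinder `X × Δ[1]`. -/
def prismMap {n : SimplexCategory} (x : X.obj (op n)) :
    chains.{u} (Fin (n.len + 1) × Fin 2) ⟶ X ⊗ Δ[1] where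
  app k := TypeCat.ofHom fun c =>
    (X.map (ordHom (m := k.unop) (n := n) (OrderHom.fst.comp c.down)).op x,
      SSet.stdSimplex.objEquiv.symm (ordHom (OrderHom.snd.comp c.down)))
  naturality k l θ := by
    ext ⟨c⟩
    refine Prod.ext ?_ rfl
    exact congrArg (fun a => a x) (X.map_comp (ordHom (m := k.unop) (n := n)
      (OrderHom.fst.comp c)).op θ)

lemma prismMap_chain {k n : SimplexCategory} (x : X.obj (op n)) (c : k ⟶ n) (χ : k ⟶ ⦋1⦌) :
    (prismMap x).app (op k) (chain (c.toOrderHom.prod χ.toOrderHom)) =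
      (X.map c.op x, SSet.stdSimplex.objEquiv.symm χ) := by
  have hc : ordHom (OrderHom.fst.comp (c.toOrderHom.prod χ.toOrderHom)) = c := ordHom_eq rfl
  have hχ : ordHom (OrderHom.snd.comp (c.toOrderHom.prod χ.toOrderHom)) = χ := ordHom_eq rfl
  exact Prod.ext (congrArg (fun a : k ⟶ n => X.map a.op x) hc)
    (congrArg SSet.stdSimplex.objEquiv.symm hχ)

/-- The map `|Δⁿ| × |Δ¹| → |X × Δ[1]|` given by a simplex of `X`. -/
def simplexCylinder {n : SimplexCategory} (x : X.obj (op n)) :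
    C(TSimplex n × stdSimplex ℝ (Fin 2), SSet.toTop.obj (X ⊗ Δ[1])) :=
  (SSet.toTop.map (prismMap x)).hom.comp ((prismHomeo n).symm : C(_, _))

lemma simplexCylinder_map_map {k n : SimplexCategory} (x : X.obj (op n)) (c : k ⟶ n)
    (χ : k ⟶ ⦋1⦌) (t : TSimplex k) :
    simplexCylinder x (stdSimplex.map c t, stdSimplex.map χ t) =
      charMap (X := X ⊗ Δ[1]) (n := k) (X.map c.op x, SSet.stdSimplex.objEquiv.symm χ) t :=
  (congrArg (SSet.toTop.map (prismMap x)) (prismHomeo_symm_map c χ t)).trans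
    ((toTop_map_charMap _ _ t).trans (congrArg (charMap · t) (prismMap_chain x c χ)))

lemma simplexCylinder_map {m n : SimplexCategory} (θ : m ⟶ n) (x : X.obj (op n)) (t : TSimplex m)
    (s : stdSimplex ℝ (Fin 2)) :
    simplexCylinder (X.map θ.op x) (t, s) = simplexCylinder x (stdSimplex.map θ t, s) := by
  obtain ⟨k, c, χ, r, rfl, rfl⟩ := exists_map_eq_and_map_eq (n := 1) t s
  have hθ : stdSimplex.map θ (stdSimplex.map c r) = stdSimplex.map (c ≫ θ) r :=
    stdSimplex.map_comp_apply _ _ _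
  have hx : X.map (c ≫ θ).op x = X.map c.op (X.map θ.op x) :=
    congrArg (fun a => a x) (X.map_comp θ.op c.op)
  rw [hθ, simplexCylinder_map_map, simplexCylinder_map_map, hx]

variable (X) in
/-- The map `|X| × |Δ¹| → |X × Δ[1]|`, in curried form. -/
def cylinder : C(SSet.toTop.obj X, C(stdSimplex ℝ (Fin 2), SSet.toTop.obj (X ⊗ Δ[1]))) :=
  realizationDesc (fun _ x => (simplexCylinder x).curry)
    (fun θ x t => ContinuousMap.ext fun s => simplexCylinder_map θ x t s)

lemma cylinder_charMap {n : SimplexCategory} (x : X.obj (op n)) (t : TSimplex n) :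
    cylinder X (charMap x t) = (simplexCylinder x).curry t :=
  realizationDesc_charMap _
    (fun θ x t => ContinuousMap.ext fun s => simplexCylinder_map θ x t s) x t

lemma cylinder_vertex (i : Fin 2) {ι : X ⟶ X ⊗ Δ[1]}
    (hι : ∀ {n : SimplexCategory} (x : X.obj (op n)), ι.app (op n) x =
      (x, SSet.stdSimplex.objEquiv.symm (ordHom (OrderHom.const _ i))))
    (z : SSet.toTop.obj X) : cylinder X z (stdSimplex.vertex i) = SSet.toTop.map ι z := by
  obtain ⟨n, x, t, rfl⟩ := charMap_jointly_surjective z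
  have hcyl := simplexCylinder_map_map x (𝟙 n)
    (ordHom (n := ⦋1⦌) (OrderHom.const _ i)) t
  have hid : stdSimplex.map (⇑(ConcreteCategory.hom (𝟙 n))) t = t := stdSimplex.map_id_apply t
  have hconst : stdSimplex.map (ordHom (m := n) (n := ⦋1⦌) (OrderHom.const _ i)) t =
      stdSimplex.vertex i := stdSimplex_map_const i t
  have hx : X.map (𝟙 n).op x = x := congrArg (fun a => a x) (X.map_id (op n))
  rw [hid, hconst, hx] at hcyl
  rw [cylinder_charMap, toTop_map_charMap, hι]
  exact hcyl

lemma homotopic_toTop_map_ι₀_ι₁ (X : SSet.{u}) : (SSet.toTop.map (SSet.ι₀ (X := X))).hom.Homotopic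
    (SSet.toTop.map (SSet.ι₁ (X := X))).hom :=
  ⟨{ toFun := fun p => cylinder X p.2 (stdSimplexHomeomorphUnitInterval.symm p.1)
     continuous_toFun := ((cylinder X).continuous.comp continuous_snd).eval
       (stdSimplexHomeomorphUnitInterval.symm.continuous.comp continuous_fst)
     map_zero_left := fun z => by
       rw [← stdSimplexHomeomorphUnitInterval_zero, Homeomorph.symm_apply_apply]
       exact cylinder_vertex 0 (fun _ => rfl) z
     map_one_left := fun z => by
       rw [← stdSimplexHomeomorphUnitInterval_one, Homeomorph.symm_apply_apply]
       exact cylinder_vertex 1 (fun _ => rfl) z }⟩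

lemma homotopic_toTop_map {f g : X ⟶ Y} (H : SSet.Homotopy f g) :
    (SSet.toTop.map f).hom.Homotopic (SSet.toTop.map g).hom := by
  have h₀ : SSet.toTop.map f = SSet.toTop.map SSet.ι₀ ≫ SSet.toTop.map H.h := by
    rw [← Functor.map_comp, H.h₀]
  have h₁ : SSet.toTop.map g = SSet.toTop.map SSet.ι₁ ≫ SSet.toTop.map H.h := by
    rw [← Functor.map_comp, H.h₁]
  rw [h₀, h₁]
  exact (ContinuousMap.Homotopic.refl _).comp (homotopic_toTop_map_ι₀_ι₁ X)

end Homotopies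

/-! ## Edgewise subdivision -/

section Subdivision

/-- The intervals `[k - a, k + 1 + a]` of `[2k + 1]`. The identification of `[2k + 1]` with the
join of `[k]ᵒᵖ` and `[k]` sends the two copies of `a` to the endpoints of the `a`-th interval. -/
def centredIntervals (k : ℕ) : Fin (k + 1) →o NonemptyInterval (Fin (2 * k + 1 + 1)) where
  toFun a := ⟨(⟨k - a, by lia⟩, ⟨k + 1 + a, by lia⟩), Fin.mk_le_mk.2 (by lia)⟩
  monotone' a b hab := ⟨Fin.mk_le_mk.2 (by lia), Fin.mk_le_mk.2 (by lia)⟩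

/-- The inclusion of `[k]ᵒᵖ` into its join with `[k]`. -/
abbrev joinLeft {k : ℕ} (a : Fin (k + 1)) : Fin (2 * k + 1 + 1) := (centredIntervals k a).fst

/-- The inclusion of `[k]` into the join of `[k]ᵒᵖ` with it. -/
abbrev joinRight {k : ℕ} (a : Fin (k + 1)) : Fin (2 * k + 1 + 1) := (centredIntervals k a).snd

lemma val_joinLeft {k : ℕ} (a : Fin (k + 1)) : (joinLeft a : ℕ) = k - a := rfl

lemma val_joinRight {k : ℕ} (a : Fin (k + 1)) : (joinRight a : ℕ) = k + 1 + a := rfl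

lemma exists_joinLeft_or_exists_joinRight {k : ℕ} (x : Fin (2 * k + 1 + 1)) :
    (∃ a, joinLeft a = x) ∨ ∃ a, joinRight a = x := by
  rcases le_or_gt x.1 k with h | h
  · exact Or.inl ⟨⟨k - x, by lia⟩, Fin.ext (by rw [val_joinLeft]; lia)⟩
  · exact Or.inr ⟨⟨x - k - 1, by lia⟩, Fin.ext (by rw [val_joinRight]; lia)⟩

variable {Q R : Type} [PartialOrder Q] [PartialOrder R] {k l : ℕ}

lemma join_hom_ext {f g : Fin (2 * k + 1 + 1) →o Q}
    (hleft : ∀ a : Fin (k + 1), f (joinLeft a) = g (joinLeft a))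
    (hright : ∀ a : Fin (k + 1), f (joinRight a) = g (joinRight a)) : f = g := by
  ext x
  obtain ⟨a, rfl⟩ | ⟨a, rfl⟩ := exists_joinLeft_or_exists_joinRight x
  exacts [hleft a, hright a]

/-- The chain in `Q` formed by the endpoints of a chain of intervals. -/
def endpoints (c : Fin (k + 1) →o NonemptyInterval Q) : Fin (2 * k + 1 + 1) →o Q where
  toFun x := if x.1 ≤ k then (c ⟨k - x, by lia⟩).fst else (c ⟨x - k - 1, by lia⟩).snd
  monotone' x y hxy := by
    dsimp only
    split_ifs with hx hy
    · exact (c.monotone (Fin.mk_le_mk.2 (by lia))).1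
    · exact (c.monotone (Fin.zero_le _)).1.trans
        ((c 0).fst_le_snd.trans (c.monotone (Fin.zero_le _)).2)
    · lia
    · exact (c.monotone (Fin.mk_le_mk.2 (by lia))).2

lemma endpoints_joinLeft (c : Fin (k + 1) →o NonemptyInterval Q) (a : Fin (k + 1)) :
    endpoints c (joinLeft a) = (c a).fst := by
  have hindex : (⟨k - (k - a), by lia⟩ : Fin (k + 1)) = a := Fin.ext (by lia)
  exact (if_pos (Nat.sub_le _ _)).trans (congrArg (fun b => (c b).fst) hindex)

lemma endpoints_joinRight (c : Fin (k + 1) →o NonemptyInterval Q) (a : Fin (k + 1)) :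
    endpoints c (joinRight a) = (c a).snd := by
  have hindex : (⟨k + 1 + a - k - 1, by lia⟩ : Fin (k + 1)) = a := Fin.ext (by lia)
  exact (if_neg (by rw [val_joinRight]; lia)).trans (congrArg (fun b => (c b).snd) hindex)

lemma endpoints_centredIntervals (k : ℕ) : endpoints (centredIntervals k) = OrderHom.id :=
  join_hom_ext (fun a => endpoints_joinLeft _ a) (fun a => endpoints_joinRight _ a)

/-- The monotone map between intervals induced by a monotone map. -/
def intervalsMap (θ : Q →o R) : NonemptyInterval Q →o NonemptyInterval R where
  toFun := NonemptyInterval.map θ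
  monotone' _ _ h := ⟨θ.monotone h.1, θ.monotone h.2⟩

lemma endpoints_intervalsMap_comp (θ : Q →o R) (c : Fin (k + 1) →o NonemptyInterval Q) :
    endpoints ((intervalsMap θ).comp c) = θ.comp (endpoints c) :=
  join_hom_ext
    (fun a => (endpoints_joinLeft _ a).trans (congrArg θ (endpoints_joinLeft c a)).symm)
    (fun a => (endpoints_joinRight _ a).trans (congrArg θ (endpoints_joinRight c a)).symm)

/-- The monotone map between the joins `[k]ᵒᵖ * [k]` and `[l]ᵒᵖ * [l]` induced by a monotone
map. -/
def joinMap (θ : Fin (k + 1) →o Fin (l + 1)) : Fin (2 * k + 1 + 1) →o Fin (2 * l + 1 + 1) :=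
  endpoints ((centredIntervals l).comp θ)

lemma joinMap_joinLeft (θ : Fin (k + 1) →o Fin (l + 1)) (a : Fin (k + 1)) :
    joinMap θ (joinLeft a) = joinLeft (θ a) :=
  endpoints_joinLeft _ a

lemma joinMap_joinRight (θ : Fin (k + 1) →o Fin (l + 1)) (a : Fin (k + 1)) :
    joinMap θ (joinRight a) = joinRight (θ a) :=
  endpoints_joinRight _ a

lemma joinMap_comp {m : ℕ} (η : Fin (l + 1) →o Fin (m + 1)) (θ : Fin (k + 1) →o Fin (l + 1)) :
    joinMap (η.comp θ) = (joinMap η).comp (joinMap θ) :=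
  join_hom_ext
    (fun a => by simp only [OrderHom.comp_coe, Function.comp_apply, joinMap_joinLeft])
    (fun a => by simp only [OrderHom.comp_coe, Function.comp_apply, joinMap_joinRight])

lemma endpoints_comp (c : Fin (l + 1) →o NonemptyInterval Q) (θ : Fin (k + 1) →o Fin (l + 1)) :
    endpoints (c.comp θ) = (endpoints c).comp (joinMap θ) :=
  join_hom_ext
    (fun a => by
      simp only [OrderHom.comp_coe, Function.comp_apply, joinMap_joinLeft, endpoints_joinLeft])
    (fun a => by
      simp only [OrderHom.comp_coe, Function.comp_apply, joinMap_joinRight, endpoints_joinRight])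

/-- The functor `[k] ↦ [k]ᵒᵖ * [k]`. -/
def doubling : SimplexCategory ⥤ SimplexCategory where
  obj k := ⦋2 * k.len + 1⦌
  map {k l} θ := ordHom (m := ⦋2 * k.len + 1⦌) (n := ⦋2 * l.len + 1⦌) (joinMap θ.toOrderHom)
  map_id k := SimplexCategory.Hom.ext _ _ (endpoints_centredIntervals k.len)
  map_comp θ η := SimplexCategory.Hom.ext _ _ (joinMap_comp η.toOrderHom θ.toOrderHom)

/-- The inclusion of `[k]` into the join of `[k]ᵒᵖ` with it, in the simplex category. -/
def joinRightHom (k : SimplexCategory) : k ⟶ doubling.obj k :=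
  ordHom (n := ⦋2 * k.len + 1⦌) ⟨joinRight, fun _ _ h => ((centredIntervals _).monotone h).2⟩

lemma joinRightHom_naturality {k l : SimplexCategory} (θ : k ⟶ l) :
    joinRightHom k ≫ doubling.map θ = θ ≫ joinRightHom l :=
  SimplexCategory.Hom.ext _ _ (OrderHom.ext _ _ (funext (joinMap_joinRight θ.toOrderHom)))

/-- The chain of endpoints, in the simplex category. -/
def endpointsHom {k n : SimplexCategory}
    (c : Fin (k.len + 1) →o NonemptyInterval (Fin (n.len + 1))) :
    doubling.obj k ⟶ n :=
  ordHom (m := ⦋2 * k.len + 1⦌) (endpoints c)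

/-- The edgewise subdivision of a simplicial set. -/
def subdivision (Y : SSet.{u}) : SSet.{u} := doubling.op ⋙ Y

/-- The map from the edgewise subdivision that restricts a simplex indexed by `[k]ᵒᵖ * [k]`
to `[k]`. -/
def lastVertex (Y : SSet.{u}) : subdivision Y ⟶ Y where
  app k := Y.map (joinRightHom k.unop).op
  naturality k l θ := by
    refine (Y.map_comp _ _).symm.trans (Eq.trans ?_ (Y.map_comp _ _))
    exact congrArg (fun a => Y.map (Quiver.Hom.op a)) (joinRightHom_naturality θ.unop)

/-- The edgewise subdivision of a map. -/
def subdivisionMap {X Y : SSet.{u}} (f : X ⟶ Y) : subdivision X ⟶ subdivision Y :=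
  Functor.whiskerLeft doubling.op f

end Subdivision

/-! ## Edgewise subdivision of the standard simplices -/

section EndpointMean

open Finset

variable {α β : Type} [Fintype α] [Fintype β]

/-- The straight path between two distributions. -/
def segment (s t : stdSimplex ℝ α) (r : unitInterval) : stdSimplex ℝ α :=
  ⟨(1 - r : ℝ) • s.1 + (r : ℝ) • t.1,
    (convex_stdSimplex ℝ α) s.2 t.2 (unitInterval.one_minus_nonneg r) r.2.1 (sub_add_cancel _ _)⟩

lemma segment_apply (s t : stdSimplex ℝ α) (r : unitInterval) (i : α) :
    segment s t r i = (1 - r) * s i + r * t i := rfl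

lemma continuous_segment :
    Continuous fun p : (stdSimplex ℝ α × stdSimplex ℝ α) × unitInterval =>
      segment p.1.1 p.1.2 p.2 :=
  Continuous.subtype_mk (by fun_prop) _

lemma map_segment (f : α → β) (s t : stdSimplex ℝ α) (r : unitInterval) :
    stdSimplex.map f (segment s t r) = segment (stdSimplex.map f s) (stdSimplex.map f t) r := by
  classical
  ext b
  simp only [segment_apply, stdSimplex_map_apply, mul_sum, ← sum_add_distrib]

lemma segment_one (s t : stdSimplex ℝ α) : segment s t 1 = t := by
  ext i
  simp [segment_apply]

/-- The midpoint of the unit interval. -/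
abbrev half : unitInterval := ⟨1 / 2, by norm_num, by norm_num⟩

lemma two_mul_segment_half (s t : stdSimplex ℝ α) (i : α) : 2 * segment s t half i = s i + t i := by
  rw [segment_apply]
  ring

instance [LE α] : Fintype (NonemptyInterval α) :=
  @Fintype.ofFinite _ (Finite.of_injective _ NonemptyInterval.toProd_injective)

/-- The midpoint of the distributions of the two endpoints of a random interval. -/
def endpointMean [LE α] (f : stdSimplex ℝ (NonemptyInterval α)) : stdSimplex ℝ α :=
  segment (stdSimplex.map (fun p => p.fst) f) (stdSimplex.map (fun p => p.snd) f) half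

lemma continuous_endpointMean [LE α] :
    Continuous (endpointMean : stdSimplex ℝ (NonemptyInterval α) → _) :=
  continuous_segment.comp (((stdSimplex.continuous_map _).prodMk
    (stdSimplex.continuous_map _)).prodMk continuous_const)

lemma two_mul_endpointMean [LE α] (f : stdSimplex ℝ (NonemptyInterval α)) (i : α) :
    2 * endpointMean f i = stdSimplex.map (fun p => p.fst) f i +
      stdSimplex.map (fun p => p.snd) f i :=
  two_mul_segment_half _ _ _

lemma endpointMean_map [PartialOrder α] {k : ℕ} (c : Fin (k + 1) →o NonemptyInterval α)
    (t : stdSimplex ℝ (Fin (k + 1))) :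
    endpointMean (stdSimplex.map c t) = stdSimplex.map (endpoints c)
      (segment (stdSimplex.map joinLeft t) (stdSimplex.map joinRight t) half) := by
  have hleft : (fun p : NonemptyInterval α => p.fst) ∘ c = endpoints c ∘ joinLeft :=
    funext fun a => (endpoints_joinLeft c a).symm
  have hright : (fun p : NonemptyInterval α => p.snd) ∘ c = endpoints c ∘ joinRight :=
    funext fun a => (endpoints_joinRight c a).symm
  rw [endpointMean, map_segment, stdSimplex.map_comp_apply, stdSimplex.map_comp_apply,
    stdSimplex.map_comp_apply, stdSimplex.map_comp_apply, hleft, hright]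

lemma map_joinMap_segment {k l : ℕ} (θ : Fin (k + 1) →o Fin (l + 1))
    (t : stdSimplex ℝ (Fin (k + 1))) (r : unitInterval) :
    stdSimplex.map (joinMap θ)
        (segment (stdSimplex.map joinLeft t) (stdSimplex.map joinRight t) r) =
      segment (stdSimplex.map joinLeft (stdSimplex.map θ t))
        (stdSimplex.map joinRight (stdSimplex.map θ t)) r := by
  have hleft : joinMap θ ∘ joinLeft = joinLeft ∘ θ := funext (joinMap_joinLeft θ)
  have hright : joinMap θ ∘ joinRight = joinRight ∘ θ := funext (joinMap_joinRight θ)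
  rw [map_segment, stdSimplex.map_comp_apply, stdSimplex.map_comp_apply,
    stdSimplex.map_comp_apply, stdSimplex.map_comp_apply, hleft, hright]

variable [LinearOrder α] {f g : stdSimplex ℝ (NonemptyInterval α)}

lemma cumLE_endpointMean (f : stdSimplex ℝ (NonemptyInterval α)) (i : α) :
    2 * cumLE (endpointMean f) i = cumLE (stdSimplex.map (fun p => p.fst) f) i +
      cumLE (stdSimplex.map (fun p => p.snd) f) i := by
  simp only [cumLE, mul_sum, two_mul_endpointMean, sum_add_distrib]

/-- A chain of intervals cannot contain an interval to the right of `i` and another one that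
ends before `i`, so one of the two summands of `2 * cumLE (endpointMean f) i` is trivial. -/
lemma ChainSupported.cumLE_map_fst (hf : ChainSupported f) (i : α) :
    cumLE (stdSimplex.map (fun p => p.fst) f) i = min 1 (2 * cumLE (endpointMean f) i) := by
  have hle := cumLE_le_one (stdSimplex.map (fun p => p.fst) f) i
  have hnonneg := cumLE_nonneg (stdSimplex.map (fun p => p.snd) f) i
  rw [cumLE_endpointMean]
  by_cases h : ∃ x ∈ Function.support f, i < x.fst
  · obtain ⟨x, hx, hix⟩ := h
    have hsnd : cumLE (stdSimplex.map (fun p => p.snd) f) i = 0 := by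
      rw [cumLE, sum_filter_stdSimplex_map]
      refine sum_eq_zero fun y hy => by_contra fun hy0 => ?_
      have hyi : y.snd ≤ i := (mem_filter.1 hy).2
      rcases hf.total hx hy0 with hxy | hyx
      · exact (hix.trans_le (x.fst_le_snd.trans (hxy.2.trans hyi))).false
      · exact (hix.trans_le (hyx.1.trans (y.fst_le_snd.trans hyi))).false
    rw [hsnd, add_zero, min_eq_right hle]
  · push Not at h
    have hfst : cumLE (stdSimplex.map (fun p => p.fst) f) i = 1 := by
      rw [cumLE, sum_filter_stdSimplex_map, ← stdSimplex.sum_eq_one f]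
      refine sum_subset (filter_subset _ _) fun x _ hx => by_contra fun hx0 => ?_
      exact hx (mem_filter.2 ⟨mem_univ _, h x hx0⟩)
    rw [hfst, min_eq_left (by linarith)]

lemma ChainSupported.eq_of_endpointMean_eq (hf : ChainSupported f) (hg : ChainSupported g)
    (h : endpointMean f = endpointMean g) : f = g := by
  have hfst : stdSimplex.map (fun p => p.fst) f = stdSimplex.map (fun p => p.fst) g :=
    stdSimplex.ext (eq_of_sum_le_eq fun i =>
      (hf.cumLE_map_fst i).trans (h ▸ (hg.cumLE_map_fst i).symm))
  have hsnd : stdSimplex.map (fun p => p.snd) f = stdSimplex.map (fun p => p.snd) g := by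
    ext i
    have hmean := two_mul_endpointMean f i
    rw [h, two_mul_endpointMean, hfst] at hmean
    exact (add_left_cancel hmean).symm
  refine stdSimplex_map_injective NonemptyInterval.toDualProd_injective
    ((hf.map NonemptyInterval.toDualProd_mono).eq_of_marginals
      (hg.map NonemptyInterval.toDualProd_mono) ?_ ?_)
  · rw [stdSimplex.map_comp_apply, stdSimplex.map_comp_apply]
    exact hfst
  · rw [stdSimplex.map_comp_apply, stdSimplex.map_comp_apply]
    exact hsnd

/-- The weight of `i` in the lower half of `t`, rescaled to total mass one. -/
def lowerHalfWeight (t : stdSimplex ℝ α) (i : α) : ℝ :=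
  min 1 (2 * cumLE t i) - min 1 (2 * cumLT t i)

lemma lowerHalfWeight_nonneg (t : stdSimplex ℝ α) (i : α) : 0 ≤ lowerHalfWeight t i :=
  sub_nonneg.2 (min_le_min le_rfl (by linarith [cumLT_le_cumLE t i]))

lemma lowerHalfWeight_le (t : stdSimplex ℝ α) (i : α) : lowerHalfWeight t i ≤ 2 * t i := by
  have hcum := cumLE_eq t i
  have hnonneg := stdSimplex.zero_le t i
  unfold lowerHalfWeight
  grind

lemma sum_lowerHalfWeight (t : stdSimplex ℝ α) : ∑ i, lowerHalfWeight t i = 1 := by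
  refine (sum_cumLE_sub_cumLT t fun x => min 1 (2 * x)).trans ?_
  norm_num

/-- The lower half of a distribution, as a distribution on the opposite order. -/
def lowerHalf (t : stdSimplex ℝ α) : stdSimplex ℝ αᵒᵈ :=
  ⟨fun i => lowerHalfWeight t (OrderDual.ofDual i), fun _ => lowerHalfWeight_nonneg t _,
    sum_lowerHalfWeight t⟩

/-- The upper half of a distribution. -/
def upperHalf (t : stdSimplex ℝ α) : stdSimplex ℝ α :=
  ⟨fun i => 2 * t i - lowerHalfWeight t i, fun i => sub_nonneg.2 (lowerHalfWeight_le t i), by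
    rw [sum_sub_distrib, ← mul_sum, stdSimplex.sum_eq_one, sum_lowerHalfWeight]
    norm_num⟩

lemma le_of_lowerHalf_ne_zero_of_upperHalf_ne_zero {t : stdSimplex ℝ α} {i j : α}
    (hi : lowerHalf t (OrderDual.toDual i) ≠ 0) (hj : upperHalf t j ≠ 0) : i ≤ j := by
  by_contra! hji
  have hcum := cumLE_le_cumLT t hji
  have hcumi := cumLT_le_cumLE t i
  have hcumj := cumLE_eq t j
  have hnonneg := stdSimplex.zero_le t j
  have hlower : lowerHalfWeight t i ≠ 0 := hi
  have hupper : 2 * t j - lowerHalfWeight t j ≠ 0 := hj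
  unfold lowerHalfWeight at hlower hupper
  grind

lemma exists_chainSupported_endpointMean_eq (t : stdSimplex ℝ α) :
    ∃ f : stdSimplex ℝ (NonemptyInterval α), ChainSupported f ∧ endpointMean f = t := by
  have hsupp : Function.support (monotoneCoupling (lowerHalf t) (upperHalf t)) ⊆
      Set.range (NonemptyInterval.toDualProd (α := α)) := by
    intro p hp
    have hlower : p.1 ∈ Function.support (lowerHalf t) := by
      rw [← map_fst_monotoneCoupling (lowerHalf t) (upperHalf t), support_stdSimplex_map]
      exact Set.mem_image_of_mem _ hp
    have hupper : p.2 ∈ Function.support (upperHalf t) := by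
      rw [← map_snd_monotoneCoupling (lowerHalf t) (upperHalf t), support_stdSimplex_map]
      exact Set.mem_image_of_mem _ hp
    exact ⟨⟨(OrderDual.ofDual p.1, p.2),
      le_of_lowerHalf_ne_zero_of_upperHalf_ne_zero hlower hupper⟩, rfl⟩
  obtain ⟨f, hf⟩ := exists_stdSimplex_map_eq NonemptyInterval.toDualProd_injective hsupp
  refine ⟨f, .of_map NonemptyInterval.toDualProdHom
    (hf ▸ chainSupported_monotoneCoupling _ _ : ChainSupported (stdSimplex.map _ f)), ?_⟩
  have hfst : stdSimplex.map (fun p : NonemptyInterval α => OrderDual.toDual p.fst) f =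
      lowerHalf t := by
    rw [← map_fst_monotoneCoupling (lowerHalf t) (upperHalf t), ← hf, stdSimplex.map_comp_apply]
    rfl
  have hsnd : stdSimplex.map (fun p => p.snd) f = upperHalf t := by
    rw [← map_snd_monotoneCoupling (lowerHalf t) (upperHalf t), ← hf, stdSimplex.map_comp_apply]
    rfl
  ext i
  have hmean := two_mul_endpointMean f i
  have hlower : stdSimplex.map (fun p => p.fst) f i = lowerHalfWeight t i :=
    congrArg (fun a : stdSimplex ℝ αᵒᵈ => a (OrderDual.toDual i)) hfst
  have hupper : upperHalf t i = 2 * t i - lowerHalfWeight t i := rfl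
  rw [hlower, hsnd, hupper] at hmean
  linarith

lemma bijOn_endpointMean : Set.BijOn (endpointMean : stdSimplex ℝ (NonemptyInterval α) → _)
    {f | ChainSupported f} Set.univ :=
  ⟨Set.mapsTo_univ _ _, fun _ hf _ hg h => ChainSupported.eq_of_endpointMean_eq hf hg h,
    fun t _ => exists_chainSupported_endpointMean_eq t⟩

lemma exists_endpointMean_map_eq (t : stdSimplex ℝ α) :
    ∃ (k : SimplexCategory) (c : Fin (k.len + 1) →o NonemptyInterval α) (s : TSimplex k),
      endpointMean (stdSimplex.map c s) = t := by
  obtain ⟨f, hf, rfl⟩ := exists_chainSupported_endpointMean_eq t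
  obtain ⟨k, c, s, rfl⟩ := hf.exists_map_eq
  exact ⟨⦋k⦌, c, s, rfl⟩

end EndpointMean

/-! ## Edgewise subdivision and realization -/

section Realization

lemma sset_map_map (Y : SSet.{u}) {l m n : SimplexCategory} (η : l ⟶ m) (θ : m ⟶ n)
    (y : Y.obj (op n)) : Y.map η.op (Y.map θ.op y) = Y.map (η ≫ θ).op y :=
  congrArg (fun a => a y) (Y.map_comp θ.op η.op).symm

lemma homotopic_eval {Z T : Type*} [TopologicalSpace Z] [TopologicalSpace T]
    (F : C(Z, C(unitInterval, T))) (r r' : unitInterval) :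
    (⟨fun z => F z r, by fun_prop⟩ : C(Z, T)).Homotopic ⟨fun z => F z r', by fun_prop⟩ := by
  have : PathConnectedSpace unitInterval := isPathConnected_iff_pathConnectedSpace.1
    ((convex_Icc (0 : ℝ) 1).isPathConnected ⟨0, unitInterval.zero_mem⟩)
  let γ := PathConnectedSpace.somePath r r'
  exact ⟨{  toFun := fun p => F p.2 (γ p.1)
            continuous_toFun := by fun_prop
            map_zero_left := fun z => congrArg (F z) γ.source
            map_one_left := fun z => congrArg (F z) γ.target }⟩

variable (Y : SSet.{u})

/-- The segment between the images of a point of `|Δᵏ|` in the two factors of the join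
`[k]ᵒᵖ * [k]`, mapped to `|Y|` by a `k`-simplex of the edgewise subdivision of `Y`. -/
def simplexEndpointPath {k : SimplexCategory} (y : (subdivision Y).obj (op k)) :
    C(TSimplex k × unitInterval, SSet.toTop.obj Y) :=
  (charMap (X := Y) (n := doubling.obj k) y).comp
    ⟨fun p => segment (stdSimplex.map joinLeft p.1) (stdSimplex.map joinRight p.1) p.2,
      continuous_segment.comp ((((stdSimplex.continuous_map _).comp continuous_fst).prodMk
        ((stdSimplex.continuous_map _).comp continuous_fst)).prodMk continuous_snd)⟩

lemma simplexEndpointPath_map {k l : SimplexCategory} (θ : k ⟶ l)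
    (y : (subdivision Y).obj (op l)) (t : TSimplex k) (r : unitInterval) :
    simplexEndpointPath Y ((subdivision Y).map θ.op y) (t, r) =
      simplexEndpointPath Y y (stdSimplex.map θ t, r) :=
  (charMap_map (X := Y) (doubling.map θ) y _).trans
    (congrArg (charMap (X := Y) y) (map_joinMap_segment θ.toOrderHom t r))

/-- The straight path in `|Y|` from the first to the last vertex map on the realization of the
edgewise subdivision. -/
def endpointPath : C(SSet.toTop.obj (subdivision Y), C(unitInterval, SSet.toTop.obj Y)) :=
  realizationDesc (fun _ y => (simplexEndpointPath Y y).curry)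
    (fun θ y t => ContinuousMap.ext fun r => simplexEndpointPath_map Y θ y t r)

lemma endpointPath_charMap {k : SimplexCategory} (y : (subdivision Y).obj (op k))
    (t : TSimplex k) (r : unitInterval) :
    endpointPath Y (charMap y t) r = simplexEndpointPath Y y (t, r) :=
  congrArg (fun a : C(unitInterval, SSet.toTop.obj Y) => a r)
    (realizationDesc_charMap _
      (fun θ y t => ContinuousMap.ext fun r => simplexEndpointPath_map Y θ y t r) y t)

/-- The midpoint of the path from the first to the last vertex map. -/
def midpointMap : C(SSet.toTop.obj (subdivision Y), SSet.toTop.obj Y) :=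
  ⟨fun z => endpointPath Y z half, by fun_prop⟩

lemma midpointMap_charMap {k : SimplexCategory} (y : (subdivision Y).obj (op k)) (t : TSimplex k) :
    midpointMap Y (charMap y t) = charMap (X := Y) (n := doubling.obj k) y
      (segment (stdSimplex.map joinLeft t) (stdSimplex.map joinRight t) half) :=
  endpointPath_charMap Y y t half

lemma endpointPath_one (z : SSet.toTop.obj (subdivision Y)) :
    endpointPath Y z 1 = SSet.toTop.map (lastVertex Y) z := by
  obtain ⟨k, y, t, rfl⟩ := charMap_jointly_surjective z
  rw [endpointPath_charMap, toTop_map_charMap]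
  exact (congrArg (charMap (X := Y) (n := doubling.obj k) y) (segment_one _ _)).trans
    (charMap_map (X := Y) (joinRightHom k) y t).symm

lemma midpointMap_homotopic_lastVertex :
    (midpointMap Y).Homotopic (SSet.toTop.map (lastVertex Y)).hom := by
  have hone : (⟨fun z => endpointPath Y z 1, by fun_prop⟩ : C(_, SSet.toTop.obj Y)) =
      (SSet.toTop.map (lastVertex Y)).hom := ContinuousMap.ext (endpointPath_one Y)
  rw [← hone]
  exact homotopic_eval (endpointPath Y) half 1

/-- The triangulation of the simplex by the chains of intervals of its vertices. -/
def subdividedSimplexHomeo (n : SimplexCategory) :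
    SSet.toTop.obj (chains.{u} (NonemptyInterval (Fin (n.len + 1)))) ≃ₜ TSimplex n :=
  chainsHomeo bijOn_endpointMean continuous_endpointMean

variable {Y}

/-- A simplex of `Y`, as a map from the edgewise subdivision of the standard simplex, whose
simplices are the chains of intervals. -/
def subdividedSimplexMap {n : SimplexCategory} (y : Y.obj (op n)) :
    chains.{u} (NonemptyInterval (Fin (n.len + 1))) ⟶ subdivision Y where
  app k := TypeCat.ofHom fun c => Y.map (endpointsHom (k := k.unop) c.down).op y
  naturality k l θ := by
    ext ⟨c⟩
    have hcomp : endpointsHom (c.comp θ.unop.toOrderHom) =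
        doubling.map θ.unop ≫ endpointsHom (k := k.unop) (n := n) c :=
      SimplexCategory.Hom.ext _ _ (endpoints_comp c θ.unop.toOrderHom)
    exact (congrArg (fun a => Y.map (Quiver.Hom.op a) y) hcomp).trans
      (sset_map_map Y (doubling.map θ.unop) _ y).symm

/-- The map from a topological simplex to the realization of the edgewise subdivision of `Y`
that is given by a simplex of `Y`. -/
def subdivideSimplex {n : SimplexCategory} (y : Y.obj (op n)) :
    C(TSimplex n, SSet.toTop.obj (subdivision Y)) :=
  (SSet.toTop.map (subdividedSimplexMap y)).hom.comp ((subdividedSimplexHomeo n).symm : C(_, _))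

lemma subdivideSimplex_endpointMean {k n : SimplexCategory} (y : Y.obj (op n))
    (c : Fin (k.len + 1) →o NonemptyInterval (Fin (n.len + 1))) (t : TSimplex k) :
    subdivideSimplex y (endpointMean (stdSimplex.map c t)) =
      charMap (X := subdivision Y) (n := k) (Y.map (endpointsHom c).op y) t :=
  (congrArg (SSet.toTop.map (subdividedSimplexMap y))
    (chainsHomeo_symm_apply bijOn_endpointMean continuous_endpointMean c t)).trans
      (toTop_map_charMap (subdividedSimplexMap y) (chain c) t)

lemma map_endpointMean_map {k m n : SimplexCategory} (θ : m ⟶ n)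
    (c : Fin (k.len + 1) →o NonemptyInterval (Fin (m.len + 1))) (t : TSimplex k) :
    stdSimplex.map θ (endpointMean (stdSimplex.map c t)) =
      endpointMean (stdSimplex.map ((intervalsMap θ.toOrderHom).comp c) t) := by
  rw [endpointMean_map, endpointMean_map, endpoints_intervalsMap_comp, stdSimplex.map_comp_apply]
  rfl

lemma subdivideSimplex_map {m n : SimplexCategory} (θ : m ⟶ n) (y : Y.obj (op n))
    (t : TSimplex m) :
    subdivideSimplex (Y.map θ.op y) t = subdivideSimplex y (stdSimplex.map θ t) := by
  obtain ⟨k, c, s, rfl⟩ := exists_endpointMean_map_eq t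
  have hendpoints : endpointsHom c ≫ θ = endpointsHom ((intervalsMap θ.toOrderHom).comp c) :=
    SimplexCategory.Hom.ext _ _ (endpoints_intervalsMap_comp θ.toOrderHom c).symm
  rw [map_endpointMean_map, subdivideSimplex_endpointMean, subdivideSimplex_endpointMean,
    sset_map_map, hendpoints]

variable (Y)

/-- The map from `|Y|` to the realization of its edgewise subdivision that subdivides every
simplex. -/
def subdivideMap : C(SSet.toTop.obj Y, SSet.toTop.obj (subdivision Y)) :=
  realizationDesc (fun _ y => subdivideSimplex y) (fun θ y t => subdivideSimplex_map θ y t)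

lemma subdivideMap_charMap {n : SimplexCategory} (y : Y.obj (op n)) (t : TSimplex n) :
    subdivideMap Y (charMap y t) = subdivideSimplex y t :=
  realizationDesc_charMap _ (fun θ y t => subdivideSimplex_map θ y t) y t

lemma midpointMap_subdivideMap (z : SSet.toTop.obj Y) : midpointMap Y (subdivideMap Y z) = z := by
  obtain ⟨n, y, t, rfl⟩ := charMap_jointly_surjective z
  obtain ⟨k, c, s, rfl⟩ := exists_endpointMean_map_eq t
  rw [subdivideMap_charMap, subdivideSimplex_endpointMean]
  refine (midpointMap_charMap Y (k := k) _ s).trans ?_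
  rw [endpointMean_map]
  exact charMap_map (X := Y) (endpointsHom c) y _

lemma segment_half_eq_endpointMean {k : ℕ} (t : stdSimplex ℝ (Fin (k + 1))) :
    segment (stdSimplex.map joinLeft t) (stdSimplex.map joinRight t) half =
      endpointMean (stdSimplex.map (centredIntervals k) t) := by
  rw [endpointMean_map, endpoints_centredIntervals]
  exact (stdSimplex.map_id_apply _).symm

lemma subdivideMap_midpointMap (z : SSet.toTop.obj (subdivision Y)) :
    subdivideMap Y (midpointMap Y z) = z := by
  obtain ⟨k, y, t, rfl⟩ := charMap_jointly_surjective z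
  have hendpoints : endpointsHom (n := doubling.obj k) (centredIntervals k.len) = 𝟙 _ :=
    SimplexCategory.Hom.ext _ _ (endpoints_centredIntervals k.len)
  have hid : Y.map (endpointsHom (n := doubling.obj k) (centredIntervals k.len)).op y = y :=
    (congrArg (fun a => Y.map (Quiver.Hom.op a) y) hendpoints).trans
      (congrArg (fun a => a y) (Y.map_id _))
  rw [midpointMap_charMap]
  exact (subdivideMap_charMap Y (n := doubling.obj k) y _).trans <|
    (congrArg (subdivideSimplex (n := doubling.obj k) y) (segment_half_eq_endpointMean t)).trans <|
    (subdivideSimplex_endpointMean (n := doubling.obj k) y (centredIntervals k.len) t).trans <|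
    congrArg (fun x => charMap (X := subdivision Y) (n := k) x t) hid

lemma isHomotopyEquiv_lastVertex : IsHomotopyEquiv (SSet.toTop.map (lastVertex Y)).hom :=
  (IsHomotopyEquiv.of_homeomorph
    { toFun := midpointMap Y
      invFun := subdivideMap Y
      left_inv := subdivideMap_midpointMap Y
      right_inv := midpointMap_subdivideMap Y
      continuous_toFun := (midpointMap Y).continuous
      continuous_invFun := (subdivideMap Y).continuous }).of_homotopic
    (midpointMap_homotopic_lastVertex Y)

end Realization

/-! ## Complement models -/

namespace SWData

variable {C : Type u} [Category.{v} C] (W : SWData C)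

/-- The cofibrations between two objects, that is the horizontal maps of the squares category. -/
abbrev Cof (X Y : C) := { f : X ⟶ Y // W.cof f }

/-- An extension of a map to a subtraction sequence. -/
structure Complement {X Y : C} (f : X ⟶ Y) where
  obj : C
  incl : obj ⟶ Y
  sub : W.sub f incl

variable {W}

/-- A map between the targets of two maps is said to restrict to given complements of these maps if
it is covered by a map of the complements. -/
def Complement.Restricts {X Y X' Y' : C} {f : X ⟶ Y} {f' : X' ⟶ Y'} (K : W.Complement f)
    (K' : W.Complement f') (g : Y ⟶ Y') : Prop :=
  ∃ c : K.obj ⟶ K'.obj, c ≫ K'.incl = K.incl ≫ g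

end SWData

/-- Distinguished squares and chosen complements on a category with the data of an SW-category,
with those properties on which the comparison of `S~` and `T` rests. They hold both for an
SW-category and for its sum diagrams. The restrictions `lift` to complements are part of the data,
although they are unique, so that those of sum diagrams are computed pointwise by definition. -/
structure ComplementModel (B : BundledSW.{v, u}) where
  dist : ∀ {X Y X' Y' : B.C}, (X ⟶ Y) → (X' ⟶ Y') → (X ⟶ X') → (Y ⟶ Y') → Prop
  dist_vcomp : ∀ {X Y X' Y' X'' Y'' : B.C} {f : X ⟶ Y} {f' : X' ⟶ Y'} {f'' : X'' ⟶ Y''}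
    {g : X ⟶ X'} {g' : Y ⟶ Y'} {h : X' ⟶ X''} {h' : Y' ⟶ Y''},
    dist f f' g g' → dist f' f'' h h' → dist f f'' (g ≫ h) (g' ≫ h')
  dist_hcomp : ∀ {X Y Z X' Y' Z' : B.C} {f : X ⟶ Y} {k : Y ⟶ Z} {f' : X' ⟶ Y'} {k' : Y' ⟶ Z'}
    {g : X ⟶ X'} {g' : Y ⟶ Y'} {g'' : Z ⟶ Z'},
    dist f f' g g' → dist k k' g' g'' → dist (f ≫ k) (f' ≫ k') g g''
  dist_comm : ∀ {X Y X' Y' : B.C} {f : X ⟶ Y} {f' : X' ⟶ Y'} {g : X ⟶ X'} {g' : Y ⟶ Y'},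
    dist f f' g g' → f ≫ g' = g ≫ f'
  dist_vid : ∀ {X Y : B.C} {f : X ⟶ Y}, B.W.cof f → dist f f (𝟙 X) (𝟙 Y)
  dist_hid : ∀ {X Y : B.C} (g : X ⟶ Y), dist (𝟙 X) (𝟙 Y) g g
  initial : Nonempty (IsInitial B.W.O)
  cof_initial : ∀ {X : B.C} (f : B.W.O ⟶ X), B.W.cof f
  sub_cof : ∀ {X Y U : B.C} {i : X ⟶ Y} {j : U ⟶ Y}, B.W.sub i j → B.W.cof i
  mono_of_sub : ∀ {X Y U : B.C} {i : X ⟶ Y} {j : U ⟶ Y}, B.W.sub i j → Mono j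
  complement : ∀ {X Y : B.C} (f : B.W.Cof X Y), B.W.Complement f.1
  lift : ∀ {X Y X' Y' : B.C} {f : B.W.Cof X Y} {f' : B.W.Cof X' Y'} {g : Y ⟶ Y'},
    (complement f).Restricts (complement f') g → ((complement f).obj ⟶ (complement f').obj)
  lift_incl : ∀ {X Y X' Y' : B.C} {f : B.W.Cof X Y} {f' : B.W.Cof X' Y'} {g : Y ⟶ Y'}
    (h : (complement f).Restricts (complement f') g),
    lift h ≫ (complement f').incl = (complement f).incl ≫ g
  complement_id_O : (complement ⟨𝟙 B.W.O, B.W.cof_mul.id_mem _⟩).obj = B.W.O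
  iso_O_of_sub_id : ∀ {X U : B.C} {j : U ⟶ X}, B.W.sub (𝟙 X) j → Nonempty (U ≅ B.W.O)
  exists_weq : ∀ {X Y U X' Y' U' : B.C} {i : X ⟶ Y} {j : U ⟶ Y} {i' : X' ⟶ Y'} {j' : U' ⟶ Y'}
    {g : X ⟶ X'} {g' : Y ⟶ Y'}, dist i i' g g' → B.W.sub i j → B.W.sub i' j' →
    ∃ c : U ⟶ U', c ≫ j' = j ≫ g' ∧ B.W.weq c
  dist_of_sub : ∀ {X Y U X' Y' U' : B.C} {i : X ⟶ Y} {j : U ⟶ Y} {i' : X' ⟶ Y'} {j' : U' ⟶ Y'}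
    {g : X ⟶ X'} {g' : Y ⟶ Y'} {c : U ⟶ U'}, B.W.sub i j → B.W.sub i' j' →
    i ≫ g' = g ≫ i' → c ≫ j' = j ≫ g' → B.W.weq c → dist i i' g g'
  exists_sub_comp : ∀ {X Y Z U V K : B.C} {f : X ⟶ Y} {g : Y ⟶ Z} {j : U ⟶ Y} {l : V ⟶ Z}
    {k : K ⟶ Z}, B.W.sub f j → B.W.sub g l → B.W.sub (f ≫ g) k →
    ∃ (a : U ⟶ K) (b : V ⟶ K), a ≫ k = j ≫ g ∧ b ≫ k = l ∧ B.W.sub a b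

namespace ComplementModel

variable {B : BundledSW.{v, u}} (M : ComplementModel B)

section Lifts

variable {M} {X Y X' Y' X'' Y'' : B.C} {f : B.W.Cof X Y} {f' : B.W.Cof X' Y'}
  {f'' : B.W.Cof X'' Y''}

lemma hom_ext {Z : B.C} {a b : Z ⟶ (M.complement f).obj}
    (h : a ≫ (M.complement f).incl = b ≫ (M.complement f).incl) : a = b := by
  have := M.mono_of_sub (M.complement f).sub
  exact (cancel_mono _).1 h

lemma lift_eq {g : Y ⟶ Y'} (h : (M.complement f).Restricts (M.complement f') g)
    {c : (M.complement f).obj ⟶ (M.complement f').obj}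
    (hc : c ≫ (M.complement f').incl = (M.complement f).incl ≫ g) : M.lift h = c :=
  hom_ext ((M.lift_incl h).trans hc.symm)

lemma lift_id (h : (M.complement f).Restricts (M.complement f) (𝟙 Y)) : M.lift h = 𝟙 _ :=
  lift_eq h (by rw [Category.id_comp, Category.comp_id])

lemma lift_comp_lift_incl {g : Y ⟶ Y'} {g' : Y' ⟶ Y''}
    (h : (M.complement f).Restricts (M.complement f') g)
    (h' : (M.complement f').Restricts (M.complement f'') g') :
    (M.lift h ≫ M.lift h') ≫ (M.complement f'').incl = (M.complement f).incl ≫ g ≫ g' := by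
  rw [Category.assoc, lift_incl, ← Category.assoc, lift_incl, Category.assoc]

lemma lift_comp {g : Y ⟶ Y'} {g' : Y' ⟶ Y''}
    (h : (M.complement f).Restricts (M.complement f') g)
    (h' : (M.complement f').Restricts (M.complement f'') g')
    (hc : (M.complement f).Restricts (M.complement f'') (g ≫ g')) :
    M.lift hc = M.lift h ≫ M.lift h' :=
  lift_eq hc (lift_comp_lift_incl h h')

lemma lift_square {X₁ Y₁ X₂ Y₂ : B.C} {f₁ : B.W.Cof X₁ Y₁} {f₂ : B.W.Cof X₂ Y₂} {g₁ : Y ⟶ Y₁}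
    {g₁' : Y₁ ⟶ Y'} {g₂ : Y ⟶ Y₂} {g₂' : Y₂ ⟶ Y'} (e : g₁ ≫ g₁' = g₂ ≫ g₂')
    (h₁ : (M.complement f).Restricts (M.complement f₁) g₁)
    (h₁' : (M.complement f₁).Restricts (M.complement f') g₁')
    (h₂ : (M.complement f).Restricts (M.complement f₂) g₂)
    (h₂' : (M.complement f₂).Restricts (M.complement f') g₂') :
    M.lift h₁ ≫ M.lift h₁' = M.lift h₂ ≫ M.lift h₂' :=
  hom_ext (by rw [lift_comp_lift_incl, lift_comp_lift_incl, e])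

end Lifts

/-- The squares category of a complement model. -/
def squares : SquaresCategory.{v, u} where
  Ob := B.C
  E := B.cat
  M := B.W.cofCategory
  dist f f' g g' := M.dist f.1 f'.1 g g'
  dist_vcomp h₁ h₂ := M.dist_vcomp h₁ h₂
  dist_hcomp h₁ h₂ := M.dist_hcomp h₁ h₂
  dist_vid f := M.dist_vid f.2
  dist_hid g := M.dist_hid g
  O := B.W.O
  initial_M X := by
    obtain ⟨I⟩ := M.initial
    exact ⟨{ default := ⟨I.to X, M.cof_initial _⟩
             uniq := fun f => Subtype.ext (I.hom_ext _ _) }⟩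
  initial_E X := by
    obtain ⟨I⟩ := M.initial
    exact ⟨{ default := I.to X
             uniq := fun f => I.hom_ext _ _ }⟩

open SquaresCategory

variable {n : ℕ}

/-- The objects of a chain of cofibrations. -/
abbrev vertex (A : HFun (Fin (n + 1)) M.squares) (i : Fin (n + 1)) : B.C := A.fn.obj i

/-- The maps of a chain of cofibrations. -/
def edge (A : HFun (Fin (n + 1)) M.squares) {i j : Fin (n + 1)} (h : i ≤ j) :
    B.W.Cof (M.vertex A i) (M.vertex A j) :=
  A.fn.map (homOfLE h)

/-- The components of a vertical transformation of chains of cofibrations. -/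
def component {A A' : HFun (Fin (n + 1)) M.squares} (α : A ⟶ A') (i : Fin (n + 1)) :
    M.vertex A i ⟶ M.vertex A' i :=
  VertTrans.app α i

variable {M}

section Chain

variable (A : HFun (Fin (n + 1)) M.squares)

lemma edge_refl (i : Fin (n + 1)) : (M.edge A (le_refl i)).1 = 𝟙 _ :=
  congrArg Subtype.val (A.fn.map_id i)

lemma edge_trans {i j k : Fin (n + 1)} (h : i ≤ j) (h' : j ≤ k) :
    (M.edge A (h.trans h')).1 = (M.edge A h).1 ≫ (M.edge A h').1 :=
  congrArg Subtype.val (A.fn.map_comp (homOfLE h) (homOfLE h'))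

lemma exists_sub_edge {i j k : Fin (n + 1)} (h : i ≤ j) (h' : j ≤ k) :
    ∃ (a : (M.complement (M.edge A h)).obj ⟶ (M.complement (M.edge A (h.trans h'))).obj)
      (b : (M.complement (M.edge A h')).obj ⟶ (M.complement (M.edge A (h.trans h'))).obj),
      a ≫ (M.complement _).incl = (M.complement _).incl ≫ (M.edge A h').1 ∧
        b ≫ (M.complement _).incl = (M.complement _).incl ∧ B.W.sub a b := by
  refine M.exists_sub_comp (M.complement _).sub (M.complement _).sub ?_
  rw [← edge_trans]
  exact (M.complement _).sub

lemma restricts_edge {a b : ArTilde n} (h : a ≤ b) :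
    (M.complement (M.edge A a.le)).Restricts (M.complement (M.edge A b.le)) (M.edge A h.2).1 := by
  obtain ⟨-, c, -, hc, -⟩ := exists_sub_edge A h.1 a.le
  obtain ⟨d, -, hd, -, -⟩ := exists_sub_edge A (h.1.trans a.le) h.2
  exact ⟨c ≫ d, by rw [Category.assoc, hd, ← Category.assoc, hc]⟩

/-- The diagram of complements `A_j ∖ A_i` of a chain of cofibrations. -/
def complDiagram : ArTilde n ⥤ B.C where
  obj a := (M.complement (M.edge A a.le)).obj
  map h := M.lift (restricts_edge A (leOfHom h))
  map_id a := lift_eq _ (by rw [edge_refl, Category.id_comp, Category.comp_id])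
  map_comp f g := lift_eq _ (by rw [lift_comp_lift_incl, ← edge_trans])

/-- The object of `S~_n` given by the complements of a chain of cofibrations. -/
def complObj : STilde B n where
  fn := complDiagram A
  diag i := by
    refine M.iso_O_of_sub_id (j := (M.complement (M.edge A (le_refl i))).incl) ?_
    rw [← edge_refl]
    exact (M.complement _).sub
  sub {i j k} h h' := by
    obtain ⟨a, b, ha, hb, hab⟩ := exists_sub_edge A h h'
    have hright : (complDiagram A).map (ArTilde.right h h') = a := lift_eq _ ha
    have hleft : (complDiagram A).map (ArTilde.left h h') = b :=
      lift_eq _ (by rw [hb, edge_refl, Category.comp_id])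
    rw [hright, hleft]
    exact hab

end Chain

section VerticalTransformation

variable {A A' : HFun (Fin (n + 1)) M.squares} (α : A ⟶ A')

lemma dist_component {i j : Fin (n + 1)} (h : i ≤ j) :
    M.dist (M.edge A h).1 (M.edge A' h).1 (M.component α i) (M.component α j) :=
  VertTrans.dist α (homOfLE h)

lemma edge_comp_component {i j : Fin (n + 1)} (h : i ≤ j) :
    (M.edge A h).1 ≫ M.component α j = M.component α i ≫ (M.edge A' h).1 :=
  M.dist_comm (dist_component α h)

lemma exists_weq_component {i j : Fin (n + 1)} (h : i ≤ j) :
    ∃ c : (M.complement (M.edge A h)).obj ⟶ (M.complement (M.edge A' h)).obj,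
      c ≫ (M.complement _).incl = (M.complement _).incl ≫ M.component α j ∧ B.W.weq c :=
  M.exists_weq (dist_component α h) (M.complement _).sub (M.complement _).sub

lemma restricts_component {i j : Fin (n + 1)} (h : i ≤ j) :
    (M.complement (M.edge A h)).Restricts (M.complement (M.edge A' h)) (M.component α j) := by
  obtain ⟨c, hc, -⟩ := exists_weq_component α h
  exact ⟨c, hc⟩

/-- The map of complements induced by a vertical transformation. -/
def complMap : complObj A ⟶ complObj A' where
  nat :=
    { app := fun a => M.lift (restricts_component α a.le)
      naturality := fun _ _ h => lift_square (edge_comp_component α (leOfHom h).2) _ _ _ _ }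
  weq a := by
    obtain ⟨c, hc, hw⟩ := exists_weq_component α a.le
    rwa [← lift_eq (restricts_component α a.le) hc] at hw

end VerticalTransformation

variable (M)

/-- The functor `T_n ⥤ S~_n` that takes complements. -/
def complFunctor (n : ℕ) : HFun (Fin (n + 1)) M.squares ⥤ STilde B n where
  obj A := complObj A
  map α := complMap α
  map_id _ := STilde.Hom.ext (NatTrans.ext (funext fun _ => lift_id _))
  map_comp _ _ := STilde.Hom.ext (NatTrans.ext (funext fun _ => lift_comp _ _ _))

/-- The map of simplicial categories from `T` to `S~` that takes complements. -/
def complTrans : simplicialT M.squares ⟶ simplicialS B where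
  app k := (M.complFunctor k.unop.len).toCatHom
  naturality _ _ _ := rfl

end ComplementModel

lemma stilde_ext {B : BundledSW.{v, u}} {n : ℕ} {X Y : STilde B n} (h : X.fn = Y.fn) : X = Y := by
  obtain ⟨_, _, _⟩ := X
  obtain ⟨_, _, _⟩ := Y
  obtain rfl := h
  rfl

lemma functor_eq_const_of_isInitial {J C : Type*} [Category J] [Category C] {F : J ⥤ C} {X : C}
    (hX : IsInitial X) (h : ∀ j, F.obj j = X) : F = (Functor.const J).obj X :=
  CategoryTheory.Functor.ext h fun i _ _ => (hX.ofIso (eqToIso (h i)).symm).hom_ext _ _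

namespace ComplementModel

open SquaresCategory

variable {B : BundledSW.{v, u}} (M : ComplementModel B)

lemma complObj_const :
    complObj (⟨(Functor.const _).obj M.squares.horO⟩ : HFun (Fin (0 + 1)) M.squares) =
      STilde.base B := by
  obtain ⟨I⟩ := M.initial
  exact stilde_ext (functor_eq_const_of_isInitial I fun _ => M.complement_id_O)

/-- The map of pointed simplicial sets from `T` to `S~` that takes complements. -/
def complSSet : pointedT.obj M.squares ⟶ pointedS.obj B where
  map := diagNerve.map M.complTrans
  map_pt := ComposableArrows.ext₀ M.complObj_const

end ComplementModel

/-! ## Homotopies from natural transformations -/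

section Glue

variable {k : ℕ} {D : Type u} [Category.{v} D]

/-- The functor that follows the source of a natural transformation on the first part of `[k]`
and its target on the second part. -/
def glue (N : ComposableArrows (Fin (k + 1) ⥤ D) 1) (χ : Fin (k + 1) →o Fin 2) :
    Fin (k + 1) ⥤ D :=
  Functor.prod' χ.monotone.functor (𝟭 _) ⋙ Functor.uncurry.obj N

lemma glue_const (N : ComposableArrows (Fin (k + 1) ⥤ D) 1) (i : Fin 2) :
    glue N (OrderHom.const _ i) = N.obj i := by
  refine Functor.hext (fun _ => rfl) (fun a b h => heq_of_eq ?_)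
  have hid : (N.map (𝟙 i)).app a = 𝟙 ((N.obj i).obj a) :=
    congrArg (fun α => NatTrans.app α a) (N.map_id i)
  exact (congrArg (fun f => f ≫ (N.obj i).map h) hid).trans (Category.id_comp _)

/-- Restriction along `θ` and postcomposition with `P`. -/
def whiskerBoth {l : ℕ} {D' : Type u} [Category.{v} D'] (θ : Fin (l + 1) ⥤ Fin (k + 1))
    (P : D ⥤ D') : (Fin (k + 1) ⥤ D) ⥤ (Fin (l + 1) ⥤ D') :=
  (Functor.whiskeringLeft _ _ _).obj θ ⋙ (Functor.whiskeringRight _ _ _).obj P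

lemma comp_glue_comp {l : ℕ} {D' : Type u} [Category.{v} D']
    (N : ComposableArrows (Fin (k + 1) ⥤ D) 1) (χ : Fin (k + 1) →o Fin 2)
    (θ : Fin (l + 1) →o Fin (k + 1)) (P : D ⥤ D') :
    θ.monotone.functor ⋙ glue N χ ⋙ P =
      glue (N ⋙ whiskerBoth θ.monotone.functor P) (χ.comp θ) :=
  Functor.hext (fun _ => rfl) (fun _ _ _ => heq_of_eq (P.map_comp _ _))

end Glue

open MonoidalCategory in
/-- A homotopy between maps to the diagonal of a nerve, given by natural transformations. -/
def homotopyOfNatTrans {Z : SSet.{max u v}} {𝒳 : SimplexCategoryᵒᵖ ⥤ Cat.{v, u}}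
    {f g : Z ⟶ diagNerve.obj 𝒳}
    (N : ∀ {n : SimplexCategory}, Z.obj (op n) →
      ComposableArrows (Fin (n.len + 1) ⥤ 𝒳.obj (op n)) 1)
    (hN : ∀ {m n : SimplexCategory} (θ : m ⟶ n) (z : Z.obj (op n)),
      N (Z.map θ.op z) = N z ⋙ whiskerBoth (ordFunctor θ) (𝒳.map θ.op).toFunctor)
    (hf : ∀ {n : SimplexCategory} (z : Z.obj (op n)), (N z).obj 0 = f.app (op n) z)
    (hg : ∀ {n : SimplexCategory} (z : Z.obj (op n)), (N z).obj 1 = g.app (op n) z) :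
    SSet.Homotopy f g where
  h :=
    { app := fun n => TypeCat.ofHom fun p =>
        glue (N (n := n.unop) p.1) (SSet.stdSimplex.objEquiv p.2).toOrderHom
      naturality := fun n l θ => by
        ext p
        refine Eq.trans ?_ (comp_glue_comp (N (n := n.unop) p.1) _ θ.unop.toOrderHom
          (𝒳.map θ).toFunctor).symm
        exact congrArg (fun K => glue K _) (hN θ.unop p.1) }
  h₀ := by
    ext n z
    exact (glue_const _ _).trans (hf z)
  h₁ := by
    ext n z
    exact (glue_const _ _).trans (hg z)
  rel := by
    ext n p
    exact p.1.2.elim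

section

variable {J : Type} [Preorder J] {C : Type u} [Category.{v} C] {F G : J ⥤ C} (N : F ⟶ G)

lemma map_comp_app_comp_map {p q s : J} (f : p ⟶ q) (g : q ⟶ s) (h : p ⟶ s) :
    F.map f ≫ N.app q ≫ G.map g = N.app p ≫ G.map h := by
  rw [← Category.assoc, N.naturality, Category.assoc, ← G.map_comp, Subsingleton.elim (f ≫ g) h]

lemma app_comp_map_comp_map {p q s : J} (f : p ⟶ q) (g : q ⟶ s) (h : p ⟶ s) :
    (N.app p ≫ G.map f) ≫ G.map g = N.app p ≫ G.map h := by
  rw [Category.assoc, ← G.map_comp, Subsingleton.elim (f ≫ g) h]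

end

/-! ## From the subdivision of `S~` back to `T` -/

lemma fst_le_snd_of_nested {k : ℕ} {Q : Type} [PartialOrder Q]
    (w : Fin (k + 1) →o NonemptyInterval Q) (a b : Fin (k + 1)) : (w a).fst ≤ (w b).snd :=
  (w.monotone (Fin.zero_le a)).1.trans ((w 0).fst_le_snd.trans (w.monotone (Fin.zero_le b)).2)

lemma intervalsMap_joinMap_comp_centredIntervals {k l : ℕ} (θ : Fin (k + 1) →o Fin (l + 1)) :
    (intervalsMap (joinMap θ)).comp (centredIntervals k) = (centredIntervals l).comp θ :=
  OrderHom.ext _ _ (funext fun a => NonemptyInterval.ext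
    (Prod.ext (joinMap_joinLeft θ a) (joinMap_joinRight θ a)))

namespace ComplementModel

open SquaresCategory

variable {B : BundledSW.{v, u}} {M : ComplementModel B} {k m : ℕ}

section Window

variable (X : Fin (m + 1) ⥤ STilde B m) (w : Fin (k + 1) →o NonemptyInterval (Fin (m + 1)))

/-- The pair of the left endpoint of the `a`-th and the right endpoint of the `i`-th of a sequence
of nested intervals. -/
abbrev corner (a i : Fin (k + 1)) : ArTilde m :=
  ⟨(w a).fst, (w i).snd, fst_le_snd_of_nested w a i⟩

/-- The pair of two right endpoints of a sequence of nested intervals. -/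
abbrev cornerCompl {i j : Fin (k + 1)} (h : i ≤ j) : ArTilde m :=
  ⟨(w i).snd, (w j).snd, (w.monotone h).2⟩

/-- The inclusion of the `i`-th into the `j`-th interval, if both are extended to the left
endpoint of the `a`-th. -/
abbrev cornerRight (a : Fin (k + 1)) {i j : Fin (k + 1)} (h : i ≤ j) :
    corner w a i ⟶ corner w a j :=
  ArTilde.right (fst_le_snd_of_nested w a i) (w.monotone h).2

/-- The complementary part to `cornerRight`. -/
abbrev cornerComplLeft (a : Fin (k + 1)) {i j : Fin (k + 1)} (h : i ≤ j) :
    cornerCompl w h ⟶ corner w a j :=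
  ArTilde.left (fst_le_snd_of_nested w a i) (w.monotone h).2

/-- The inclusion of intervals with the same right endpoint. -/
abbrev cornerLeft {a b : Fin (k + 1)} (h : a ≤ b) (i : Fin (k + 1)) :
    corner w a i ⟶ corner w b i :=
  ArTilde.left (w.monotone h).1 (fst_le_snd_of_nested w a i)

/-- The map in the simplex `X` from the right endpoint of the `a`-th to that of the `b`-th
interval. -/
abbrev sndMap {a b : Fin (k + 1)} (h : a ≤ b) :
    (X.obj (w a).snd).fn ⟶ (X.obj (w b).snd).fn :=
  STilde.Hom.nat (X.map (homOfLE (w.monotone h).2))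

variable (M) in
/-- The chain of cofibrations in the `a`-th row: `X_{l,r}` with `l` the left endpoint of the
`a`-th interval and `r` a right endpoint. -/
def windowObj (a : Fin (k + 1)) : HFun (Fin (k + 1)) M.squares where
  fn :=
    { obj := fun i => (X.obj (w a).snd).fn.obj (corner w a i)
      map := fun h => ⟨(X.obj (w a).snd).fn.map (cornerRight w a (leOfHom h)),
        M.sub_cof ((X.obj (w a).snd).sub _ _)⟩
      map_id := fun _ => Subtype.ext ((X.obj (w a).snd).fn.map_id _)
      map_comp := fun f g => Subtype.ext ((X.obj (w a).snd).fn.map_comp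
        (cornerRight w a (leOfHom f)) (cornerRight w a (leOfHom g))) }

/-- The vertical maps between the rows of a window. -/
def windowApp {a b : Fin (k + 1)} (h : a ≤ b) (i : Fin (k + 1)) :
    (X.obj (w a).snd).fn.obj (corner w a i) ⟶ (X.obj (w b).snd).fn.obj (corner w b i) :=
  (sndMap X w h).app (corner w a i) ≫ (X.obj (w b).snd).fn.map (cornerLeft w h i)

variable (M) in
/-- The vertical transformation between two rows of a window. -/
def windowMap {a b : Fin (k + 1)} (h : a ⟶ b) : M.windowObj X w a ⟶ M.windowObj X w b where
  app i := windowApp X w (leOfHom h) i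
  dist {i j} f := by
    let diagonal : corner w a i ⟶ corner w b j :=
      homOfLE ⟨(w.monotone (leOfHom h)).1, (w.monotone (leOfHom f)).2⟩
    refine M.dist_of_sub (c := (sndMap X w (leOfHom h)).app (cornerCompl w (leOfHom f)))
      ((X.obj (w a).snd).sub _ _) ((X.obj (w b).snd).sub _ _) ?_ ?_ (STilde.Hom.weq _ _)
    · exact (map_comp_app_comp_map _ _ _ diagonal).trans
        (app_comp_map_comp_map _ _ _ diagonal).symm
    · exact (map_comp_app_comp_map _ _ _ _).symm

variable (M) in
/-- The simplex of `T_k` given by a simplex of `S~_m` and a sequence of nested intervals. -/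
def window : Fin (k + 1) ⥤ HFun (Fin (k + 1)) M.squares where
  obj a := M.windowObj X w a
  map h := M.windowMap X w h
  map_id a := VertTrans.ext (funext fun i => by
    have hX : sndMap X w (le_refl a) = 𝟙 _ := congrArg STilde.Hom.nat (X.map_id (w a).snd)
    have hleft : (X.obj (w a).snd).fn.map (cornerLeft w (le_refl a) i) = 𝟙 _ :=
      (X.obj (w a).snd).fn.map_id _
    exact (congrArg₂ (fun (p : (X.obj (w a).snd).fn ⟶ (X.obj (w a).snd).fn) q =>
      p.app (corner w a i) ≫ q) hX hleft).trans (Category.id_comp _))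
  map_comp {a b c} f g := VertTrans.ext (funext fun i => by
    have hX : sndMap X w (leOfHom (f ≫ g)) = sndMap X w (leOfHom f) ≫ sndMap X w (leOfHom g) :=
      congrArg STilde.Hom.nat (X.map_comp (homOfLE (w.monotone (leOfHom f)).2)
        (homOfLE (w.monotone (leOfHom g)).2))
    change windowApp X w (leOfHom (f ≫ g)) i =
      windowApp X w (leOfHom f) i ≫ windowApp X w (leOfHom g) i
    rw [windowApp, hX, windowApp, windowApp, NatTrans.comp_app, Category.assoc, Category.assoc]
    exact congrArg (fun x => _ ≫ x) (map_comp_app_comp_map _ _ _ _).symm)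

end Window

variable (M) in
/-- The map from the edgewise subdivision of `S~` back to `T`, given by the windows of centred
intervals. -/
def windowSSet : subdivision (diagNerve.obj (simplicialS B)) ⟶
    diagNerve.obj (simplicialT M.squares) where
  app n := TypeCat.ofHom fun X =>
    M.window (m := 2 * n.unop.len + 1) X (centredIntervals n.unop.len)
  naturality n l θ := by
    ext X
    change (M.window _ ((intervalsMap (joinMap θ.unop.toOrderHom)).comp
      (centredIntervals l.unop.len)) :
      Fin (l.unop.len + 1) ⥤ HFun (Fin (l.unop.len + 1)) M.squares) = _
    rw [intervalsMap_joinMap_comp_centredIntervals]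
    rfl

end ComplementModel

/-! ## The comparison homotopies -/

lemma mk₁_map_eq_mk₁_comp {C D : Type u} [Category.{v} C] [Category.{v} D] (T : C ⥤ D) {X Y : C}
    (f : X ⟶ Y) : ComposableArrows.mk₁ (T.map f) = ComposableArrows.mk₁ f ⋙ T :=
  ComposableArrows.ext₁ rfl rfl ((Category.id_comp _).trans (Category.comp_id _)).symm

/-- The right endpoints of a sequence of nested intervals. -/
def sndHom {k : ℕ} {Q : Type} [PartialOrder Q] (w : Fin (k + 1) →o NonemptyInterval Q) :
    Fin (k + 1) →o Q :=
  ⟨fun a => (w a).snd, fun _ _ h => (w.monotone h).2⟩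

/-- The functor that restricts simplices of the diagonal of the nerve of a simplicial category
along a map of ordinals. -/
abbrev restriction (𝒳 : SimplexCategoryᵒᵖ ⥤ Cat.{v, u}) {m n : SimplexCategory} (θ : m ⟶ n) :
    (Fin (n.len + 1) ⥤ 𝒳.obj (op n)) ⥤ (Fin (m.len + 1) ⥤ 𝒳.obj (op m)) :=
  whiskerBoth (ordFunctor θ) (𝒳.map θ.op).toFunctor

namespace ComplementModel

open SquaresCategory

variable {B : BundledSW.{v, u}} {M : ComplementModel B} {k m : ℕ}

section Comparison

variable {X Y X' Y' : B.C} {f : B.W.Cof X Y} {f' : B.W.Cof X' Y'}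

lemma exists_weq_complement (K : B.W.Complement f.1) :
    ∃ c : K.obj ⟶ (M.complement f).obj, c ≫ (M.complement f).incl = K.incl ∧ B.W.weq c := by
  obtain ⟨c, hc, hw⟩ := M.exists_weq (M.dist_vid f.2) K.sub (M.complement f).sub
  exact ⟨c, hc.trans (Category.comp_id _), hw⟩

variable (M) in
/-- The map from a complement to the chosen complement. -/
def comparison (K : B.W.Complement f.1) : K.obj ⟶ (M.complement f).obj :=
  (exists_weq_complement K).choose

lemma comparison_incl (K : B.W.Complement f.1) :
    M.comparison K ≫ (M.complement f).incl = K.incl :=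
  (exists_weq_complement K).choose_spec.1

lemma weq_comparison (K : B.W.Complement f.1) : B.W.weq (M.comparison K) :=
  (exists_weq_complement K).choose_spec.2

lemma comparison_naturality {K : B.W.Complement f.1} {K' : B.W.Complement f'.1} {g : Y ⟶ Y'}
    {p : K.obj ⟶ K'.obj} (hp : p ≫ K'.incl = K.incl ≫ g)
    (h : (M.complement f).Restricts (M.complement f') g) :
    p ≫ M.comparison K' = M.comparison K ≫ M.lift h :=
  hom_ext (by
    rw [Category.assoc, comparison_incl, Category.assoc, lift_incl, ← Category.assoc,
      comparison_incl, hp])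

end Comparison

section Unit

variable (X : Fin (m + 1) ⥤ STilde B m) (w : Fin (k + 1) →o NonemptyInterval (Fin (m + 1)))

/-- The restriction of a simplex of `S~` to the right endpoints of nested intervals. -/
def sndRestrictionS : Fin (k + 1) ⥤ STilde B k :=
  (restriction (simplicialS B) (ordHom (m := ⦋k⦌) (n := ⦋m⦌) (sndHom w))).obj X

variable (M) in
/-- The complements of the cofibrations in a window that are part of the given simplex. -/
def windowComplement (a : Fin (k + 1)) (p : ArTilde k) :
    B.W.Complement (M.edge (M.windowObj X w a) p.le).1 where
  obj := (X.obj (w a).snd).fn.obj (cornerCompl w p.le)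
  incl := (X.obj (w a).snd).fn.map (cornerComplLeft w a p.le)
  sub := (X.obj (w a).snd).sub _ _

variable (M) in
/-- The comparison of the complements in the `a`-th row of a window with the chosen ones. -/
def unitApp (a : Fin (k + 1)) : (sndRestrictionS X w).obj a ⟶ complObj (M.windowObj X w a) where
  nat :=
    { app := fun p => M.comparison (M.windowComplement X w a p)
      naturality := fun p q h =>
        comparison_naturality (K := M.windowComplement X w a p) (K' := M.windowComplement X w a q)
          (((X.obj (w a).snd).fn.map_comp _ _).symm.trans ((X.obj (w a).snd).fn.map_comp
            (cornerComplLeft w a p.le) (cornerRight w a (leOfHom h).2)))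
          (restricts_edge (M.windowObj X w a) (leOfHom h)) }
  weq p := weq_comparison (M.windowComplement X w a p)

variable (M) in
/-- The transformation from a restriction of a simplex of `S~` to the chosen complements in its
window. -/
def unitTrans : sndRestrictionS X w ⟶ M.window X w ⋙ M.complFunctor k where
  app a := M.unitApp X w a
  naturality a b h := STilde.Hom.ext (NatTrans.ext (funext fun p =>
    comparison_naturality (M := M) (K := M.windowComplement X w a p)
      (K' := M.windowComplement X w b p)
      (map_comp_app_comp_map (sndMap X w (leOfHom h)) (cornerComplLeft w a p.le)
        (cornerLeft w (leOfHom h) p.j) (cornerComplLeft w b p.le)).symm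
      (restricts_component (M.windowMap X w h) p.le)))

variable (M) in
/-- The homotopy from the last vertex map of `S~` to the complements of windows. -/
def unitHomotopy : SSet.Homotopy (lastVertex (diagNerve.obj (simplicialS B)))
    (M.windowSSet ≫ diagNerve.map M.complTrans) :=
  homotopyOfNatTrans
    (fun {n} X => ComposableArrows.mk₁
      (M.unitTrans (m := 2 * n.len + 1) X (centredIntervals n.len)))
    (fun {k l} θ X => by
      change ComposableArrows.mk₁ (M.unitTrans (m := 2 * l.len + 1) X
        ((intervalsMap (joinMap θ.toOrderHom)).comp (centredIntervals k.len))) = _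
      rw [intervalsMap_joinMap_comp_centredIntervals]
      exact mk₁_map_eq_mk₁_comp (restriction (simplicialS B) θ)
        (M.unitTrans (m := 2 * l.len + 1) X (centredIntervals l.len)))
    (fun _ => rfl)
    (fun _ => rfl)

end Unit

section Counit

variable (A : Fin (m + 1) ⥤ HFun (Fin (m + 1)) M.squares)
  (w : Fin (k + 1) →o NonemptyInterval (Fin (m + 1)))

/-- The restriction of a simplex of `T` to the right endpoints of nested intervals. -/
def sndRestrictionT : Fin (k + 1) ⥤ HFun (Fin (k + 1)) M.squares :=
  (restriction (simplicialT M.squares) (ordHom (m := ⦋k⦌) (n := ⦋m⦌) (sndHom w))).obj A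

/-- The inclusions of the complements in the `a`-th row of the window of `A ⋙ M.complFunctor m`. -/
def counitApp (a : Fin (k + 1)) :
    M.windowObj (A ⋙ M.complFunctor m) w a ⟶ (sndRestrictionT A w).obj a where
  app i := (M.complement (M.edge (A.obj (w a).snd) (fst_le_snd_of_nested w a i))).incl
  dist {i j} h := by
    refine M.dist_of_sub (c := 𝟙 _)
      ((complObj (A.obj (w a).snd)).sub (fst_le_snd_of_nested w a i) (w.monotone (leOfHom h)).2)
      (M.complement (M.edge (A.obj (w a).snd) (w.monotone (leOfHom h)).2)).sub ?_ ?_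
      (B.W.weq_mul.id_mem _)
    · exact M.lift_incl _
    · refine (Category.id_comp _).trans (Eq.symm ((M.lift_incl _).trans ?_))
      exact (congrArg (fun x => _ ≫ x) (edge_refl (A.obj (w a).snd) (w j).snd)).trans
        (Category.comp_id _)

/-- The transformation from the window of the complements of a simplex of `T` to a restriction of
the simplex. -/
def counitTrans : M.window (A ⋙ M.complFunctor m) w ⟶ sndRestrictionT A w where
  app a := counitApp A w a
  naturality a b h := VertTrans.ext (funext fun i => by
    let α := A.map (homOfLE (w.monotone (leOfHom h)).2)
    let lift := M.lift (restricts_component α (fst_le_snd_of_nested w a i))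
    have hedge : (M.complement (M.edge (A.obj (w b).snd) (fst_le_snd_of_nested w a i))).incl ≫
        (M.edge (A.obj (w b).snd) (le_refl (w i).snd)).1 = (M.complement _).incl := by
      rw [edge_refl, Category.comp_id]
    exact ((Category.assoc _ _ _).trans (congrArg (fun x => lift ≫ x) (M.lift_incl _))).trans
      ((congrArg (fun x => lift ≫ x) hedge).trans (M.lift_incl _)))

variable (M) in
/-- The homotopy from the windows of the complements to the last vertex map of `T`. -/
def counitHomotopy : SSet.Homotopy (subdivisionMap (diagNerve.map M.complTrans) ≫ M.windowSSet)
    (lastVertex (diagNerve.obj (simplicialT M.squares))) :=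
  homotopyOfNatTrans
    (fun {n} A => ComposableArrows.mk₁
      (counitTrans (M := M) (m := 2 * n.len + 1) A (centredIntervals n.len)))
    (fun {k l} θ A => by
      change ComposableArrows.mk₁ (counitTrans (M := M) (m := 2 * l.len + 1) A
        ((intervalsMap (joinMap θ.toOrderHom)).comp (centredIntervals k.len))) = _
      rw [intervalsMap_joinMap_comp_centredIntervals]
      exact mk₁_map_eq_mk₁_comp (restriction (simplicialT M.squares) θ)
        (counitTrans (M := M) (m := 2 * l.len + 1) A (centredIntervals l.len)))
    (fun _ => rfl)
    (fun _ => rfl)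

end Counit

variable (M)

lemma isHomotopyEquiv_complTrans :
    IsHomotopyEquiv (SSet.toTop.map (diagNerve.map M.complTrans)).hom := by
  have hS := (isHomotopyEquiv_lastVertex (diagNerve.obj (simplicialS B))).of_homotopic
    (homotopic_toTop_map M.unitHomotopy)
  have hT := (isHomotopyEquiv_lastVertex (diagNerve.obj (simplicialT M.squares))).of_homotopic
    (homotopic_toTop_map M.counitHomotopy).symm
  rw [Functor.map_comp, TopCat.hom_comp] at hS hT
  exact (hT.two_of_six hS).of_comp_right hS

end ComplementModel

/-! ## The comparison of the two K-theories -/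

lemma IsHomotopyEquiv.of_loop_apply_eq {X Y : Type*} [TopologicalSpace X] [TopologicalSpace Y]
    {f : C(X, Y)} (hf : IsHomotopyEquiv f) {x : X} {y : Y} (h : y = f x)
    (g : C(Path x x, Path y y)) (hg : ∀ p t, g p t = f (p t)) : IsHomotopyEquiv g := by
  subst h
  have : g = SquaresK.loopMap f x := ContinuousMap.ext fun p => Path.ext (funext fun t => hg p t)
  rw [this]
  exact hf.loopMap x

lemma isHomotopyEquiv_loopRealization {X Y : PointedSSet.{u}} (f : X ⟶ Y)
    (hf : IsHomotopyEquiv (SSet.toTop.map (PointedSSet.Hom.map f)).hom) :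
    IsHomotopyEquiv (loopRealization.map f).hom :=
  hf.of_loop_apply_eq
    (by
      rw [← PointedSSet.Hom.map_pt f]
      exact (realizationPoint_map (PointedSSet.Hom.map f) X.pt).symm)
    _ (fun _ _ => rfl)

/-- The comparison map between the two versions of `K`-theory. -/
def ComplementModel.kMap {B : BundledSW.{v, u}} (M : ComplementModel B) :
    squaresK.obj M.squares ⟶ swK.obj B :=
  loopRealization.map M.complSSet

lemma ComplementModel.isHomotopyEquiv_kMap {B : BundledSW.{v, u}} (M : ComplementModel B) :
    IsHomotopyEquiv M.kMap.hom :=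
  isHomotopyEquiv_loopRealization _ M.isHomotopyEquiv_complTrans

/-! ## The complement model of an SW-category -/

lemma isPullback_id_comp {C : Type*} [Category* C] {X Y Z : C} (f : X ⟶ Y) (g : Y ⟶ Z) [Mono g] :
    IsPullback (𝟙 X) f (f ≫ g) g := by
  simpa only [Category.comp_id] using
    ((IsPullback.of_vert_isIso ⟨by rw [Category.comp_id, Category.id_comp]⟩ :
      IsPullback f (𝟙 X) (𝟙 Y) f).paste_horiz (IsKernelPair.id_of_mono g)).flip

namespace SWData

variable {C : Type u} [Category.{v} C] {W : SWData C}

lemma IsSubtractive.sub_of_sub_comp (hS : W.IsSubtractive) {X P Y U V : C} {a : X ⟶ P} {p : P ⟶ Y}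
    [Mono p] {j : U ⟶ Y} {q : V ⟶ U} {j' : V ⟶ P} (hj : W.sub (a ≫ p) j)
    (hV : IsPullback q j' j p) : W.sub a j' :=
  hS.sub_baseChange hj (isPullback_id_comp a p) hV

lemma IsSubtractive.isIso_of_sub_comp (hS : W.IsSubtractive) (hm : W.MonoCof)
    {X P Y U X' Y' U' : C} {a : X ⟶ P} {p : P ⟶ Y} [Mono p] {q : P ⟶ X'} {j : U ⟶ Y}
    {i' : X' ⟶ Y'} {j' : U' ⟶ Y'} {g : Y ⟶ Y'} {c : U ⟶ U'} (hj : W.sub (a ≫ p) j)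
    (hj' : W.sub i' j') (hq : p ≫ g = q ≫ i') (hc : c ≫ j' = j ≫ g) : IsIso a := by
  have := hS.fib_hasPullback j p (hS.sub_fib hj)
  have hsub : W.sub a (pullback.fst p j) :=
    hS.sub_of_sub_comp hj (IsPullback.of_hasPullback p j).flip
  have hdisjoint : (pullback.fst p j ≫ q) ≫ i' = (pullback.snd p j ≫ c) ≫ j' := by
    rw [Category.assoc, Category.assoc, ← hq, hc, pullback.condition_assoc]
  obtain ⟨e⟩ := disjoint_of_sub hS hm hj' hdisjoint
  exact isIso_of_sub_initial' hS hsub e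

lemma IsSubtractive.isIso_fst_of_sub_comp (hS : W.IsSubtractive) (hm : W.MonoCof)
    {X Y Z V K T : C} {f : X ⟶ Y} {g : Y ⟶ Z} {l : V ⟶ Z} {k : K ⟶ Z} {t : T ⟶ V} {s : T ⟶ K}
    (hl : W.sub g l) (hk : W.sub (f ≫ g) k) (hT : IsPullback t s l k) : IsIso t := by
  have := hS.cof_hasPullback (f ≫ g) l (hS.sub_cof hk)
  have hsub : W.sub (pullback.fst l (f ≫ g)) t :=
    hS.sub_baseChange hk (IsPullback.of_hasPullback l (f ≫ g)).flip hT.flip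
  have hdisjoint : (pullback.snd l (f ≫ g) ≫ f) ≫ g = pullback.fst l (f ≫ g) ≫ l := by
    rw [pullback.condition, Category.assoc]
  obtain ⟨e⟩ := disjoint_of_sub hS hm hl hdisjoint
  exact isIso_of_sub_initial hS hsub e

lemma IsSubtractive.exists_sub_comp (hS : W.IsSubtractive) (hm : W.MonoCof) {X Y Z U V K : C}
    {f : X ⟶ Y} {g : Y ⟶ Z} {j : U ⟶ Y} {l : V ⟶ Z} {k : K ⟶ Z} (hj : W.sub f j)
    (hl : W.sub g l) (hk : W.sub (f ≫ g) k) :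
    ∃ (a : U ⟶ K) (b : V ⟶ K), a ≫ k = j ≫ g ∧ b ≫ k = l ∧ W.sub a b := by
  have := hm g (hS.sub_cof hl)
  have := hS.fib_hasPullback k g (hS.sub_fib hk)
  have := hS.fib_hasPullback k l (hS.sub_fib hk)
  have hU := IsPullback.of_hasPullback g k
  have hV := IsPullback.of_hasPullback l k
  have hf : W.sub f (pullback.fst g k) := hS.sub_of_sub_comp hk hU.flip
  obtain ⟨e, he, -⟩ := hS.sub_unique hj hf
  have := hS.isIso_fst_of_sub_comp hm hl hk hV
  refine ⟨e.hom ≫ pullback.snd g k, inv (pullback.fst l k) ≫ pullback.snd l k, ?_, ?_,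
    sub_iso hS (hS.sub_baseChange hl hU hV) e (asIso (pullback.fst l k)).symm⟩
  · rw [Category.assoc, ← pullback.condition, ← Category.assoc, he]
  · rw [Category.assoc, ← pullback.condition, IsIso.inv_hom_id_assoc]

lemma Dist.exists_weq (hW : W.IsSW) {X Y U X' Y' U' : C} {i : X ⟶ Y} {j : U ⟶ Y}
    {i' : X' ⟶ Y'} {j' : U' ⟶ Y'} {g : X ⟶ X'} {g' : Y ⟶ Y'} (h : W.Dist i i' g g')
    (hj : W.sub i j) (hj' : W.sub i' j') : ∃ c : U ⟶ U', c ≫ j' = j ≫ g' ∧ W.weq c := by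
  obtain ⟨-, -, V, V', k, k', c, hk, hk', hc, hw⟩ := h
  obtain ⟨e, he, -⟩ := hW.sub_unique hj hk
  obtain ⟨e', he', -⟩ := hW.sub_unique hk' hj'
  refine ⟨e.hom ≫ c ≫ e'.hom, ?_,
    weq_comp W (weq_of_isIso hW _) (weq_comp W hw (weq_of_isIso hW _))⟩
  rw [Category.assoc, Category.assoc, he', hc, ← Category.assoc, he]

lemma Dist.of_sub (hW : W.IsSW) (hm : W.MonoCof) {X Y U X' Y' U' : C} {i : X ⟶ Y} {j : U ⟶ Y}
    {i' : X' ⟶ Y'} {j' : U' ⟶ Y'} {g : X ⟶ X'} {g' : Y ⟶ Y'} {c : U ⟶ U'} (hj : W.sub i j)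
    (hj' : W.sub i' j') (w : i ≫ g' = g ≫ i') (hc : c ≫ j' = j ≫ g') (hw : W.weq c) :
    W.Dist i i' g g' := by
  have := hW.cof_hasPullback i' g' (hW.sub_cof hj')
  have hP := IsPullback.of_hasPullback g' i'
  have := hm _ (hW.cof_baseChange.of_isPullback hP.flip (hW.sub_cof hj'))
  have hlift : IsIso (hP.lift i g w) :=
    hW.toIsSubtractive.isIso_of_sub_comp hm (p := pullback.fst g' i')
      (by rwa [hP.lift_fst]) hj' hP.w hc
  exact ⟨w, ⟨_, _, _, hP, weq_of_isIso hW _⟩, U, U', j, j', c, hj, hj', hc, hw⟩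

open scoped Classical in
/-- A choice of complements of cofibrations. It takes the object `W.O` if possible, so that the
basepoints are preserved strictly. -/
def chosenComplement (hS : W.IsSubtractive) {X Y : C} (f : W.Cof X Y) : W.Complement f.1 :=
  if h : W.sub f.1 (hS.initial.some.to Y) then ⟨W.O, _, h⟩
  else ⟨_, _, (hS.exists_sub f.1 f.2).choose_spec.choose_spec⟩

lemma chosenComplement_id_O (hS : W.IsSubtractive) (h : W.cof (𝟙 W.O)) :
    (chosenComplement hS ⟨𝟙 W.O, h⟩).obj = W.O := by
  rw [chosenComplement, dif_pos (hS.sub_id _)]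

/-- The complement model of an SW-category. -/
def model (W : SWData C) (hW : W.IsSW) (hm : W.MonoCof) (hs : W.Star) :
    ComplementModel (⟨C, inferInstance, W⟩ : BundledSW.{v, u}) where
  dist := W.Dist
  dist_vcomp := Dist.vcomp hW hm
  dist_hcomp := Dist.hcomp hW hm hs
  dist_comm h := h.1
  dist_vid := Dist.vid hW
  dist_hid := Dist.hid hW
  initial := hW.initial
  cof_initial f := hW.sub_cof (hW.sub_initial f)
  sub_cof := hW.sub_cof
  mono_of_sub := mono_of_sub hW.toIsSubtractive hm
  complement := chosenComplement hW.toIsSubtractive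
  lift h := h.choose
  lift_incl h := h.choose_spec
  complement_id_O := chosenComplement_id_O hW.toIsSubtractive _
  iso_O_of_sub_id h := iso_O_of_sub_isIso hW.toIsSubtractive h
  exists_weq h := h.exists_weq hW
  dist_of_sub := Dist.of_sub hW hm
  exists_sub_comp := hW.toIsSubtractive.exists_sub_comp hm

end SWData

/-! ## Sum diagrams -/

namespace SWData

variable {C : Type u} [Category.{v} C] {W : SWData C}

lemma IsSubtractive.exists_coproduct (hS : W.IsSubtractive) (X Y : C) :
    ∃ (T : C) (a : X ⟶ T) (b : Y ⟶ T), Nonempty (IsColimit (BinaryCofan.mk a b)) := by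
  obtain ⟨I⟩ := hS.initial
  have := hS.cof_hasPushout (I.to X) (I.to Y) (hS.sub_cof (hS.sub_initial _))
    (hS.sub_cof (hS.sub_initial _))
  exact ⟨_, _, _, ⟨isCoproductOfIsInitialIsPushout _ _ _ _ I
    (IsPushout.of_hasPushout (I.to X) (I.to Y)).isColimit⟩⟩

lemma IsSubtractive.exists_coproduct_complement (hS : W.IsSubtractive) (hc : W.SumsSubtractive)
    {X₁ X₂ X Y₁ Y₂ Y : C} {x₁ : X₁ ⟶ X} {x₂ : X₂ ⟶ X} {y₁ : Y₁ ⟶ Y} {y₂ : Y₂ ⟶ Y}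
    {i₁ : X₁ ⟶ Y₁} {i₂ : X₂ ⟶ Y₂} {i : X ⟶ Y}
    (hx : Nonempty (IsColimit (BinaryCofan.mk x₁ x₂)))
    (hy : Nonempty (IsColimit (BinaryCofan.mk y₁ y₂))) (h₁ : i₁ ≫ y₁ = x₁ ≫ i)
    (h₂ : i₂ ≫ y₂ = x₂ ≫ i) (K₁ : W.Complement i₁) (K₂ : W.Complement i₂) (K : W.Complement i) :
    ∃ (u₁ : K₁.obj ⟶ K.obj) (u₂ : K₂.obj ⟶ K.obj), u₁ ≫ K.incl = K₁.incl ≫ y₁ ∧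
      u₂ ≫ K.incl = K₂.incl ≫ y₂ ∧ Nonempty (IsColimit (BinaryCofan.mk u₁ u₂)) := by
  obtain ⟨T, t₁, t₂, ⟨hT⟩⟩ := hS.exists_coproduct K₁.obj K₂.obj
  obtain ⟨k, hk₁, hk₂⟩ : ∃ k : T ⟶ Y, t₁ ≫ k = K₁.incl ≫ y₁ ∧ t₂ ≫ k = K₂.incl ≫ y₂ := by
    obtain ⟨k, hk₁, hk₂⟩ := BinaryCofan.IsColimit.desc' hT (K₁.incl ≫ y₁) (K₂.incl ≫ y₂)
    exact ⟨k, hk₁, hk₂⟩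
  have hk : W.sub i k := hc hx hy ⟨hT⟩ h₁ h₂ hk₁.symm hk₂.symm K₁.sub K₂.sub
  obtain ⟨e, he, -⟩ := hS.sub_unique hk K.sub
  exact ⟨t₁ ≫ e.hom, t₂ ≫ e.hom, by rw [Category.assoc, he, hk₁],
    by rw [Category.assoc, he, hk₂], ⟨IsColimit.ofIsoColimit hT (BinaryCofan.ext e rfl rfl)⟩⟩

/-- The components of a pointwise cofibration of sum diagrams. -/
abbrev cofApp {S : Type} {hI : Nonempty (IsInitial W.O)} {A A' : SumDiag C S}
    (f : (W.sums hI S).W.Cof A A') (U : Set S) : W.Cof (A.fn.obj U) (A'.fn.obj U) :=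
  ⟨SumDiag.app f.1 U, f.2 U⟩

end SWData

namespace SumDiag

variable {C : Type u} [Category.{v} C] {S : Type}

lemma ext_fn {A B : SumDiag C S} (h : A.fn = B.fn) : A = B := by
  obtain ⟨_, _, _⟩ := A
  obtain ⟨_, _, _⟩ := B
  obtain rfl := h
  rfl

lemma mono_of_app {A B : SumDiag C S} (f : A ⟶ B) (h : ∀ U, Mono (app f U)) : Mono f where
  right_cancellation _ _ e := NatTrans.ext (funext fun U =>
    (h U).right_cancellation _ _ (congrArg (fun a => app a U) e))

lemma app_comp_map {A B : SumDiag C S} (f : A ⟶ B) {U V : Set S} (h : U ≤ V) :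
    app f U ≫ B.fn.map (homOfLE h) = A.fn.map (homOfLE h) ≫ app f V :=
  (NatTrans.naturality f (homOfLE h)).symm

/-- The morphism of sum diagrams given by a pointwise factorization of `f` through a pointwise
monomorphism `g`. -/
def factor {A B D : SumDiag C S} (f : A ⟶ D) (g : B ⟶ D) (hg : ∀ U, Mono (app g U))
    (c : ∀ U, A.fn.obj U ⟶ B.fn.obj U) (hc : ∀ U, c U ≫ app g U = app f U) : A ⟶ B where
  app := c
  naturality U V h := (hg V).right_cancellation _ _ (by
    have hf := app_comp_map f (leOfHom h)
    have hg := app_comp_map g (leOfHom h)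
    rw [Category.assoc, hc, Category.assoc]
    exact hf.symm.trans (by rw [← hc, Category.assoc, hg]; rfl))

lemma factor_comp {A B D : SumDiag C S} (f : A ⟶ D) (g : B ⟶ D) (hg : ∀ U, Mono (app g U))
    (c : ∀ U, A.fn.obj U ⟶ B.fn.obj U) (hc : ∀ U, c U ≫ app g U = app f U) :
    factor f g hg c hc ≫ g = f :=
  NatTrans.ext (funext hc)

def isInitialOfObj {A : SumDiag C S} (h : ∀ U, IsInitial (A.fn.obj U)) : IsInitial A :=
  IsInitial.ofUniqueHom
    (fun B => { app := fun U => (h U).to (B.fn.obj U)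
                naturality := fun _ _ _ => (h _).hom_ext _ _ })
    (fun _ _ => NatTrans.ext (funext fun U => (h U).hom_ext _ _))

end SumDiag

namespace ComplementModel

variable {B : BundledSW.{v, u}} (M : ComplementModel B) {S : Type}

section SumComplement

variable {M} {A A' : SumDiag B.C S}

variable (hS : B.W.IsSubtractive) (hc : B.W.SumsSubtractive)
  (f : (B.W.sums M.initial S).W.Cof A A')

include hS hc

lemma exists_coproduct_complement_cofApp {U V X : Set S} (hU : U ≤ X) (hV : V ≤ X)
    (h : Disjoint U V) (h' : U ∪ V = X) :
    ∃ (u : (M.complement (SWData.cofApp f U)).obj ⟶ (M.complement (SWData.cofApp f X)).obj)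
      (v : (M.complement (SWData.cofApp f V)).obj ⟶ (M.complement (SWData.cofApp f X)).obj),
      u ≫ (M.complement (SWData.cofApp f X)).incl =
        (M.complement (SWData.cofApp f U)).incl ≫ A'.fn.map (homOfLE hU) ∧
      v ≫ (M.complement (SWData.cofApp f X)).incl =
        (M.complement (SWData.cofApp f V)).incl ≫ A'.fn.map (homOfLE hV) ∧
      Nonempty (IsColimit (BinaryCofan.mk u v)) :=
  hS.exists_coproduct_complement hc (A.sum hU hV h h') (A'.sum hU hV h h')
    (SumDiag.app_comp_map f.1 hU) (SumDiag.app_comp_map f.1 hV) _ _ _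

lemma restricts_map {U X : Set S} (hU : U ≤ X) :
    (M.complement (SWData.cofApp f U)).Restricts (M.complement (SWData.cofApp f X))
      (A'.fn.map (homOfLE hU)) := by
  obtain ⟨u, -, hu, -⟩ := exists_coproduct_complement_cofApp hS hc f hU
    (Set.sdiff_subset (t := U)) Set.disjoint_sdiff_right (Set.union_sdiff_cancel hU)
  exact ⟨u, hu⟩

variable (M) in
/-- The pointwise complement of a pointwise cofibration of sum diagrams. -/
def sumComplement : (B.W.sums M.initial S).W.Complement f.1 where
  obj :=
    { fn :=
        { obj := fun U => (M.complement (SWData.cofApp f U)).obj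
          map := fun h => M.lift (restricts_map hS hc f (leOfHom h))
          map_id := fun U => lift_eq _
            ((Category.id_comp _).trans ((Category.comp_id _).symm.trans
              (congrArg (fun x => _ ≫ x) (A'.fn.map_id U).symm)))
          map_comp := fun g h => lift_eq _
            ((lift_comp_lift_incl _ _).trans
              (congrArg (fun x => _ ≫ x) (A'.fn.map_comp g h).symm)) }
      empty := fun {U} hU => by
        obtain ⟨I⟩ := hS.initial
        obtain ⟨J⟩ := A'.empty hU
        obtain ⟨e⟩ := SWData.iso_O_of_hom hS ((M.complement (SWData.cofApp f U)).incl ≫ J.to B.W.O)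
        exact ⟨I.ofIso e.symm⟩
      sum := fun hU hV h h' => by
        obtain ⟨u, v, hu, hv, hcolim⟩ := exists_coproduct_complement_cofApp hS hc f hU hV h h'
        rwa [← lift_eq (restricts_map hS hc f hU) hu,
          ← lift_eq (restricts_map hS hc f hV) hv] at hcolim }
  incl :=
    { app := fun U => (M.complement (SWData.cofApp f U)).incl
      naturality := fun _ _ _ => M.lift_incl _ }
  sub U := (M.complement (SWData.cofApp f U)).sub

end SumComplement

lemma mono_app_of_sub {A A' D : SumDiag B.C S} {i : A ⟶ A'} {j : D ⟶ A'}
    (h : (B.W.sums M.initial S).W.sub i j) (U : Set S) : Mono (SumDiag.app j U) :=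
  M.mono_of_sub (h U)

lemma exists_sumDiag_sub_comp {X Y Z D E K : SumDiag B.C S} {f : X ⟶ Y} {g : Y ⟶ Z} {j : D ⟶ Y}
    {l : E ⟶ Z} {k : K ⟶ Z} (hj : (B.W.sums M.initial S).W.sub f j)
    (hl : (B.W.sums M.initial S).W.sub g l) (hk : (B.W.sums M.initial S).W.sub (f ≫ g) k) :
    ∃ (a : D ⟶ K) (b : E ⟶ K), a ≫ k = j ≫ g ∧ b ≫ k = l ∧
      (B.W.sums M.initial S).W.sub a b := by
  choose a b ha hb hab using fun U => M.exists_sub_comp (hj U) (hl U) (hk U)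
  have hmono := M.mono_app_of_sub hk
  exact ⟨SumDiag.factor (j ≫ g) k hmono a ha, SumDiag.factor l k hmono b hb,
    SumDiag.factor_comp _ _ _ _ _, SumDiag.factor_comp _ _ _ _ _, hab⟩

/-- The pointwise complement model of the category of sum diagrams. -/
def sums (hS : B.W.IsSubtractive) (hc : B.W.SumsSubtractive) (S : Type) :
    ComplementModel (B.W.sums M.initial S) where
  dist f f' g g' := ∀ U, M.dist (SumDiag.app f U) (SumDiag.app f' U) (SumDiag.app g U)
    (SumDiag.app g' U)
  dist_vcomp h₁ h₂ U := M.dist_vcomp (h₁ U) (h₂ U)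
  dist_hcomp h₁ h₂ U := M.dist_hcomp (h₁ U) (h₂ U)
  dist_comm h := NatTrans.ext (funext fun U => M.dist_comm (h U))
  dist_vid hf U := M.dist_vid (hf U)
  dist_hid g U := M.dist_hid (SumDiag.app g U)
  initial := ⟨SumDiag.isInitialOfObj fun _ => M.initial.some⟩
  cof_initial f U := M.cof_initial (SumDiag.app f U)
  sub_cof h U := M.sub_cof (h U)
  mono_of_sub h := SumDiag.mono_of_app _ (M.mono_app_of_sub h)
  complement f := M.sumComplement hS hc f
  lift {_ _ _ _ f f' g} h :=
    SumDiag.factor ((M.sumComplement hS hc f).incl ≫ g) (M.sumComplement hS hc f').incl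
      (M.mono_app_of_sub (M.sumComplement hS hc f').sub)
      (fun U => M.lift (g := SumDiag.app g U)
        (h.elim fun c hc => ⟨SumDiag.app c U, congrArg (fun a => SumDiag.app a U) hc⟩))
      (fun U => M.lift_incl _)
  lift_incl _ := SumDiag.factor_comp _ _ _ _ _
  complement_id_O := SumDiag.ext_fn
    (functor_eq_const_of_isInitial M.initial.some fun _ => M.complement_id_O)
  iso_O_of_sub_id h := ⟨IsInitial.uniqueUpToIso
    (SumDiag.isInitialOfObj fun U => M.initial.some.ofIso (M.iso_O_of_sub_id (h U)).some.symm)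
    (SumDiag.isInitialOfObj fun _ => M.initial.some)⟩
  exists_weq {_ _ _ _ _ _ _ j _ j' _ g'} h hj hj' := by
    choose c hc hw using fun U => M.exists_weq (h U) (hj U) (hj' U)
    exact ⟨SumDiag.factor (j ≫ g') j' (M.mono_app_of_sub hj') c hc,
      SumDiag.factor_comp _ _ _ _ _, hw⟩
  dist_of_sub hj hj' w hc hw U := M.dist_of_sub (hj U) (hj' U)
    (congrArg (fun a => SumDiag.app a U) w) (congrArg (fun a => SumDiag.app a U) hc) (hw U)
  exists_sub_comp := M.exists_sumDiag_sub_comp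

end ComplementModel

namespace SWData

variable {C : Type u} [Category.{v} C] (W : SWData C) (hW : W.IsSW) (hm : W.MonoCof)
  (hs : W.Star) (hc : W.SumsSubtractive)

/-- The complement model of the sum diagrams in an SW-category. -/
abbrev sumModel (S : Type) : ComplementModel (W.sums hW.initial S) :=
  (W.model hW hm hs).sums hW.toIsSubtractive hc S

lemma complSSet_naturality {S T : Type} (m : SetMap S T) :
    pointedT.map (W.sumSquaresMap hW hm hs m) ≫ (W.sumModel hW hm hs hc T).complSSet =
      (W.sumModel hW hm hs hc S).complSSet ≫ pointedS.map (W.sumsMap hW.initial m) :=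
  rfl

/-- The comparison map of `Γ`-spaces. -/
def kGammaMap : W.squaresKGamma hW hm hs ⟶ W.swKGamma hW.initial where
  app S := (W.sumModel hW hm hs hc S.obj).kMap
  naturality _ _ φ := (loopRealization.map_comp _ _).symm.trans
    ((congrArg (fun f => loopRealization.map f)
      (W.complSSet_naturality hW hm hs hc (SetMap.ofPFun φ.hom))).trans
      (loopRealization.map_comp _ _))

end SWData

end SquaresK

end

theorem mainTheorem7 {C : Type u} [CategoryTheory.Category.{v} C] (W : SquaresK.SWData C)
    (hW : W.IsSW) (hm : W.MonoCof) (hs : W.Star) :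
    Nonempty (W.K ≃ₕ SquaresK.squaresK.obj (W.squares hW hm hs)) ∧
    (W.SumsSubtractive →
      SquaresK.GammaEquiv (W.swKGamma hW.initial) (W.squaresKGamma hW hm hs)) := by
  constructor
  · obtain ⟨e, -⟩ := (W.model hW hm hs).isHomotopyEquiv_kMap
    exact ⟨e.symm⟩
  · intro hc
    exact Relation.EqvGen.symm _ _ (Relation.EqvGen.rel _ _
      ⟨W.kGammaMap hW hm hs hc, fun S => (W.sumModel hW hm hs hc S.obj).isHomotopyEquiv_kMap⟩)
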